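/- **Notation.** Let $\chi$ be a real primitive Dirichlet character modulo $D$, and put $\mathcal L=\log D$, $Q=\exp(\mathcal L^2)$, $\alpha=\mathcal L^{-2}=(\log Q)^{-1}$, $R=\pi\left\lfloor\frac{\log\mathcal L}{30\pi}\right\rfloor-\frac{\pi}{2}$, $\omega=\alpha R$, $s_0=\frac12+iD$. Define $\nu,\upsilon,\lambda_+,\lambda_-$ by $$\sum_{n\ge1}\frac{\nu(n)}{n^s}=\zeta(s)L(s,\chi),\quad \sum_{n\ge1}\frac{\upsilon(n)}{n^s}=\frac1{\zeta(s)L(s,\chi)},\quad \sum_{n\ge1}\frac{\lambda_\pm(n)}{n^s}=\frac{\zeta(s\pm\alpha)}{\zeta(s\mp\alpha)},$$ and for $x>0$ $$\vartheta(x)=\frac1{2\pi i}\int_{\Re s=1}x^sY(s)\,ds,\qquad Y(s)=\frac{5\alpha\,(Q^{s/10}-Q^{-s/10})\,e^{s^2/4}}{s^2}.$$ Let $$\Omega_1=\{-2\alpha^{1/2}<\Re(s-s_0)<1,\ |\Im(s-s_0)|<1+20\mathcal L\},$$ $$\Omega_2=\{-\tfrac1{10}\alpha\log\mathcal L<\Re(s-s_0)<\tfrac12,\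 |\Im(s-s_0)|<1+10\mathcal L\}.$$ For a Dirichlet character $\psi$ modulo $q$ put $$F(s,\psi)=\sum_{n\le D^5}\frac{\nu(n)\psi(n)}{n^s},\qquad G(s,\psi)=\sum_{n\le D^5}\frac{\upsilon(n)\psi(n)}{n^s}.$$ For primitive $\psi$, let $\Delta(s,\psi)$ be the meromorphic function $L(s,\psi)/L(1-s,\bar\psi)$. When $\psi$ and $\psi\chi$ are primitive, put $$\mathcal F(s,\psi)=F(s,\psi)+\Delta(s,\psi)\Delta(s,\psi\chi)F(1-s,\bar\psi).$$ Let $\Psi$ be the set of primitive characters $\psi$ modulo $q$, where $q$ runs over the squarefree integers with $Q<q<2Q$ and $(q,6)=1$, such that $\psi\chi$ is primitive modulo $[q,D]$. Let $\Psi^*$ be the set of $\psi\in\Psi$ satisfying $$\sup_{s\in\Omega_1}\{|F(s,\psi)|+|G(s,\psi)|\}<\mathcal L^3\log\mathcal L,\qquad \sup_{s\in\Omega_1}|F(s,\psi)G(s,\psi)-1|<\tfrac12,$$ $$\sup_{s\in\Omega_2}|L(s,\psi)L(s,\psi\chi)-\mathcal F(s,\psi)|<\mathcal L^{-24/5}.$$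 For $\psi\in\Psi^*$ let $S(\psi)$ be the set of zeros $\rho$ of $L(s,\psi)L(s,\psi\chi)$ with $|\Im\rho-D|<1$, and put $$\mathcal K_\pm(s,\psi)=\frac{L(s\pm\alpha,\psi)\,L(s\mp\alpha,\psi\chi)}{F(s,\psi)}.$$ **Lemma 4.4.** There are absolute constants $C$ and $D_0$ such that for all $D\ge D_0$, every real primitive character $\chi$ modulo $D$, every $\psi\in\Psi^*$, every $\rho\in S(\psi)$ and every complex $s$ with $|s|\le3\omega$, $$\left|\mathcal K_+(\rho+s,\psi)-\left(\sum_{n\le Q^{3/2}}\frac{\lambda_+(n)\psi(n)}{n^{\rho+s}}\vartheta\Big(\frac{Q^{4/3}}n\Big)-Q^{-2s}\sum_{n\le Q}\frac{\lambda_-(n)\bar\psi(n)}{n^{1-\rho-s}}\vartheta\Big(\frac{Q^{2/3}}n\Big)\right)\right|\le C\mathcal L^{-3/5}$$ and $$\left|\mathcal K_-(\rho+s,\psi)-\left(\sum_{n\le Q^{3/2}}\frac{\lambda_-(n)\psi(n)}{n^{\rho+s}}\vartheta\Big(\frac{Q^{4/3}}n\Big)-Q^{-2s}\sum_{n\le Q}\frac{\lambda_+(n)\bar\psi(n)}{n^{1-\rho-s}}\vartheta\Big(\frac{Q^{2/3}}n\Big)\right)\right|\le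 C\mathcal L^{-3/5}.$$ -/

import Mathlib

open Complex MeasureTheory DirichletCharacter

noncomputable section

namespace LandauSiegel

/-! ### Parameters attached to the modulus `D` -/

/-- `𝓛 = log D`. -/
def logD (D : ℕ) : ℝ := Real.log D

/-- `Q = exp (𝓛 ^ 2)`. -/
def bigQ (D : ℕ) : ℝ := Real.exp (logD D ^ 2)

/-- `α = 𝓛 ^ (-2) = (log Q)⁻¹`. -/
def alpha (D : ℕ) : ℝ := (logD D ^ 2)⁻¹

/-- `R = π ⌊log 𝓛 / (30 π)⌋ - π / 2`. -/
def bigR (D : ℕ) : ℝ := Real.pi * ⌊Real.log (logD D) / (30 * Real.pi)⌋ - Real.pi / 2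

/-- `ω = α R`. -/
def omega (D : ℕ) : ℝ := alpha D * bigR D

/-- `s₀ = 1 / 2 + i D`. -/
def sZero (D : ℕ) : ℂ := 1 / 2 + D * I

/-- The rectangle `Ω₁`. -/
def Omega1 (D : ℕ) : Set ℂ :=
  {s | -2 * Real.sqrt (alpha D) < (s - sZero D).re ∧ (s - sZero D).re < 1 ∧
    |(s - sZero D).im| < 1 + 20 * logD D}

/-- The rectangle `Ω₂`. -/
def Omega2 (D : ℕ) : Set ℂ :=
  {s | -(1 / 10) * alpha D * Real.log (logD D) < (s - sZero D).re ∧ (s - sZero D).re < 1 / 2 ∧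
    |(s - sZero D).im| < 1 + 10 * logD D}

/-! ### Arithmetic functions -/

/-- `ν = 1 * χ`, the coefficients of `ζ(s) L(s, χ)`. -/
def nu {D : ℕ} (χ : DirichletCharacter ℂ D) : ℕ → ℂ :=
  LSeries.convolution (fun _ => 1) (fun n => χ n)

/-- `υ = μ * (χ μ)`, the coefficients of `ζ(s)⁻¹ L(s, χ)⁻¹`. -/
def upsilon {D : ℕ} (χ : DirichletCharacter ℂ D) : ℕ → ℂ :=
  LSeries.convolution (fun n => (ArithmeticFunction.moebius n : ℂ))
    (fun n => χ n * (ArithmeticFunction.moebius n : ℂ))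

/-- The coefficients of `ζ(s + a) / ζ(s - a)`, i.e. `n ↦ ∑_{k m = n} k ^ (-a) μ(m) m ^ a`. -/
def zetaRatioCoeff (a : ℝ) : ℕ → ℂ :=
  LSeries.convolution (fun n => (n : ℂ) ^ (-a : ℂ))
    (fun n => (ArithmeticFunction.moebius n : ℂ) * (n : ℂ) ^ (a : ℂ))

/-- `λ₊(n)`: the coefficients of `ζ(s + α) / ζ(s - α)`. -/
def lambdaPlus (D : ℕ) : ℕ → ℂ := zetaRatioCoeff (alpha D)

/-- `λ₋(n)`: the coefficients of `ζ(s - α) / ζ(s + α)`. -/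
def lambdaMinus (D : ℕ) : ℕ → ℂ := zetaRatioCoeff (-alpha D)

theorem nu_LSeries {D : ℕ} [NeZero D] (χ : DirichletCharacter ℂ D) {s : ℂ} (hs : 1 < s.re) :
    LSeriesHasSum (nu χ) s (riemannZeta s * LFunction χ s) := by
  rw [LFunction_eq_LSeries χ hs]
  exact (LSeriesHasSum_one hs).convolution (LSeriesSummable_of_one_lt_re χ hs).LSeriesHasSum

theorem upsilon_LSeries {D : ℕ} [NeZero D] (χ : DirichletCharacter ℂ D) {s : ℂ}
    (hs : 1 < s.re) :
    LSeriesHasSum (upsilon χ) s ((riemannZeta s)⁻¹ * (LFunction χ s)⁻¹) := by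
  have h1 : LSeriesHasSum (fun n => (ArithmeticFunction.moebius n : ℂ)) s (riemannZeta s)⁻¹ := by
    have := (ArithmeticFunction.LSeriesSummable_moebius_iff.mpr hs).LSeriesHasSum
    have h := LSeries_one_mul_Lseries_moebius hs
    rw [LSeries_one_eq_riemannZeta hs] at h
    rwa [eq_inv_of_mul_eq_one_right h] at this
  have h2 : LSeriesHasSum (fun n => χ n * (ArithmeticFunction.moebius n : ℂ)) s
      (LFunction χ s)⁻¹ := by
    have := (LSeriesSummable_mul χ
      (ArithmeticFunction.LSeriesSummable_moebius_iff.mpr hs)).LSeriesHasSum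
    have h := LSeries.mul_mu_eq_one χ hs
    rw [← LFunction_eq_LSeries χ hs] at h
    rwa [eq_inv_of_mul_eq_one_right h] at this
  exact h1.convolution h2

theorem LSeries_term_mul_cpow (f : ℕ → ℂ) (a s : ℂ) (n : ℕ) :
    LSeries.term (fun n => f n * (n : ℂ) ^ a) s n = LSeries.term f (s - a) n := by
  rcases eq_or_ne n 0 with rfl | hn
  · simp
  · have hn' : (n : ℂ) ≠ 0 := by exact_mod_cast hn
    rw [LSeries.term_of_ne_zero hn, LSeries.term_of_ne_zero hn, cpow_sub _ _ hn']
    have : (n : ℂ) ^ s ≠ 0 := by simp [cpow_eq_zero_iff, hn']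
    have : (n : ℂ) ^ a ≠ 0 := by simp [cpow_eq_zero_iff, hn']
    field_simp

theorem zetaRatioCoeff_LSeries (a : ℝ) {s : ℂ} (hs : 1 + |a| < s.re) :
    LSeriesHasSum (zetaRatioCoeff a) s (riemannZeta (s + a) / riemannZeta (s - a)) := by
  have h1 : 1 < (s + a).re := by simp; linarith [neg_abs_le a]
  have h2 : 1 < (s - a).re := by simp; linarith [le_abs_self a]
  have e1 : LSeriesHasSum (fun n => (n : ℂ) ^ (-a : ℂ)) s (riemannZeta (s + a)) := by
    have := LSeriesHasSum_one h1
    unfold LSeriesHasSum at this ⊢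
    convert! this using 1
    ext n
    have h := LSeries_term_mul_cpow 1 (-a) s n
    simpa using h
  have e2 : LSeriesHasSum
      (fun n => (ArithmeticFunction.moebius n : ℂ) * (n : ℂ) ^ (a : ℂ)) s
      (riemannZeta (s - a))⁻¹ := by
    have := (ArithmeticFunction.LSeriesSummable_moebius_iff.mpr h2).LSeriesHasSum
    have h := LSeries_one_mul_Lseries_moebius h2
    rw [LSeries_one_eq_riemannZeta h2] at h
    rw [eq_inv_of_mul_eq_one_right h] at this
    unfold LSeriesHasSum at this ⊢
    convert! this using 1
    ext n
    exact LSeries_term_mul_cpow _ a s n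
  rw [div_eq_mul_inv]
  exact e1.convolution e2

/-! ### The weight `ϑ` -/

/-- `Y(s) = 5 α (Q ^ (s / 10) - Q ^ (-s / 10)) exp (s ^ 2 / 4) / s ^ 2`. -/
def weightY (D : ℕ) (s : ℂ) : ℂ :=
  5 * alpha D * ((bigQ D : ℂ) ^ (s / 10) - (bigQ D : ℂ) ^ (-s / 10)) * exp (s ^ 2 / 4) / s ^ 2

/-- `ϑ(x) = (2 π i)⁻¹ ∫_{Re s = 1} x ^ s Y(s) ds`, with the line parametrised by `s = 1 + i t`. -/
def vartheta (D : ℕ) (x : ℝ) : ℂ :=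
  1 / (2 * Real.pi) * ∫ t : ℝ, (x : ℂ) ^ (1 + t * I) * weightY D (1 + t * I)

/-! ### Characters and `L`-functions -/

instance instNeZeroLcm {m n : ℕ} [NeZero m] [NeZero n] : NeZero (Nat.lcm m n) :=
  ⟨Nat.lcm_ne_zero (NeZero.ne m) (NeZero.ne n)⟩

/-- `Δ(s, ψ) = L(s, ψ) / L(1 - s, ψ̄)` for primitive `ψ` modulo `k`, as a meromorphic function.
It is written with Gamma factors, so that no removable `0 / 0` occurs at zeros of `L(s, ψ)`;
here `gammaFactor ψ s` is `π ^ (-(s + a) / 2) Γ((s + a) / 2)`, where `a = (1 - ψ(-1)) / 2`. -/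
def Delta {k : ℕ} [NeZero k] (ψ : DirichletCharacter ℂ k) (s : ℂ) : ℂ :=
  rootNumber ψ * (k : ℂ) ^ (1 / 2 - s) * gammaFactor ψ (1 - s) / gammaFactor ψ s

/-- The functional equation `L(s, ψ) = Δ(s, ψ) L(1 - s, ψ̄)`. -/
theorem LFunction_eq_Delta_mul {k : ℕ} [NeZero k] {ψ : DirichletCharacter ℂ k}
    (hψ : ψ.IsPrimitive) {s : ℂ} (hs : s.im ≠ 0) :
    LFunction ψ s = Delta ψ s * LFunction ψ⁻¹ (1 - s) := by
  have hs0 : s ≠ 0 := by rintro rfl; simp at hs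
  have hs1 : 1 - s ≠ 0 := by
    intro h
    apply hs
    have := congrArg Complex.im h
    simpa using this
  have hg : gammaFactor ψ⁻¹ (1 - s) = gammaFactor ψ (1 - s) := by
    rcases ψ.even_or_odd with h | h
    · have h' : ψ⁻¹.Even := by
        rw [DirichletCharacter.Even] at h ⊢
        simp [MulChar.inv_apply_eq_inv, h]
      rw [h.gammaFactor_def, h'.gammaFactor_def]
    · have h' : ψ⁻¹.Odd := by
        rw [DirichletCharacter.Odd] at h ⊢
        rw [MulChar.inv_apply_eq_inv, h]
        simp [Ring.inverse_eq_inv']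
      rw [h.gammaFactor_def, h'.gammaFactor_def]
  have hne : gammaFactor ψ (1 - s) ≠ 0 := by
    rcases ψ.even_or_odd with h | h
    · rw [h.gammaFactor_def, Ne, Gammaℝ_eq_zero_iff]
      rintro ⟨n, hn⟩
      apply hs
      simpa using congrArg Complex.im hn
    · rw [h.gammaFactor_def, Ne, Gammaℝ_eq_zero_iff]
      rintro ⟨n, hn⟩
      apply hs
      simpa using congrArg Complex.im hn
  have h := hψ.completedLFunction_one_sub (1 - s)
  rw [sub_sub_cancel] at h
  rw [LFunction_eq_completed_div_gammaFactor ψ s (Or.inl hs0),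
    LFunction_eq_completed_div_gammaFactor ψ⁻¹ (1 - s) (Or.inl hs1), hg, h, Delta]
  have he : (1 - s - 1 / 2 : ℂ) = 1 / 2 - s := by ring
  rw [he]
  field_simp

section

variable {D : ℕ} [NeZero D] (χ : DirichletCharacter ℂ D)
variable {q : ℕ} [NeZero q] (ψ : DirichletCharacter ℂ q)

/-- `L(s, ψ) L(s, ψ χ)`, where `ψ χ` is a character modulo `[q, D]`. -/
def LL (s : ℂ) : ℂ := LFunction ψ s * LFunction (ψ.mul χ) s

/-- `Δ₁(s, ψ) = Δ(s, ψ) Δ(s, ψ χ)`. -/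
def Delta1 (s : ℂ) : ℂ := Delta ψ s * Delta (ψ.mul χ) s

/-- `F(s, ψ) = ∑_{n ≤ D ^ 5} ν(n) ψ(n) n ^ (-s)`. -/
def F (s : ℂ) : ℂ := ∑ n ∈ Finset.Icc 1 (D ^ 5), nu χ n * ψ n / (n : ℂ) ^ s

/-- `G(s, ψ) = ∑_{n ≤ D ^ 5} υ(n) ψ(n) n ^ (-s)`. -/
def G (s : ℂ) : ℂ := ∑ n ∈ Finset.Icc 1 (D ^ 5), upsilon χ n * ψ n / (n : ℂ) ^ s

/-- `𝓕(s, ψ) = F(s, ψ) + Δ₁(s, ψ) F(1 - s, ψ̄)`; the conjugate character `ψ̄` is `ψ⁻¹`. -/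
def calF (s : ℂ) : ℂ := F χ ψ s + Delta1 χ ψ s * F χ ψ⁻¹ (1 - s)

/-- `sup_{s ∈ S} f(s) < B`, for nonempty `S` (the supremum taken in the extended reals). -/
def SupLT (S : Set ℂ) (f : ℂ → ℝ) (B : ℝ) : Prop := ∃ b < B, ∀ s ∈ S, f s ≤ b

/-- `ψ ∈ Ψ`: the modulus `q` is squarefree, prime to `6`, with `Q < q < 2 Q`; `ψ` is primitive
modulo `q` and `ψ χ` is primitive modulo `[q, D]`. -/
structure MemPsi : Prop where
  lt_modulus : bigQ D < q
  modulus_lt : (q : ℝ) < 2 * bigQ D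
  coprime_six : Nat.Coprime 6 q
  squarefree : Squarefree q
  primitive : ψ.IsPrimitive
  primitive_mul : (ψ.mul χ).IsPrimitive

/-- `ψ ∈ Ψ*`: `ψ ∈ Ψ` and three inequalities for `F`, `G` and `𝓕` hold. -/
structure MemPsiStar : Prop where
  memPsi : MemPsi χ ψ
  ineq1 : SupLT (Omega1 D) (fun s => ‖F χ ψ s‖ + ‖G χ ψ s‖) (logD D ^ 3 * Real.log (logD D))
  ineq2 : SupLT (Omega1 D) (fun s => ‖F χ ψ s * G χ ψ s - 1‖) (1 / 2)
  ineq3 : SupLT (Omega2 D) (fun s => ‖LL χ ψ s - calF χ ψ s‖) (logD D ^ (-(24 / 5) : ℝ))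

/-- `S(ψ)`: the zeros of `L(s, ψ) L(s, ψ χ)` in the strip `|Im s - D| < 1`. -/
def zeroSet : Set ℂ := {ρ | LL χ ψ ρ = 0 ∧ |ρ.im - D| < 1}

/-- `𝓚₊(s, ψ) = L(s + α, ψ) L(s - α, ψ χ) / F(s, ψ)`. -/
def Kplus (s : ℂ) : ℂ :=
  LFunction ψ (s + alpha D) * LFunction (ψ.mul χ) (s - alpha D) / F χ ψ s

/-- `𝓚₋(s, ψ) = L(s - α, ψ) L(s + α, ψ χ) / F(s, ψ)`. -/
def Kminus (s : ℂ) : ℂ :=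
  LFunction ψ (s - alpha D) * LFunction (ψ.mul χ) (s + alpha D) / F χ ψ s

end

end LandauSiegel

end

open LandauSiegel

open LandauSiegel

/-! ### Logarithms of zero-free functions and a damped maximum principle. -/

namespace LandauSiegel

/-! Write f = L(·, ψ), g = L(·, ψχ), P = F(·, ψ), l = log 𝓛, and let `quot` be f(u + a) g(u − a) /
P(u), so that a = α and a = −α give 𝓚₊ and 𝓚₋. Up to O(exp(−𝓛²)), each smoothed Dirichlet polynomial
is an integral over Re z = 1 of f(w + z + a) / f(w + z − a) against the kernel Q^{κz} Y(z), where κ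
is 4/3 or 2/3 (`exists_smooth_sum_approx`).

To the right of the critical line the dual term Δ₁(s) conj P(1 − s̄) of 𝓕 decays like Q^{−2(Re s −
1/2)}, so the approximation fg ≈ 𝓕 says fg ≈ P. Hence f(u + a) / f(u − a), which equals quot(u) P(u)
/ (fg)(u − a), is close to quot(u), and the integral may be replaced by that of `quot` along Re z =
αl/5 (`eventually_vint_div`).

The weight Y has a simple pole of residue 1 at the origin, so Cauchy's formula gives quot(ρ + s) as
the difference of the integrals of `quot` along Re z = αl/5 and Re z = −αl/5
(`eventually_quot_residue`). The right one is the first Dirichlet polynomial. On the left one the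
functional equations turn `quot` for a at u into `dualRatio` times the conjugate of `quot` for −a at
1 − ū. Since fg vanishes at ρ, the approximation forces the dual term at ρ to be about −P(ρ); away
from ρ the ratio follows −Q^{−2(u − ρ)}, by Lipschitz bounds for the logarithms of all its factors
(`eventually_dualRatio`). As Y is odd and 2 − 4/3 = 2/3, the left integral becomes Q^{−2s} times the
conjugate of an integral of the first kind, for −a, κ = 2/3 and the point 1 − conj(ρ + s)
(`eventually_vint_left`). Read backwards, this is the second Dirichlet polynomial, with ψ̄ and the
opposite λ.

The Lipschitz bounds come from the digamma function for the Δ-factors (`Gamma_ratio`) and from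
Borel–Carathéodory for P (`exists_exp_ratio_F`), P having no zeros in Ω₁ because FG is near 1 there.
In the critical steps real parts vary by O(αl), so powers of Q are powers of 𝓛. The worst error is
that of the left integral, l² 𝓛^{−1 + 53/150}, which is O(𝓛^{−3/5}). -/

open Metric in
/-- A function without zeros on a disc has ratios `exp θ` with `θ` Lipschitz-small, by the
Borel-Carathéodory theorem. -/
theorem exists_exp_ratio_of_ball {g : ℂ → ℂ} {c : ℂ} {r A : ℝ} (hr : 0 < r) (hA : 0 < A)
    (hg : DifferentiableOn ℂ g (ball c r)) (h0 : ∀ z ∈ ball c r, g z ≠ 0)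
    (hb : ∀ z ∈ ball c r, ‖g z‖ ≤ Real.exp A * ‖g c‖) {z₁ z₂ : ℂ}
    (h1 : z₁ ∈ ball c (r / 2)) (h2 : z₂ ∈ ball c (r / 2)) :
    ∃ θ : ℂ, g z₁ = g z₂ * exp θ ∧ ‖θ‖ ≤ 24 * A / r * ‖z₁ - z₂‖ := by
  have hg' : DifferentiableOn ℂ (fun z => deriv g z / g z) (ball c r) :=
    (hg.deriv isOpen_ball).div hg h0
  -- φ is a primitive of g′/g on the disc, so g · exp(−φ) is constant and φ is a logarithm of g up
  -- to a constant.
  obtain ⟨φ, hφ⟩ := hg'.isExactOn_ball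
  have hc : c ∈ ball c r := mem_ball_self hr
  have key : ∀ z ∈ ball c r, g z = g c * exp (φ z - φ c) := by
    have hconst : ∀ z ∈ ball c r, HasDerivAt (fun z => g z * exp (-φ z)) 0 z := by
      intro z hz
      have e1 : HasDerivAt g (deriv g z) z :=
        ((hg z hz).differentiableAt (isOpen_ball.mem_nhds hz)).hasDerivAt
      have e2 := e1.mul ((hφ z hz).neg.cexp)
      convert! e2 using 1
      have := h0 z hz
      field_simp
      ring
    intro z hz
    have := (convex_ball c r).is_const_of_fderivWithin_eq_zero (𝕜 := ℂ)
      (f := fun z => g z * exp (-φ z))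
      (fun z hz => (hconst z hz).differentiableAt.differentiableWithinAt)
      (fun z hz => by
        rw [fderivWithin_of_isOpen isOpen_ball hz]
        have := (hconst z hz).hasFDerivAt.fderiv
        rw [this]; ext; simp) hz hc
    rw [sub_eq_add_neg, Complex.exp_add, exp_neg (φ c)]
    rw [exp_neg, exp_neg] at this
    have n1 := exp_ne_zero (φ z)
    have n2 := exp_ne_zero (φ c)
    field_simp at this ⊢
    linear_combination this
  have hre : ∀ z ∈ ball c r, (φ z - φ c).re ≤ A := by
    intro z hz
    have h := hb z hz
    rw [key z hz, norm_mul, norm_exp, mul_comm] at h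
    have hgc : 0 < ‖g c‖ := norm_pos_iff.mpr (h0 c hc)
    exact Real.exp_le_exp.mp (le_of_mul_le_mul_right h hgc)
  have hφd : DifferentiableOn ℂ φ (ball c r) :=
    fun z hz => (hφ z hz).differentiableAt.differentiableWithinAt
  -- Borel–Carathéodory at radius 3r/4 gives 2A(3/4)/(1/4) = 6A; Cauchy's estimate on circles of
  -- radius r/4 then gives 24A/r on the half disc.
  have hbound : ∀ z ∈ ball c (3 * r / 4), ‖φ z - φ c‖ ≤ 6 * A := by
    intro z hz
    have hz' : ‖z - c‖ < 3 * r / 4 := by simpa [dist_eq_norm] using hz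
    have := borelCaratheodory_zero (f := fun w => φ (c + w) - φ c) (M := A) (R := r) (z := z - c) hA
      (by
        apply DifferentiableOn.sub_const
        apply hφd.comp (by fun_prop)
        intro w hw
        simpa using hw)
      (by
        intro w hw
        exact hre _ (by simpa using hw)) hr (by simpa using by linarith) (by simp)
    simp only [add_sub_cancel] at this
    refine this.trans ?_
    rw [div_le_iff₀ (by linarith)]
    nlinarith
  have hder : ∀ z ∈ ball c (r / 2), ‖deriv φ z‖ ≤ 24 * A / r := by
    intro z hz
    have hz' : dist z c < r / 2 := hz
    have hsub : ∀ w ∈ closedBall z (r / 4), w ∈ ball c (3 * r / 4) := by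
      intro w hw
      have : dist w z ≤ r / 4 := hw
      have := dist_triangle w z c
      rw [mem_ball]; linarith
    have hsub2 : ball c (3 * r / 4) ⊆ ball c r := ball_subset_ball (by linarith)
    have := norm_deriv_le_of_forall_mem_sphere_norm_le (f := fun w => φ w - φ c) (c := z)
      (R := r / 4) (C := 6 * A) (by linarith)
      (DifferentiableOn.diffContOnCl_ball (U := ball c r)
        (hφd.sub_const _) (fun w hw => hsub2 (hsub w hw)))
      (fun w hw => hbound w (hsub w (sphere_subset_closedBall hw)))
    rw [deriv_sub_const] at this
    refine this.trans (le_of_eq ?_)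
    field_simp; ring
  refine ⟨φ z₁ - φ z₂, ?_, ?_⟩
  · have hs : ball c (r / 2) ⊆ ball c r := ball_subset_ball (by linarith)
    rw [key z₁ (hs h1), key z₂ (hs h2), mul_assoc, ← Complex.exp_add]
    congr 2; ring
  · have := (convex_ball c (r / 2)).norm_image_sub_le_of_norm_deriv_le (f := φ)
      (fun z hz => (hφ z (ball_subset_ball (by linarith) hz)).differentiableAt) hder h2 h1
    exact this

/-- Maximum principle in a rectangle, where growth on the horizontal sides is damped by a
Gaussian factor. -/
theorem norm_le_of_rect {h : ℂ → ℂ} {a b y T δ B : ℝ} (hab : a < b) (hb1 : b ≤ a + 1)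
    (hT : 0 < T) (hB : 0 ≤ B) (hδ : 0 ≤ δ)
    (hd : ∀ z : ℂ, a ≤ z.re → z.re ≤ b → |z.im - y| ≤ T → DifferentiableAt ℂ h z)
    (hside : ∀ z : ℂ, z.re = a ∨ z.re = b → |z.im - y| ≤ T → ‖h z‖ ≤ B)
    (htop : ∀ z : ℂ, a ≤ z.re → z.re ≤ b → |z.im - y| = T → ‖h z‖ ≤ B * Real.exp (10 * δ ^ 2))
    {u : ℂ} (hu1 : a ≤ u.re) (hu2 : u.re ≤ b) (hu3 : |u.im - y| ≤ T - δ) :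
    ‖h u‖ ≤ Real.exp 10 * B := by
  set U : Set ℂ := Set.Ioo a b ×ℂ Set.Ioo (y - T) (y + T) with hU
  have hcl : closure U = Set.Icc a b ×ℂ Set.Icc (y - T) (y + T) := by
    rw [hU, closure_reProdIm, closure_Ioo hab.ne, closure_Ioo (by linarith)]
  have hbd : Bornology.IsBounded U := by
    rw [hU]
    exact (Metric.isBounded_Ioo _ _).reProdIm (Metric.isBounded_Ioo _ _)
  -- The damping factor is 1 at u. It is at most e^{10} on the vertical sides, the width being at
  -- most 1, and at most exp(10 − 10δ²) on the horizontal sides, which are at distance at least δ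
  -- from u.
  have hdiff : DiffContOnCl ℂ (fun z => h z * exp (10 * (z - u) ^ 2)) U := by
    apply DifferentiableOn.diffContOnCl
    intro z hz
    rw [hcl] at hz
    obtain ⟨⟨h1, h2⟩, h3, h4⟩ := hz
    have := hd z h1 h2 (abs_le.mpr ⟨by linarith, by linarith⟩)
    exact (this.mul (by fun_prop)).differentiableWithinAt
  have hw : ∀ z : ℂ, ‖exp (10 * (z - u) ^ 2)‖ =
      Real.exp (10 * (z.re - u.re) ^ 2 - 10 * (z.im - u.im) ^ 2) := by
    intro z
    rw [norm_exp]
    congr 1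
    rw [pow_two]
    simp [mul_re, mul_im]
    ring
  have := norm_le_of_forall_mem_frontier_norm_le hbd hdiff (C := Real.exp 10 * B) ?_
    (z := u) ?_
  · simpa using this
  · intro z hz
    have hz' := frontier_subset_closure hz
    rw [hcl] at hz'
    obtain ⟨⟨h1, h2⟩, h3, h4⟩ := hz'
    have hre : (z.re - u.re) ^ 2 ≤ 1 := by
      rw [sq_le_one_iff_abs_le_one, abs_le]; constructor <;> linarith
    have hfr : z ∉ U := by
      have ho : IsOpen U := by
        rw [hU]; exact isOpen_Ioo.reProdIm isOpen_Ioo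
      rw [ho.frontier_eq] at hz
      exact hz.2
    have habs : |z.im - y| ≤ T := abs_le.mpr ⟨by linarith, by linarith⟩
    rw [norm_mul, hw]
    by_cases hs : z.re = a ∨ z.re = b
    · rw [mul_comm]
      apply mul_le_mul (Real.exp_le_exp.mpr _) (hside z hs habs) (norm_nonneg _)
        (Real.exp_pos _).le
      nlinarith [sq_nonneg (z.im - u.im)]
    · push Not at hs
      have hre1 : a < z.re := lt_of_le_of_ne h1 (Ne.symm hs.1)
      have hre2 : z.re < b := lt_of_le_of_ne h2 hs.2
      have him : |z.im - y| = T := by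
        by_contra hne
        have hlt := lt_of_le_of_ne habs hne
        rw [abs_lt] at hlt
        exact hfr ⟨⟨hre1, hre2⟩, by constructor <;> linarith⟩
      have hδ2 : δ ^ 2 ≤ (z.im - u.im) ^ 2 := by
        have h6 := abs_sub_abs_le_abs_sub (z.im - y) (u.im - y)
        rw [sub_sub_sub_cancel_right] at h6
        rw [← sq_abs (z.im - u.im)]
        exact pow_le_pow_left₀ hδ (by linarith) 2
      calc ‖h z‖ * Real.exp (10 * (z.re - u.re) ^ 2 - 10 * (z.im - u.im) ^ 2)
          ≤ (B * Real.exp (10 * δ ^ 2)) * Real.exp (10 - 10 * δ ^ 2) := by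
            gcongr
            · exact htop z h1 h2 him
            · linarith
        _ = Real.exp 10 * B := by
            rw [mul_assoc, ← Real.exp_add]; ring_nf
  · rw [hcl]
    have h5 := abs_le.mp hu3
    exact ⟨⟨hu1, hu2⟩, by constructor <;> linarith⟩

end LandauSiegel

/-! ### Cauchy's theorem and residues on rectangles. -/

namespace LandauSiegel
open Set Filter Topology
open scoped Interval

/-- The integral of `h` along the vertical segment `c + i [-T, T]`. -/
noncomputable def vint (h : ℂ → ℂ) (c T : ℝ) : ℂ := ∫ y in (-T)..T, h (c + y * I)

theorem rect_mem {a b T : ℝ} (hab : a ≤ b) (hT : 0 ≤ T) {z : ℂ}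
    (hz : z ∈ [[a, b]] ×ℂ [[-T, T]]) : a ≤ z.re ∧ z.re ≤ b ∧ |z.im| ≤ T := by
  obtain ⟨h1, h2⟩ := hz
  simp only [mem_preimage, uIcc_of_le hab, uIcc_of_le (by linarith : -T ≤ T), mem_Icc] at h1 h2
  exact ⟨h1.1, h1.2, abs_le.mpr h2⟩

/-- Cauchy's theorem: the two vertical integrals differ by the horizontal sides, each worth at most
ε(b − a). -/
theorem norm_vint_sub_le {h : ℂ → ℂ} {a b T ε : ℝ} (hab : a ≤ b) (hT : 0 ≤ T)
    (hd : ∀ z : ℂ, a ≤ z.re → z.re ≤ b → |z.im| ≤ T → DifferentiableAt ℂ h z)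
    (htop : ∀ z : ℂ, a ≤ z.re → z.re ≤ b → |z.im| = T → ‖h z‖ ≤ ε) :
    ‖vint h b T - vint h a T‖ ≤ 2 * ε * (b - a) := by
  have H := integral_boundary_rect_eq_zero_of_differentiableOn h (a + (-T : ℝ) * I) (b + (T : ℝ) * I)
    (by
      intro z hz
      simp only [add_re, ofReal_re, mul_re, I_re, mul_zero, ofReal_im, I_im, mul_one, sub_self,
        add_zero, add_im, mul_im, zero_add] at hz
      obtain ⟨h1, h2, h3⟩ := rect_mem hab hT hz
      exact (hd z h1 h2 h3).differentiableWithinAt)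
  simp only [add_re, ofReal_re, mul_re, I_re, mul_zero, ofReal_im, I_im, mul_one, sub_self,
        add_zero, add_im, mul_im, zero_add] at H
  have hbt : ∀ t : ℝ, |t| = T → ‖∫ x in a..b, h (x + t * I)‖ ≤ ε * (b - a) := by
    intro t ht
    have := intervalIntegral.norm_integral_le_of_norm_le_const (a := a) (b := b) (C := ε)
      (f := fun x : ℝ => h (x + t * I)) (by
        intro x hx
        rw [uIoc_of_le hab] at hx
        exact htop _ (by simpa using hx.1.le) (by simpa using hx.2) (by simpa using ht))
    rwa [abs_of_nonneg (by linarith : 0 ≤ b - a)] at this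
  have e : I • (vint h b T - vint h a T) =
      (∫ x in a..b, h (x + (T : ℝ) * I)) - ∫ x in a..b, h (x + (-T : ℝ) * I) := by
    rw [smul_sub]
    unfold vint
    linear_combination H
  have := congrArg norm e
  rw [norm_smul, norm_I, one_mul] at this
  rw [this]
  refine (norm_sub_le _ _).trans ?_
  linarith [hbt T (abs_of_nonneg hT), hbt (-T) (by rw [abs_neg, abs_of_nonneg hT])]

theorem continuous_vertical (c : ℝ) : Continuous (fun y : ℝ => (c : ℂ) + y * I) := by fun_prop

theorem continuousOn_vert {h : ℂ → ℂ} {c T : ℝ} (hT : 0 ≤ T)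
    (hd : ∀ z : ℂ, z.re = c → |z.im| ≤ T → DifferentiableAt ℂ h z) :
    ContinuousOn (fun y : ℝ => h (c + y * I)) [[-T, T]] := by
  intro y hy
  rw [uIcc_of_le (by linarith)] at hy
  have := (hd (c + y * I) (by simp) (by simpa using abs_le.mpr hy)).continuousAt
  exact (ContinuousAt.comp (g := h) (f := fun y : ℝ => (c : ℂ) + y * I) this
    (continuous_vertical c).continuousAt).continuousWithinAt

theorem norm_vint_le {h : ℂ → ℂ} {c T : ℝ} {k : ℝ → ℝ} (hT : 0 ≤ T)
    (hk : IntervalIntegrable k volume (-T) T)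
    (hle : ∀ y : ℝ, |y| ≤ T → ‖h (c + y * I)‖ ≤ k y) :
    ‖vint h c T‖ ≤ ∫ y in (-T)..T, k y := by
  apply intervalIntegral.norm_integral_le_of_norm_le (by linarith) _ hk
  filter_upwards with y hy
  exact hle y (abs_le.mpr ⟨hy.1.le, hy.2⟩)

theorem vint_sub {h k : ℂ → ℂ} {c T : ℝ} (hT : 0 ≤ T)
    (hd : ∀ z : ℂ, z.re = c → |z.im| ≤ T → DifferentiableAt ℂ h z)
    (kd : ∀ z : ℂ, z.re = c → |z.im| ≤ T → DifferentiableAt ℂ k z) :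
    vint (fun z => h z - k z) c T = vint h c T - vint k c T := by
  unfold vint
  rw [intervalIntegral.integral_sub]
  · exact (continuousOn_vert hT hd).intervalIntegrable
  · exact (continuousOn_vert hT kd).intervalIntegrable

theorem integral_inv_sq_add_sq_le {c T : ℝ} (hc : 0 < c) :
    ∫ y in (-T)..T, 1 / (c ^ 2 + y ^ 2) = 2 * Real.arctan (T / c) / c := by
  have : ∀ y ∈ [[-T, T]], HasDerivAt (fun y => Real.arctan (y / c) / c) (1 / (c ^ 2 + y ^ 2)) y := by
    intro y _
    have h1 := (((hasDerivAt_id' y).div_const c).arctan).div_const c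
    refine h1.congr_deriv ?_
    field_simp
  rw [intervalIntegral.integral_eq_sub_of_hasDerivAt this]
  · rw [neg_div, Real.arctan_neg]; ring
  · apply Continuous.intervalIntegrable
    have : ∀ y : ℝ, c ^ 2 + y ^ 2 ≠ 0 := fun y => by positivity
    fun_prop (disch := assumption)

/-- `vint` integrates dy and not dz, so the residue shows up as 2π without the factor i. The
arctangent is the share of the horizontal sides. -/
theorem rect_residue_kernel {c T : ℝ} (hc : 0 < c) (hT : 0 < T) :
    vint (fun z => 1 / z) c T - vint (fun z => 1 / z) (-c) T = 2 * Real.pi -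
      (4 * Real.arctan (c / T) : ℝ) := by
  have hne : ∀ y : ℝ, (c : ℂ) + y * I ≠ 0 := fun y h => hc.ne' (by simpa using congrArg re h)
  have hne' : ∀ y : ℝ, ((-c : ℝ) : ℂ) + y * I ≠ 0 := fun y h => hc.ne' (by
    have := congrArg re h
    simp at this; exact this)
  unfold vint
  rw [← intervalIntegral.integral_sub]
  · have : ∀ y : ℝ, 1 / ((c : ℂ) + y * I) - 1 / (((-c : ℝ) : ℂ) + y * I) =
        ((2 * c * (1 / (c ^ 2 + y ^ 2)) : ℝ) : ℂ) := by
      intro y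
      have h3 : ((c : ℂ) ^ 2 + y ^ 2) ≠ 0 := by
        have : (c ^ 2 + y ^ 2 : ℝ) ≠ 0 := by positivity
        exact_mod_cast this
      have h1 := hne y
      have h2 := hne' y
      push_cast at h2 ⊢
      rw [div_sub_div _ _ h1 h2, ← mul_div_assoc, div_eq_div_iff (mul_ne_zero h1 h2) h3]
      ring_nf
      rw [I_sq]; ring
    simp_rw [this]
    rw [intervalIntegral.integral_ofReal, intervalIntegral.integral_const_mul,
      integral_inv_sq_add_sq_le hc]
    have h4 : Real.arctan (T / c) = Real.pi / 2 - Real.arctan (c / T) := by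
      rw [← Real.arctan_inv_of_pos (by positivity), inv_div]
    rw [h4]
    push_cast
    have : (c : ℂ) ≠ 0 := by exact_mod_cast hc.ne'
    field_simp
    ring
  · apply Continuous.intervalIntegrable
    fun_prop (disch := exact hne _)
  · apply Continuous.intervalIntegrable
    fun_prop (disch := exact hne' _)

/-- Cauchy's formula for a rectangle symmetric about the origin. -/
theorem rect_residue {h : ℂ → ℂ} {c T ε : ℝ} (hc : 0 < c) (hT : 0 < T)
    (hd : ∀ z : ℂ, -c ≤ z.re → z.re ≤ c → |z.im| ≤ T → DifferentiableAt ℂ h z)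
    (htop : ∀ z : ℂ, -c ≤ z.re → z.re ≤ c → |z.im| = T → ‖h z / z‖ ≤ ε) (h0 : ‖h 0‖ ≤ T * ε) :
    ‖vint (fun z => h z / z) c T - vint (fun z => h z / z) (-c) T - 2 * Real.pi * h 0‖ ≤
      12 * ε * c := by
  -- Removing the pole: k(z) = h(z)/z − h(0)/z extends holomorphically over 0, so Cauchy's theorem
  -- applies to k and the 1/z part is integrated explicitly. The bound ‖h 0‖ ≤ Tε keeps h(0)/z below
  -- ε on the horizontal sides.
  set k : ℂ → ℂ := dslope h 0 with hk
  have hkd : ∀ z : ℂ, -c ≤ z.re → z.re ≤ c → |z.im| ≤ T → DifferentiableAt ℂ k z := by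
    intro z h1 h2 h3
    rcases eq_or_ne z 0 with rfl | hz
    · have hU : Ioo (-c) c ×ℂ Ioo (-T) T ∈ 𝓝 (0 : ℂ) :=
        (isOpen_Ioo.reProdIm isOpen_Ioo).mem_nhds ⟨by simpa using hc, by simpa using hT⟩
      have : DifferentiableOn ℂ k (Ioo (-c) c ×ℂ Ioo (-T) T) := by
        rw [hk, differentiableOn_dslope hU]
        rintro z ⟨h1, h2⟩
        exact (hd z h1.1.le h1.2.le (abs_le.mpr ⟨h2.1.le, h2.2.le⟩)).differentiableWithinAt
      exact (this 0 (mem_of_mem_nhds hU)).differentiableAt hU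
    · exact (differentiableAt_dslope_of_ne hz).mpr (hd z h1 h2 h3)
  have hkz : ∀ z : ℂ, z ≠ 0 → k z = h z / z - h 0 * (1 / z) := by
    intro z hz
    rw [hk, dslope_of_ne _ hz, slope_def_field]
    simp
    ring
  have hε : 0 ≤ ε := (norm_nonneg _).trans
    (htop (T * I) (by simpa using hc.le) (by simpa using hc.le) (by simpa using hT.le))
  have e1 := norm_vint_sub_le (by linarith : -c ≤ c) hT.le hkd (ε := 2 * ε) (by
    intro z h1 h2 h3
    have hz : z ≠ 0 := by
      rintro rfl
      simp at h3; linarith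
    rw [hkz z hz]
    refine (norm_sub_le _ _).trans ?_
    have hzT : T ≤ ‖z‖ := h3 ▸ abs_im_le_norm z
    have : ‖h 0 * (1 / z)‖ ≤ ε := by
      rw [norm_mul, norm_div, norm_one, mul_one_div, div_le_iff₀ (by linarith)]
      nlinarith
    linarith [htop z h1 h2 h3])
  have hne : ∀ c' : ℝ, c' ≠ 0 → ∀ z : ℂ, z.re = c' → z ≠ 0 := by
    rintro c' hc' z hz rfl
    exact hc' (by simpa using hz.symm)
  have hv : ∀ c' : ℝ, c' ≠ 0 → -c ≤ c' → c' ≤ c → vint k c' T =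
      vint (fun z => h z / z) c' T - h 0 * vint (fun z => 1 / z) c' T := by
    intro c' hc' h1 h2
    have : vint k c' T = vint (fun z => h z / z - h 0 * (1 / z)) c' T := by
      unfold vint
      congr 1; ext y
      exact hkz _ (hne c' hc' _ (by simp))
    rw [this, vint_sub hT.le]
    · congr 1
      unfold vint
      rw [intervalIntegral.integral_const_mul]
    · intro z hz1 hz2
      exact (hd z (hz1 ▸ h1) (hz1 ▸ h2) hz2).div differentiableAt_id (hne c' hc' z hz1)
    · intro z hz1 hz2
      have := hne c' hc' z hz1
      fun_prop (disch := assumption)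
  rw [hv c hc.ne' (by linarith) le_rfl, hv (-c) (by linarith) le_rfl (by linarith)] at e1
  have e2 := rect_residue_kernel hc hT
  have e3 : vint (fun z => h z / z) c T - vint (fun z => h z / z) (-c) T - 2 * Real.pi * h 0 =
      (vint (fun z => h z / z) c T - h 0 * vint (fun z => 1 / z) c T -
        (vint (fun z => h z / z) (-c) T - h 0 * vint (fun z => 1 / z) (-c) T)) -
      h 0 * (4 * Real.arctan (c / T) : ℝ) := by
    linear_combination (h 0) * e2
  rw [e3]
  refine (norm_sub_le _ _).trans ?_
  have e4 : ‖h 0 * (4 * Real.arctan (c / T) : ℝ)‖ ≤ 4 * ε * c := by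
    rw [norm_mul, norm_real, Real.norm_eq_abs, abs_mul, abs_of_nonneg (by norm_num : (0:ℝ) ≤ 4)]
    have ha : |Real.arctan (c / T)| ≤ c / T := by
      rw [abs_of_nonneg (Real.arctan_nonneg.mpr (by positivity))]
      have hn : 0 ≤ Real.arctan (c / T) := Real.arctan_nonneg.mpr (by positivity)
      have := Real.le_tan hn (Real.arctan_lt_pi_div_two _)
      rwa [Real.tan_arctan] at this
    calc ‖h 0‖ * (4 * |Real.arctan (c / T)|) ≤ (T * ε) * (4 * (c / T)) := by gcongr
      _ = 4 * ε * c := by field_simp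
  linarith

theorem integral_one_div_sq_le {c T : ℝ} (hc : 0 < c) :
    ∫ y in (-T)..T, 1 / (c ^ 2 + y ^ 2) ≤ 4 / c := by
  rw [integral_inv_sq_add_sq_le hc]
  gcongr
  linarith [Real.arctan_lt_pi_div_two (T / c), Real.pi_lt_four]

theorem integral_one_div_norm_le {c T : ℝ} (hc : 0 < c) (hcT : c ≤ T) :
    ∫ y in (-T)..T, 1 / (c + |y|) ≤ 2 * Real.log (2 * T / c) := by
  have hT : 0 < T := hc.trans_le hcT
  have hpos : ∀ y : ℝ, c + |y| ≠ 0 := fun y => by positivity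
  have hint : ∀ a b, IntervalIntegrable (fun y : ℝ => 1 / (c + |y|)) volume a b := by
    intro a b
    apply Continuous.intervalIntegrable
    fun_prop (disch := exact hpos _)
  have h1 : ∫ y in (0 : ℝ)..T, 1 / (c + |y|) = Real.log ((c + T) / c) := by
    have : ∫ y in (0 : ℝ)..T, 1 / (c + |y|) = ∫ y in (0 : ℝ)..T, 1 / (c + y) := by
      apply intervalIntegral.integral_congr
      intro y hy
      rw [uIcc_of_le hT.le] at hy
      simp [abs_of_nonneg hy.1]
    rw [this, intervalIntegral.integral_comp_add_left (fun y => 1 / y), integral_one_div_of_pos]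
    · simp
    · simpa using hc
    · linarith
  have h2 : ∫ y in (-T)..(0 : ℝ), 1 / (c + |y|) = ∫ y in (0 : ℝ)..T, 1 / (c + |y|) := by
    have := intervalIntegral.integral_comp_neg (a := 0) (b := T) (fun y : ℝ => 1 / (c + |y|))
    simp only [abs_neg, neg_zero] at this
    rw [this]
  rw [← intervalIntegral.integral_add_adjacent_intervals (hint (-T) 0) (hint 0 T), h2, h1]
  have : Real.log ((c + T) / c) ≤ Real.log (2 * T / c) := by
    apply Real.log_le_log (by positivity)
    gcongr; linarith
  linarith

end LandauSiegel

/-! ### Vertical lines: shifting and truncation under Gaussian decay. -/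

namespace LandauSiegel
open Set Filter Topology
open scoped Interval

theorem integrable_gaussian_quarter : Integrable (fun y : ℝ => Real.exp (-(y ^ 2) / 4)) := by
  have := integrable_exp_neg_mul_sq (b := 1 / 4) (by norm_num)
  refine this.congr (ae_of_all _ fun y => ?_)
  simp only; congr 1; ring

theorem integrable_vertical {h : ℂ → ℂ} {c B : ℝ}
    (hd : ∀ z : ℂ, z.re = c → DifferentiableAt ℂ h z)
    (hB : ∀ z : ℂ, z.re = c → ‖h z‖ ≤ B * Real.exp (-(z.im ^ 2) / 4)) :
    Integrable (fun y : ℝ => h (c + y * I)) := by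
  refine (integrable_gaussian_quarter.const_mul B).mono' ?_ (ae_of_all _ fun y => ?_)
  · apply Continuous.aestronglyMeasurable
    rw [continuous_iff_continuousAt]
    intro y
    exact ContinuousAt.comp (g := h) (f := fun y : ℝ => (c : ℂ) + y * I)
      (hd _ (by simp)).continuousAt (continuous_vertical c).continuousAt
  · simpa using hB (c + y * I) (by simp)

/-- Cauchy's theorem on growing rectangles; the Gaussian factor makes the horizontal sides vanish in
the limit. -/
theorem integral_vertical_eq {h : ℂ → ℂ} {a b B : ℝ} (hab : a ≤ b)
    (hd : ∀ z : ℂ, a ≤ z.re → z.re ≤ b → DifferentiableAt ℂ h z)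
    (hB : ∀ z : ℂ, a ≤ z.re → z.re ≤ b → ‖h z‖ ≤ B * Real.exp (-(z.im ^ 2) / 4)) :
    ∫ y : ℝ, h (b + y * I) = ∫ y : ℝ, h (a + y * I) := by
  have hlim : ∀ c, a ≤ c → c ≤ b → Tendsto (fun T : ℝ => vint h c T) atTop
      (𝓝 (∫ y : ℝ, h (c + y * I))) := by
    intro c h1 h2
    exact intervalIntegral_tendsto_integral
      (integrable_vertical (fun z hz => hd z (hz ▸ h1) (hz ▸ h2))
        (fun z hz => hB z (hz ▸ h1) (hz ▸ h2)))
      tendsto_neg_atTop_atBot tendsto_id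
  have hdiff := (hlim b hab le_rfl).sub (hlim a le_rfl hab)
  have hzero : Tendsto (fun T : ℝ => vint h b T - vint h a T) atTop (𝓝 0) := by
    apply squeeze_zero_norm' (a := fun T : ℝ => 2 * (B * Real.exp (-(T ^ 2) / 4)) * (b - a))
    · filter_upwards [eventually_ge_atTop 0] with T hT
      apply norm_vint_sub_le hab hT (fun z h1 h2 _ => hd z h1 h2)
      intro z h1 h2 h3
      rw [← h3, sq_abs]
      exact hB z h1 h2
    · have : Tendsto (fun T : ℝ => Real.exp (-(T ^ 2) / 4)) atTop (𝓝 0) := by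
        apply Real.tendsto_exp_atBot.comp
        apply Tendsto.atBot_div_const (by norm_num)
        exact tendsto_neg_atTop_atBot.comp (tendsto_pow_atTop (by norm_num))
      simpa using ((this.const_mul B).const_mul 2).mul_const (b - a)
  exact sub_eq_zero.mp (tendsto_nhds_unique hdiff hzero)

theorem norm_integral_sub_truncated_le {h : ℝ → ℂ} {B T : ℝ} (hT : 0 ≤ T) (hB0 : 0 ≤ B)
    (hi : Integrable h) (hB : ∀ y : ℝ, ‖h y‖ ≤ B * Real.exp (-(y ^ 2) / 4)) :
    ‖(∫ y : ℝ, h y) - ∫ y in (-T)..T, h y‖ ≤ 10 * B * Real.exp (-(T ^ 2) / 8) := by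
  have hg : Integrable (fun y : ℝ => Real.exp (-(1 / 8) * y ^ 2)) :=
    integrable_exp_neg_mul_sq (by norm_num)
  have h1 : (∫ y : ℝ, h y) - ∫ y in (-T)..T, h y = ∫ y in (Ioc (-T) T)ᶜ, h y := by
    rw [intervalIntegral.integral_of_le (by linarith),
      ← integral_add_compl (s := Ioc (-T) T) measurableSet_Ioc hi]
    ring
  rw [h1]
  -- Half of the Gaussian exponent is given up for the factor exp(−T²/8), the other half keeps the
  -- integral finite.
  calc ‖∫ y in (Ioc (-T) T)ᶜ, h y‖
      ≤ ∫ y in (Ioc (-T) T)ᶜ, B * Real.exp (-(T ^ 2) / 8) * Real.exp (-(1 / 8) * y ^ 2) := by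
        apply norm_integral_le_of_norm_le (hg.const_mul _).integrableOn
        filter_upwards [ae_restrict_mem measurableSet_Ioc.compl] with y hy
        refine (hB y).trans ?_
        rw [mul_assoc, ← Real.exp_add]
        gcongr
        have : T ^ 2 ≤ y ^ 2 := by
          apply sq_le_sq.mpr
          rw [abs_of_nonneg hT]
          by_contra! hlt
          rw [abs_lt] at hlt
          exact hy ⟨hlt.1, hlt.2.le⟩
        linarith
    _ ≤ ∫ y : ℝ, B * Real.exp (-(T ^ 2) / 8) * Real.exp (-(1 / 8) * y ^ 2) := by
        apply setIntegral_le_integral (hg.const_mul _)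
        exact ae_of_all _ fun y => by positivity
    _ = B * Real.exp (-(T ^ 2) / 8) * Real.sqrt (Real.pi / (1 / 8)) := by
        rw [integral_const_mul, integral_gaussian]
    _ ≤ B * Real.exp (-(T ^ 2) / 8) * 10 := by
        gcongr
        rw [Real.sqrt_le_left (by norm_num)]
        linarith [Real.pi_lt_four]
    _ = _ := by ring

end LandauSiegel

/-! ### Lipschitz bounds for log Γ at large height, by way of Euler's limit. -/

namespace LandauSiegel
open Set Filter Topology
open scoped Interval

theorem norm_add_nat_ge {s : ℂ} (h1 : -1 ≤ s.re) (h2 : 1 ≤ s.im) (j : ℕ) :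
    ((j : ℝ) + 1) / 3 ≤ ‖s + j‖ := by
  have e1 : (j : ℝ) - 1 ≤ ‖s + j‖ := by
    have := re_le_norm (s + j)
    simp at this; linarith
  have e2 : 1 ≤ ‖s + j‖ := by
    have := im_le_norm (s + j)
    simp at this; linarith
  linarith

/-- The first bound serves for j up to the size of s, the second for larger j, where the difference
(1 − s) / ((s + j)(j + 1)) is summable. -/
theorem norm_inv_add_nat_sub_le {s : ℂ} {X : ℝ} (h1 : -1 ≤ s.re) (h2 : 1 ≤ s.im) (hX : ‖s‖ ≤ X)
    (j : ℕ) : ‖1 / (s + j) - 1 / ((j : ℂ) + 1)‖ ≤ 4 * ((j : ℝ) + 1)⁻¹ ∧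
      ‖1 / (s + j) - 1 / ((j : ℂ) + 1)‖ ≤ 3 * (X + 1) / ((j : ℝ) + 1) ^ 2 := by
  have hj : (0 : ℝ) < (j : ℝ) + 1 := by positivity
  have hn := norm_add_nat_ge h1 h2 j
  have hpos : 0 < ‖s + j‖ := by linarith [div_pos hj (by norm_num : (0:ℝ) < 3)]
  have hj' : ‖(j : ℂ) + 1‖ = (j : ℝ) + 1 := by
    rw [← Nat.cast_add_one, norm_natCast]; simp
  have e0 : ‖1 / (s + j)‖ ≤ 3 / ((j : ℝ) + 1) := by
    rw [norm_div, norm_one, div_le_div_iff₀ hpos hj]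
    linarith
  constructor
  · refine (norm_sub_le _ _).trans ?_
    rw [norm_div 1 ((j : ℂ) + 1), norm_one, hj']
    have : 4 * ((j : ℝ) + 1)⁻¹ = 3 / ((j : ℝ) + 1) + 1 / ((j : ℝ) + 1) := by
      field_simp; norm_num
    linarith
  · have : 1 / (s + j) - 1 / ((j : ℂ) + 1) = 1 / (s + j) * ((1 - s) / ((j : ℂ) + 1)) := by
      have a1 : s + j ≠ 0 := norm_pos_iff.mp hpos
      have a2 : (j : ℂ) + 1 ≠ 0 := norm_pos_iff.mp (hj' ▸ hj)
      field_simp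
      ring
    rw [this, norm_mul, norm_div (1 - s), hj']
    have h3 : ‖1 - s‖ ≤ X + 1 := by
      refine (norm_sub_le _ _).trans ?_
      rw [norm_one]; linarith
    calc ‖1 / (s + j)‖ * (‖1 - s‖ / (j + 1)) ≤ 3 / ((j : ℝ) + 1) * ((X + 1) / (j + 1)) := by
          gcongr
      _ = _ := by field_simp

/-- The sum is cut at N = ⌈X⌉: below N it is dominated by a harmonic sum of size log X, above N by a
telescoping series of total O(1). -/
theorem sum_norm_inv_add_nat_sub_le {s : ℂ} {X : ℝ} (h1 : -1 ≤ s.re) (h2 : 1 ≤ s.im)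
    (hX : ‖s‖ ≤ X) (hX2 : 2 ≤ X) (n : ℕ) :
    ∑ j ∈ Finset.range n, ‖1 / (s + j) - 1 / ((j : ℂ) + 1)‖ ≤ 20 * Real.log X + 20 := by
  set N := ⌈X⌉₊ with hN
  have hNX : X ≤ N := Nat.le_ceil X
  have hNX' : (N : ℝ) < X + 1 := Nat.ceil_lt_add_one (by linarith)
  have hN0 : (0 : ℝ) < N := by linarith
  have hlog : Real.log N ≤ 2 * Real.log X := by
    rw [← Real.log_rpow (by linarith)]
    apply Real.log_le_log hN0
    norm_num
    nlinarith
  have hharm : ∀ n : ℕ, ∑ j ∈ Finset.range n, ‖1 / (s + j) - 1 / ((j : ℂ) + 1)‖ ≤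
      4 * (harmonic n : ℝ) := by
    intro n
    rw [harmonic]
    push_cast
    rw [Finset.mul_sum]
    exact Finset.sum_le_sum fun j _ => (norm_inv_add_nat_sub_le h1 h2 hX j).1
  have hHN : (harmonic N : ℝ) ≤ 1 + 2 * Real.log X := (harmonic_le_one_add_log N).trans (by linarith)
  have hlogX : 0 ≤ Real.log X := Real.log_nonneg (by linarith)
  have step : ∀ n, N ≤ n → ∑ j ∈ Finset.range n, ‖1 / (s + j) - 1 / ((j : ℂ) + 1)‖ ≤
      4 * (harmonic N : ℝ) + 3 * (X + 1) * (1 / N - 1 / n) := by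
    intro n hn
    induction n, hn using Nat.le_induction with
    | base => simpa using hharm N
    | succ n hn ih =>
      rw [Finset.sum_range_succ]
      have hn0 : (0 : ℝ) < n := hN0.trans_le (by exact_mod_cast hn)
      have := (norm_inv_add_nat_sub_le h1 h2 hX n).2
      have h3 : 3 * (X + 1) / ((n : ℝ) + 1) ^ 2 ≤ 3 * (X + 1) * (1 / n - 1 / ((n : ℝ) + 1)) := by
        rw [div_eq_mul_one_div]
        gcongr
        rw [div_sub_div _ _ hn0.ne' (by positivity), div_le_div_iff₀ (by positivity) (by positivity)]
        ring_nf
        nlinarith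
      push_cast
      linarith
  rcases le_total N n with hn | hn
  · have := step n hn
    have hn0 : (0 : ℝ) < n := hN0.trans_le (by exact_mod_cast hn)
    have h4 : 3 * (X + 1) * (1 / N - 1 / n) ≤ 3 * (X + 1) * (1 / X) := by
      gcongr
      have : (1 : ℝ) / N ≤ 1 / X := by gcongr
      have : (0 : ℝ) ≤ 1 / n := by positivity
      linarith
    have h5 : 3 * (X + 1) * (1 / X) ≤ 6 := by
      rw [mul_one_div, div_le_iff₀ (by linarith)]; linarith
    linarith
  · refine (Finset.sum_le_sum_of_subset_of_nonneg (Finset.range_mono hn)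
      (fun _ _ _ => norm_nonneg _)).trans ?_
    linarith [hharm N]

/-- The quantity bounded is the logarithmic derivative of the n-th Euler approximant to Γ. The bound
is uniform in n, which stands in for an estimate of the digamma function. -/
theorem norm_log_sub_sum_le {s : ℂ} {X : ℝ} (h1 : -1 ≤ s.re) (h2 : 1 ≤ s.im)
    (hX : ‖s‖ ≤ X) (hX2 : 2 ≤ X) {n : ℕ} (hn : 1 ≤ n) :
    ‖(Real.log n : ℂ) - ∑ j ∈ Finset.range (n + 1), 1 / (s + j)‖ ≤ 70 * Real.log X := by
  have e : (Real.log n : ℂ) - ∑ j ∈ Finset.range (n + 1), 1 / (s + j) =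
      ((Real.log n - harmonic (n + 1) : ℝ) : ℂ) -
        ∑ j ∈ Finset.range (n + 1), (1 / (s + j) - 1 / ((j : ℂ) + 1)) := by
    rw [Finset.sum_sub_distrib, harmonic]
    push_cast
    simp only [one_div]
    ring
  rw [e]
  refine (norm_sub_le _ _).trans ?_
  have a1 := (norm_sum_le (Finset.range (n + 1)) _).trans
    (sum_norm_inv_add_nat_sub_le h1 h2 hX hX2 (n + 1))
  have a2 : |Real.log n - harmonic (n + 1)| ≤ 2 := by
    have b1 := harmonic_le_one_add_log (n + 1)
    have b2 := log_add_one_le_harmonic (n + 1)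
    have hn' : (1 : ℝ) ≤ n := by exact_mod_cast hn
    have b3 : Real.log ((n + 1 : ℕ) : ℝ) ≤ Real.log 2 + Real.log n := by
      rw [← Real.log_mul (by norm_num) (by positivity)]
      apply Real.log_le_log (by positivity)
      push_cast; linarith
    have b4 : Real.log n ≤ Real.log (((n + 1 : ℕ) : ℝ) + 1) := by
      apply Real.log_le_log (by positivity)
      push_cast; linarith
    have b5 := Real.log_two_lt_d9
    have b6 : Real.log ((n + 1 + 1 : ℕ) : ℝ) = Real.log (((n + 1 : ℕ) : ℝ) + 1) := by push_cast; rfl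
    rw [abs_le]
    constructor <;> linarith
  have hlog : (1/2 : ℝ) ≤ Real.log X := by
    have := Real.log_le_log (by norm_num) hX2
    linarith [Real.log_two_gt_d9]
  rw [norm_real, Real.norm_eq_abs]
  linarith

/-- Ratios of values of `Γ` in a half-strip, with a Lipschitz bound for a logarithm. -/
theorem Gamma_ratio {s₁ s₂ : ℂ} {X : ℝ} (h1 : -1 ≤ s₁.re) (h1' : 1 ≤ s₁.im) (hX1 : ‖s₁‖ ≤ X)
    (h2 : -1 ≤ s₂.re) (h2' : 1 ≤ s₂.im) (hX2 : ‖s₂‖ ≤ X) (hX : 2 ≤ X) :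
    ∃ θ : ℂ, Gamma s₁ = Gamma s₂ * exp θ ∧ ‖θ‖ ≤ 70 * Real.log X * ‖s₁ - s₂‖ := by
  set S : Set ℂ := {s | -1 ≤ s.re ∧ 1 ≤ s.im ∧ ‖s‖ ≤ X} with hS
  have hconv : Convex ℝ S := by
    have : S = {s : ℂ | -1 ≤ s.re} ∩ ({s : ℂ | 1 ≤ s.im} ∩ Metric.closedBall 0 X) := by
      ext s; simp [hS]
    rw [this]
    exact (convex_halfSpace_re_ge _).inter ((convex_halfSpace_im_ge _).inter (convex_closedBall _ _))
  have hslit : ∀ s ∈ S, ∀ j : ℕ, s + j ∈ slitPlane := by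
    intro s hs j
    right
    have := hs.2.1
    simp; linarith
  -- Φ n is a logarithm of the n-th Euler approximant without its factor n!, which cancels in
  -- ratios. Principal logarithms are differentiable here because every s + j lies in the upper
  -- half-plane.
  let Φ : ℕ → ℂ → ℂ := fun n s => (Real.log n : ℂ) * s - ∑ j ∈ Finset.range (n + 1), log (s + j)
  have hder : ∀ n, ∀ s ∈ S, HasDerivAt (Φ n)
      ((Real.log n : ℂ) - ∑ j ∈ Finset.range (n + 1), 1 / (s + j)) s := by
    intro n s hs
    apply HasDerivAt.sub
    · simpa using (hasDerivAt_id s).const_mul (Real.log n : ℂ)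
    · apply HasDerivAt.fun_sum
      intro j _
      exact ((hasDerivAt_id s).add_const (j : ℂ)).clog (hslit s hs j)
  have hlip : ∀ n, 1 ≤ n → ‖Φ n s₁ - Φ n s₂‖ ≤ 70 * Real.log X * ‖s₁ - s₂‖ := by
    intro n hn
    exact hconv.norm_image_sub_le_of_norm_hasDerivWithin_le (f := Φ n)
      (fun s hs => (hder n s hs).hasDerivWithinAt)
      (fun s hs => norm_log_sub_sum_le hs.1 hs.2.1 hs.2.2 hX hn) ⟨h2, h2', hX2⟩ ⟨h1, h1', hX1⟩
  have hseq : ∀ n, 1 ≤ n → ∀ s ∈ S, GammaSeq s n = n.factorial * exp (Φ n s) := by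
    intro n hn s hs
    have hn0 : (n : ℂ) ≠ 0 := by exact_mod_cast (by lia : n ≠ 0)
    simp only [GammaSeq, Φ]
    rw [Complex.exp_sub, exp_sum, cpow_def_of_ne_zero hn0, natCast_log]
    have : ∏ j ∈ Finset.range (n + 1), exp (log (s + j)) = ∏ j ∈ Finset.range (n + 1), (s + j) :=
      Finset.prod_congr rfl fun j _ => exp_log (slitPlane_ne_zero (hslit s hs j))
    rw [this]
    ring
  have hrat : ∀ n, 1 ≤ n → GammaSeq s₁ n = GammaSeq s₂ n * exp (Φ n s₁ - Φ n s₂) := by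
    intro n hn
    rw [hseq n hn _ ⟨h1, h1', hX1⟩, hseq n hn _ ⟨h2, h2', hX2⟩, mul_assoc, ← Complex.exp_add]
    congr 2; ring
  -- The logarithms of the ratios lie in a fixed compact disc, so a subsequence converges; any limit
  -- point serves, because the ratios themselves converge.
  obtain ⟨θ, hθ, φ, hφ, hlim⟩ := (isCompact_closedBall (0 : ℂ)
    (70 * Real.log X * ‖s₁ - s₂‖)).tendsto_subseq
      (x := fun n => Φ (n + 1) s₁ - Φ (n + 1) s₂) (fun n => by
        simpa using hlip (n + 1) (by lia))
  refine ⟨θ, ?_, by simpa using hθ⟩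
  have t1 := (GammaSeq_tendsto_Gamma s₁).comp
    ((tendsto_add_atTop_nat 1).comp hφ.tendsto_atTop)
  have t2 := (GammaSeq_tendsto_Gamma s₂).comp
    ((tendsto_add_atTop_nat 1).comp hφ.tendsto_atTop)
  have t3 := t2.mul ((continuous_exp.tendsto θ).comp hlim)
  refine tendsto_nhds_unique t1 (t3.congr fun n => ?_)
  simp only [Function.comp]
  exact (hrat _ (by lia)).symm

end LandauSiegel

/-! ### The functional equation for a single character, and the size and variation of Δ. -/

namespace LandauSiegel
open Set Filter Topology
open scoped Interval ComplexConjugate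

theorem ne_one_of_isPrimitive {k : ℕ} [NeZero k] {ψ : DirichletCharacter ℂ k} (hψ : ψ.IsPrimitive)
    (hk : k ≠ 1) : ψ ≠ 1 := by
  rintro rfl
  rw [isPrimitive_def, conductor_one] at hψ
  exact hk hψ.symm

theorem inv_apply_eq_conj {k : ℕ} [NeZero k] (ψ : DirichletCharacter ℂ k) (a : ZMod k) :
    ψ⁻¹ a = conj (ψ a) := (MulChar.star_apply' ψ a).symm

theorem conj_natCast_cpow (n : ℕ) (s : ℂ) : conj ((n : ℂ) ^ s) = (n : ℂ) ^ (conj s) := by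
  rw [cpow_conj _ _ (by rw [natCast_arg]; exact Real.pi_ne_zero.symm)]
  simp

/-- Both sides are entire and their Dirichlet series agree termwise for Re s > 1, so the identity
theorem applies. -/
theorem LFunction_inv_eq_conj {k : ℕ} [NeZero k] {ψ : DirichletCharacter ℂ k} (hψ : ψ ≠ 1)
    (s : ℂ) : LFunction ψ⁻¹ s = conj (LFunction ψ (conj s)) := by
  have h1 : Differentiable ℂ (LFunction ψ⁻¹) := differentiable_LFunction (inv_ne_one.mpr hψ)
  have h2 : Differentiable ℂ (fun s => conj (LFunction ψ (conj s))) := by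
    intro s
    have := (differentiable_LFunction hψ (conj s)).conj_conj
    rwa [conj_conj] at this
  have := AnalyticOnNhd.eq_of_eventuallyEq (z₀ := (2 : ℂ)) (fun s _ => h1.analyticAt s)
    (fun s _ => h2.analyticAt s) ?_
  · exact congrFun this s
  · have : {s : ℂ | 1 < s.re} ∈ 𝓝 (2 : ℂ) :=
      (isOpen_lt continuous_const continuous_re).mem_nhds (by simp)
    filter_upwards [this] with s hs
    rw [LFunction_eq_LSeries _ hs, LFunction_eq_LSeries _ (by simpa using hs), LSeries, LSeries,
      conj_tsum]
    congr 1; ext n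
    rcases eq_or_ne n 0 with rfl | hn
    · simp
    · rw [LSeries.term_of_ne_zero hn, LSeries.term_of_ne_zero hn, map_div₀, conj_natCast_cpow,
        conj_conj, inv_apply_eq_conj]

/-- The functional equation in terms of a single character. -/
theorem LFunction_eq_Delta_mul_conj {k : ℕ} [NeZero k] {ψ : DirichletCharacter ℂ k}
    (hψ : ψ.IsPrimitive) (h1 : ψ ≠ 1) {s : ℂ} (hs : s.im ≠ 0) :
    LFunction ψ s = Delta ψ s * conj (LFunction ψ (1 - conj s)) := by
  rw [LFunction_eq_Delta_mul hψ hs, LFunction_inv_eq_conj h1]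
  simp

/-- The shift in the Gamma factor of `ψ`. -/
noncomputable def parity {k : ℕ} (ψ : DirichletCharacter ℂ k) : ℝ :=
  open Classical in if ψ.Even then 0 else 1

theorem parity_mem {k : ℕ} (ψ : DirichletCharacter ℂ k) : 0 ≤ parity ψ ∧ parity ψ ≤ 1 := by
  unfold parity; split_ifs <;> norm_num

theorem gammaFactor_eq {k : ℕ} [NeZero k] (ψ : DirichletCharacter ℂ k) (s : ℂ) :
    gammaFactor ψ s = Gammaℝ (s + parity ψ) := by
  unfold parity
  split_ifs with h
  · rw [h.gammaFactor_def]; simp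
  · have := ψ.even_or_odd.resolve_left h
    rw [this.gammaFactor_def]; simp

theorem Gammaℝ_conj (s : ℂ) : Gammaℝ (conj s) = conj (Gammaℝ s) := by
  rw [Gammaℝ_def, Gammaℝ_def, map_mul, ← Gamma_conj]
  have e : ∀ w : ℂ, conj (w / 2) = conj w / 2 := fun w => by rw [map_div₀, map_ofNat]
  congr 1
  · rw [← map_neg, ← e, cpow_conj _ _ (by
      rw [arg_ofReal_of_nonneg Real.pi_pos.le]; exact Real.pi_ne_zero.symm), conj_ofReal]
  · rw [e]

theorem Gammaℝ_ne_zero_of_im {s : ℂ} (hs : s.im ≠ 0) : Gammaℝ s ≠ 0 := by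
  rw [Ne, Gammaℝ_eq_zero_iff]
  rintro ⟨n, hn⟩
  apply hs
  simpa using congrArg Complex.im hn

theorem differentiableAt_Gammaℝ {s : ℂ} (hs : s.im ≠ 0) : DifferentiableAt ℂ Gammaℝ s := by
  have h := (differentiable_Gammaℝ_inv s).inv (inv_ne_zero (Gammaℝ_ne_zero_of_im hs))
  have e : (fun s => (Gammaℝ s)⁻¹)⁻¹ = Gammaℝ := by ext; simp
  rwa [e] at h

theorem differentiableAt_Delta {k : ℕ} [NeZero k] (ψ : DirichletCharacter ℂ k) {s : ℂ}
    (hs : s.im ≠ 0) : DifferentiableAt ℂ (Delta ψ) s := by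
  have hk : (k : ℂ) ≠ 0 := by exact_mod_cast NeZero.ne k
  have e : Delta ψ = fun s => rootNumber ψ * (k : ℂ) ^ (1 / 2 - s) *
      Gammaℝ (1 - s + parity ψ) / Gammaℝ (s + parity ψ) := by
    ext s; rw [Delta, gammaFactor_eq, gammaFactor_eq]
  rw [e]
  have d1 : DifferentiableAt ℂ (fun s : ℂ => Gammaℝ (s + parity ψ)) s :=
    (differentiableAt_Gammaℝ (s := s + parity ψ) (by simpa using hs)).comp s
      (differentiableAt_id.add_const _)
  have d2 : DifferentiableAt ℂ (fun s : ℂ => Gammaℝ (1 - s + parity ψ)) s :=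
    (differentiableAt_Gammaℝ (s := 1 - s + parity ψ) (by simpa using hs)).comp s
      ((differentiableAt_id.const_sub 1).add_const _)
  have d3 : DifferentiableAt ℂ (fun s : ℂ => (k : ℂ) ^ (1 / 2 - s)) s :=
    DifferentiableAt.const_cpow (by fun_prop) (Or.inl hk)
  exact ((d3.const_mul _).mul d2).div d1 (Gammaℝ_ne_zero_of_im (by simpa using hs))

/-- On the critical line the two Gamma factors are conjugate, so |Δ| is the modulus of the root
number there. At a point 1/2 + it the functional equation relates L to its own conjugate, so this
modulus is 1 as soon as L does not vanish at that point. -/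
theorem norm_rootNumber {k : ℕ} [NeZero k] {ψ : DirichletCharacter ℂ k}
    (hψ : ψ.IsPrimitive) (h1 : ψ ≠ 1) : ‖rootNumber ψ‖ = 1 := by
  have hk : 0 < k := Nat.pos_of_ne_zero (NeZero.ne k)
  have hΔ : ∀ t : ℝ, t ≠ 0 → ‖Delta ψ (1 / 2 + t * I)‖ = ‖rootNumber ψ‖ := by
    intro t ht
    rw [Delta, gammaFactor_eq, gammaFactor_eq, norm_div, norm_mul, norm_mul]
    have e1 : (1 - (1 / 2 + t * I) + parity ψ : ℂ) = conj (1 / 2 + t * I + parity ψ) := by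
      apply Complex.ext <;> simp
      norm_num
    rw [e1, Gammaℝ_conj, norm_conj]
    have : ‖Gammaℝ (1 / 2 + t * I + parity ψ)‖ ≠ 0 :=
      norm_ne_zero_iff.mpr (Gammaℝ_ne_zero_of_im (by simpa using ht))
    rw [mul_div_cancel_right₀ _ this, norm_natCast_cpow_of_pos hk]
    simp
  have hne : ∃ t : ℝ, t ≠ 0 ∧ LFunction ψ (1 / 2 + t * I) ≠ 0 := by
    by_contra! hall
    have hd := differentiable_LFunction h1
    -- If L vanished at all points 1/2 + it with t ≠ 0, these would accumulate at 1/2 and L would be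
    -- identically zero, against its non-vanishing at 2.
    have := AnalyticOnNhd.eqOn_zero_of_preconnected_of_frequently_eq_zero (z₀ := (1 / 2 : ℂ))
      (fun s _ => hd.analyticAt s) isPreconnected_univ (mem_univ _) (by
        have ht : Tendsto (fun t : ℝ => (1 / 2 : ℂ) + t * I) (𝓝[≠] 0) (𝓝[≠] (1 / 2)) := by
          rw [tendsto_nhdsWithin_iff]
          constructor
          · have : Continuous (fun t : ℝ => (1 / 2 : ℂ) + t * I) := by fun_prop
            have := (this.tendsto 0).mono_left (nhdsWithin_le_nhds (s := {0}ᶜ))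
            simpa using this
          · filter_upwards [self_mem_nhdsWithin] with t ht
            simpa using ht
        apply ht.frequently
        apply Eventually.frequently
        filter_upwards [self_mem_nhdsWithin] with t ht
        exact hall t ht)
    have h2 := this (mem_univ (2 : ℂ))
    exact LFunction_ne_zero_of_one_le_re ψ (s := 2) (Or.inl h1) (by simp) h2
  obtain ⟨t, ht, hL⟩ := hne
  have := LFunction_eq_Delta_mul_conj hψ h1 (s := 1 / 2 + t * I) (by simpa using ht)
  have e2 : (1 - conj (1 / 2 + t * I) : ℂ) = 1 / 2 + t * I := by
    apply Complex.ext <;> simp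
    norm_num
  rw [e2] at this
  have h3 := congrArg norm this
  rw [norm_mul, norm_conj, hΔ t ht] at h3
  have : ‖LFunction ψ (1 / 2 + t * I)‖ ≠ 0 := norm_ne_zero_iff.mpr hL
  exact (mul_eq_right₀ this).mp h3.symm

theorem norm_Delta_critical {k : ℕ} [NeZero k] {ψ : DirichletCharacter ℂ k}
    (hψ : ψ.IsPrimitive) (h1 : ψ ≠ 1) {s : ℂ} (hs : s.re = 1 / 2) (hs' : s.im ≠ 0) :
    ‖Delta ψ s‖ = 1 := by
  have hk : 0 < k := Nat.pos_of_ne_zero (NeZero.ne k)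
  rw [Delta, gammaFactor_eq, gammaFactor_eq, norm_div, norm_mul, norm_mul, norm_rootNumber hψ h1]
  have e1 : (1 - s + parity ψ : ℂ) = conj (s + parity ψ) := by
    apply Complex.ext <;> simp [hs]; norm_num
  rw [e1, Gammaℝ_conj, norm_conj]
  have : ‖Gammaℝ (s + parity ψ)‖ ≠ 0 :=
    norm_ne_zero_iff.mpr (Gammaℝ_ne_zero_of_im (by simpa using hs'))
  rw [mul_div_cancel_right₀ _ this, norm_natCast_cpow_of_pos hk]
  simp [hs]

/-- Halving the argument turns 70 into 35, and the power of π costs at most one more log X. -/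
theorem Gammaℝ_ratio {s₁ s₂ : ℂ} {X : ℝ} (h1 : -2 ≤ s₁.re) (h1' : 2 ≤ s₁.im) (hX1 : ‖s₁‖ ≤ X)
    (h2 : -2 ≤ s₂.re) (h2' : 2 ≤ s₂.im) (hX2 : ‖s₂‖ ≤ X) :
    ∃ θ : ℂ, Gammaℝ s₁ = Gammaℝ s₂ * exp θ ∧ ‖θ‖ ≤ 36 * Real.log X * ‖s₁ - s₂‖ := by
  have hX : 2 ≤ X := h1'.trans ((im_le_norm s₁).trans hX1)
  have hpos : 0 ≤ Real.log X := Real.log_nonneg (by linarith)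
  have hn : ∀ s : ℂ, ‖s‖ ≤ X → ‖s / 2‖ ≤ X := by
    intro s hs
    rw [norm_div]; norm_num; linarith
  obtain ⟨θ, h, hθ⟩ := Gamma_ratio (s₁ := s₁ / 2) (s₂ := s₂ / 2) (X := X)
    (by simp; linarith) (by simp; linarith) (hn _ hX1) (by simp; linarith) (by simp; linarith)
    (hn _ hX2) hX
  refine ⟨θ - (s₁ - s₂) / 2 * Real.log Real.pi, ?_, ?_⟩
  · have hπ : (Real.pi : ℂ) ≠ 0 := by exact_mod_cast Real.pi_ne_zero
    rw [Gammaℝ_def, Gammaℝ_def, h, cpow_def_of_ne_zero hπ, cpow_def_of_ne_zero hπ,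
      ← ofReal_log Real.pi_pos.le]
    have e : cexp (Real.log Real.pi * (-s₂ / 2)) * cexp (θ - (s₁ - s₂) / 2 * Real.log Real.pi) =
        cexp (Real.log Real.pi * (-s₁ / 2)) * cexp θ := by
      rw [← Complex.exp_add, ← Complex.exp_add]
      congr 1; ring
    linear_combination (-Gamma (s₂ / 2)) * e
  · refine (norm_sub_le _ _).trans ?_
    have hlogpi : |Real.log Real.pi| ≤ 2 * Real.log X := by
      rw [abs_of_nonneg (Real.log_nonneg (by linarith [Real.pi_gt_three]))]
      rw [← Real.log_rpow (by linarith)]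
      apply Real.log_le_log Real.pi_pos
      norm_num
      nlinarith [Real.pi_lt_four]
    have e : ‖s₁ / 2 - s₂ / 2‖ = ‖s₁ - s₂‖ / 2 := by
      rw [← sub_div, norm_div]; norm_num
    have e' : ‖(s₁ - s₂) / 2‖ = ‖s₁ - s₂‖ / 2 := by
      rw [norm_div]; norm_num
    rw [e] at hθ
    rw [norm_mul, e', norm_real, Real.norm_eq_abs]
    nlinarith [norm_nonneg (s₁ - s₂)]

/-- The power of k supplies the main term and each of the two Gamma factors an error of 36 log X.
The numerator lives in the lower half-plane and is brought back to the upper one by conjugation. -/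
theorem Delta_ratio {k : ℕ} [NeZero k] {ψ : DirichletCharacter ℂ k} {s₁ s₂ : ℂ} {X : ℝ}
    (h1 : -2 ≤ s₁.re) (k1 : s₁.re ≤ 3) (h1' : 2 ≤ s₁.im) (hX1 : ‖s₁‖ + 2 ≤ X)
    (h2 : -2 ≤ s₂.re) (k2 : s₂.re ≤ 3) (h2' : 2 ≤ s₂.im) (hX2 : ‖s₂‖ + 2 ≤ X) :
    ∃ θ : ℂ, Delta ψ s₁ = Delta ψ s₂ * exp (-(s₁ - s₂) * Real.log k + θ) ∧
      ‖θ‖ ≤ 72 * Real.log X * ‖s₁ - s₂‖ := by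
  have hk : (k : ℂ) ≠ 0 := by exact_mod_cast NeZero.ne k
  obtain ⟨p1, p2⟩ := parity_mem ψ
  have hp : ‖(parity ψ : ℂ)‖ ≤ 1 := by
    rw [norm_real, Real.norm_eq_abs, abs_of_nonneg p1]; exact p2
  have hnum : ∀ s : ℂ, ‖s‖ + 2 ≤ X → ‖s + parity ψ‖ ≤ X := fun s hs =>
    (norm_add_le _ _).trans (by linarith)
  have hnum' : ∀ s : ℂ, ‖s‖ + 2 ≤ X → ‖1 - conj s + parity ψ‖ ≤ X := fun s hs => by
    refine (norm_add_le _ _).trans ?_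
    have := norm_sub_le 1 (conj s)
    rw [norm_conj, norm_one] at this
    linarith
  obtain ⟨θ, h, hθ⟩ := Gammaℝ_ratio (s₁ := s₁ + parity ψ) (s₂ := s₂ + parity ψ) (X := X)
    (by simp; linarith) (by simpa using h1') (hnum _ hX1)
    (by simp; linarith) (by simpa using h2') (hnum _ hX2)
  obtain ⟨θ', h', hθ'⟩ := Gammaℝ_ratio (s₁ := 1 - conj s₁ + parity ψ)
    (s₂ := 1 - conj s₂ + parity ψ) (X := X)
    (by simp; linarith) (by simpa using h1') (hnum' _ hX1)
    (by simp; linarith) (by simpa using h2') (hnum' _ hX2)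
  have hc : ∀ s : ℂ, Gammaℝ (1 - s + parity ψ) = conj (Gammaℝ (1 - conj s + parity ψ)) := by
    intro s
    rw [← Gammaℝ_conj]; simp
  refine ⟨conj θ' - θ, ?_, ?_⟩
  · rw [Delta, Delta, gammaFactor_eq, gammaFactor_eq, gammaFactor_eq, gammaFactor_eq, hc s₁, h',
      map_mul, ← hc s₂, h, ← exp_conj, cpow_def_of_ne_zero hk, cpow_def_of_ne_zero hk, natCast_log]
    have n1 : Gammaℝ (s₂ + parity ψ) ≠ 0 := Gammaℝ_ne_zero_of_im (by simp; linarith)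
    have e : cexp (-(s₁ - s₂) * log ↑k + (conj θ' - θ)) * cexp (log ↑k * (1 / 2 - s₂)) * cexp θ =
        cexp (log ↑k * (1 / 2 - s₁)) * cexp (conj θ') := by
      rw [← Complex.exp_add, ← Complex.exp_add, ← Complex.exp_add]
      congr 1; ring
    have n2 := exp_ne_zero θ
    rw [div_eq_iff (mul_ne_zero n1 n2), div_mul_eq_mul_div, div_mul_eq_mul_div, eq_div_iff n1]
    linear_combination (-(rootNumber ψ * Gammaℝ (1 - s₂ + parity ψ) * Gammaℝ (s₂ + parity ψ))) * e
  · refine (norm_sub_le _ _).trans ?_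
    rw [norm_conj]
    have e1 : ‖s₁ + parity ψ - (s₂ + parity ψ)‖ = ‖s₁ - s₂‖ := by congr 1; ring
    have e2 : ‖1 - conj s₁ + parity ψ - (1 - conj s₂ + parity ψ)‖ = ‖s₁ - s₂‖ := by
      rw [← norm_conj (s₁ - s₂), ← norm_neg (conj (s₁ - s₂))]
      congr 1; simp
    rw [e1] at hθ
    rw [e2] at hθ'
    linarith

/-! ### Bounds for L-functions in the right half-plane. -/

theorem norm_sum_Icc_le {k : ℕ} [NeZero k] {ψ : DirichletCharacter ℂ k} (h1 : ψ ≠ 1) (n : ℕ) :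
    ‖∑ j ∈ Finset.Icc 1 n, ψ j‖ ≤ k := by
  -- A complete period of a nontrivial character sums to zero, so only an incomplete period of fewer
  -- than k terms matters.
  have hper : ∀ m, ∑ j ∈ Finset.Icc 1 (m + k), ψ j = ∑ j ∈ Finset.Icc 1 m, ψ j := by
    intro m
    have hsplit : ∑ j ∈ Finset.Icc 1 (m + k), ψ j = ∑ j ∈ Finset.Icc 1 m, ψ j +
        ∑ j ∈ Finset.range k, ψ ((m + 1 + j : ℕ) : ZMod k) := by
      have hI : ∀ n, Finset.Icc 1 n = Finset.Ico 1 (n + 1) := fun n => by ext; simp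
      rw [hI, hI, ← Finset.sum_Ico_consecutive _ (by lia : 1 ≤ m + 1) (by lia : m + 1 ≤ m + k + 1),
        Finset.sum_Ico_eq_sum_range _ (m + 1)]
      congr 3
      lia
    rw [hsplit]
    have : ∑ j ∈ Finset.range k, ψ ((m + 1 + j : ℕ) : ZMod k) = ∑ a : ZMod k, ψ a := by
      rw [← Equiv.sum_comp (Equiv.addLeft ((m + 1 : ℕ) : ZMod k))]
      apply Finset.sum_bij' (fun (j : ℕ) _ => (j : ZMod k)) (fun (a : ZMod k) _ => a.val)
      · simp
      · intro a _; simpa using ZMod.val_lt a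
      · intro j hj
        exact ZMod.val_cast_of_lt (by simpa using hj)
      · intro a _; exact ZMod.natCast_zmod_val a
      · intro j _; simp [add_assoc]
    rw [this, MulChar.sum_eq_zero_of_ne_one h1, add_zero]
  induction n using Nat.strong_induction_on with
  | _ n ih =>
    rcases lt_or_ge n k with h | h
    · calc ‖∑ j ∈ Finset.Icc 1 n, ψ j‖ ≤ ∑ j ∈ Finset.Icc 1 n, (1 : ℝ) :=
            norm_sum_le_of_le _ fun j _ => ψ.norm_le_one _
        _ = n := by simp
        _ ≤ k := by exact_mod_cast h.le
    · obtain ⟨m, rfl⟩ := Nat.exists_eq_add_of_le' h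
      rw [hper]
      exact ih m (by have := NeZero.pos k; lia)

/-- The polynomial bound for a Dirichlet `L`-function in the right half-plane. -/
theorem norm_LFunction_le {k : ℕ} [NeZero k] {ψ : DirichletCharacter ℂ k} (h1 : ψ ≠ 1) {s : ℂ}
    (hs : 0 < s.re) : ‖LFunction ψ s‖ ≤ ‖s‖ * k / s.re := by
  -- The formula L(s) = s ∫₁^∞ S(t) t^{−s−1} dt is read as a Mellin transform of the character sum
  -- cut off below 1. It is therefore analytic for Re s > 0, and the identity theorem carries the
  -- formula there from Re s > 1.
  set S : ℝ → ℂ := fun t => (Ioi (1 : ℝ)).indicator (fun t => ∑ j ∈ Finset.Icc 1 ⌊t⌋₊, ψ j) t with hS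
  have hSb : ∀ t, ‖S t‖ ≤ k := by
    intro t
    simp only [hS, indicator]
    split_ifs
    · exact norm_sum_Icc_le h1 _
    · simp
  have hSm : Measurable S := by
    apply Measurable.indicator _ measurableSet_Ioi
    exact (measurable_from_nat (f := fun n => ∑ j ∈ Finset.Icc 1 n, ψ j)).comp Nat.measurable_floor
  have hmel : ∀ s : ℂ, mellin S (-s) =
      ∫ t in Ioi (1 : ℝ), (∑ j ∈ Finset.Icc 1 ⌊t⌋₊, ψ j) * (t : ℂ) ^ (-(s + 1)) := by
    intro s
    rw [mellin, ← integral_indicator measurableSet_Ioi, ← integral_indicator measurableSet_Ioi]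
    congr 1; ext t
    simp only [indicator, hS, mem_Ioi, smul_eq_mul]
    split_ifs with a b b
    · rw [mul_comm]; congr 2; ring
    · simp
    · exact absurd (by linarith : (0 : ℝ) < t) a
    · rfl
  have hloc : LocallyIntegrableOn S (Ioi 0) := by
    apply LocallyIntegrable.locallyIntegrableOn
    apply (locallyIntegrable_const (k : ℝ)).mono hSm.aestronglyMeasurable
    exact ae_of_all _ fun t => by simpa using hSb t
  have hdiff : ∀ s : ℂ, 0 < s.re → DifferentiableAt ℂ (fun s => s * mellin S (-s)) s := by
    intro s hs
    have hd : DifferentiableAt ℂ (mellin S) (-s) := by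
      apply mellin_differentiableAt_of_isBigO_rpow (a := 0) (b := -s.re - 1) hloc
      · simp only [neg_zero, Real.rpow_zero]
        apply Asymptotics.IsBigO.of_bound k
        exact Eventually.of_forall fun t => by simpa using hSb t
      · simpa using hs
      · apply Asymptotics.IsBigO.of_bound 1
        filter_upwards [nhdsWithin_le_nhds (Iio_mem_nhds (zero_lt_one (α := ℝ)))] with t ht
        have : S t = 0 := by
          simp only [hS]
          apply indicator_of_notMem
          simp only [mem_Ioi, not_lt]
          exact (le_of_lt ht)
        rw [this]; simp only [norm_zero]; positivity
      · simp
    exact differentiableAt_id.mul (hd.comp s differentiableAt_id.neg)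
  have hU : IsOpen {s : ℂ | 0 < s.re} := isOpen_lt continuous_const continuous_re
  have heq : LFunction ψ s = s * mellin S (-s) := by
    have h2 : AnalyticOnNhd ℂ (fun s => s * mellin S (-s)) {s : ℂ | 0 < s.re} :=
      DifferentiableOn.analyticOnNhd (fun s hs => (hdiff s hs).differentiableWithinAt) hU
    have h3 : AnalyticOnNhd ℂ (LFunction ψ) {s : ℂ | 0 < s.re} :=
      fun s _ => (differentiable_LFunction h1).analyticAt s
    refine AnalyticOnNhd.eqOn_of_preconnected_of_eventuallyEq h3 h2
      (convex_halfSpace_re_gt 0).isPreconnected (z₀ := 2) (by simp) ?_ hs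
    have : {s : ℂ | 1 < s.re} ∈ 𝓝 (2 : ℂ) :=
      (isOpen_lt continuous_const continuous_re).mem_nhds (by simp)
    filter_upwards [this] with s hs
    have hs' : 1 < s.re := hs
    rw [LFunction_eq_LSeries _ hs, hmel]
    apply LSeries_eq_mul_integral (r := 0) _ le_rfl (by linarith)
      (LSeriesSummable_of_one_lt_re ψ hs)
    apply Asymptotics.IsBigO.of_bound k
    exact Eventually.of_forall fun n => by simpa using norm_sum_Icc_le h1 n
  rw [heq, norm_mul, hmel, mul_div_assoc]
  gcongr
  have hint : ∫ t in Ioi (1 : ℝ), (k : ℝ) * t ^ (-(s.re + 1)) = k / s.re := by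
    rw [integral_const_mul, integral_Ioi_rpow_of_lt (by linarith) one_pos]
    simp
    field_simp
  rw [← hint]
  apply norm_integral_le_of_norm_le
  · exact ((integrableOn_Ioi_rpow_of_lt (by linarith) one_pos).const_mul _)
  · filter_upwards [ae_restrict_mem measurableSet_Ioi] with t ht
    rw [norm_mul, norm_cpow_eq_rpow_re_of_pos (by linarith [mem_Ioi.mp ht])]
    simp only [neg_re, add_re, one_re]
    exact mul_le_mul_of_nonneg_right (norm_sum_Icc_le h1 _)
      (Real.rpow_nonneg (by linarith [mem_Ioi.mp ht]) _)

theorem tsum_one_div_rpow_le {σ : ℝ} (hσ : 1 < σ) :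
    ∑' n : ℕ, 1 / (n : ℝ) ^ σ ≤ 1 + 1 / (σ - 1) := by
  have := ZetaAsymptotics.zeta_limit_aux1 hσ
  have h0 : 0 ≤ ZetaAsymptotics.termTSum σ := tsum_nonneg fun n => ZetaAsymptotics.term_nonneg _ _
  rw [(Real.summable_one_div_nat_rpow.mpr hσ).tsum_eq_zero_add]
  simp only [Nat.cast_zero, Nat.cast_add, Nat.cast_one]
  rw [Real.zero_rpow (by linarith), div_zero, zero_add]
  nlinarith

theorem norm_LSeries_le {a : ℕ → ℂ} (ha : ∀ n, ‖a n‖ ≤ 1) {s : ℂ} (hs : 1 < s.re) :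
    ‖LSeries a s‖ ≤ 1 + 1 / (s.re - 1) := by
  refine le_trans ?_ (tsum_one_div_rpow_le hs)
  have hsum := Real.summable_one_div_nat_rpow.mpr hs
  refine tsum_of_norm_bounded hsum.hasSum fun n => ?_
  rw [LSeries.norm_term_eq]
  split_ifs with h
  · positivity
  · gcongr
    exact ha n

theorem norm_LFunction_le_of_one_lt {k : ℕ} [NeZero k] (ψ : DirichletCharacter ℂ k) {s : ℂ}
    (hs : 1 < s.re) : ‖LFunction ψ s‖ ≤ 1 + 1 / (s.re - 1) := by
  rw [LFunction_eq_LSeries _ hs]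
  exact norm_LSeries_le (fun n => ψ.norm_le_one _) hs

theorem norm_inv_LFunction_le_of_one_lt {k : ℕ} [NeZero k] (ψ : DirichletCharacter ℂ k) {s : ℂ}
    (hs : 1 < s.re) : ‖(LFunction ψ s)⁻¹‖ ≤ 1 + 1 / (s.re - 1) := by
  have h := LSeries.mul_mu_eq_one ψ hs
  rw [LFunction_eq_LSeries _ hs, ← eq_inv_of_mul_eq_one_right h]
  apply norm_LSeries_le (fun n => ?_) hs
  have h1 := ψ.norm_le_one n
  have h2 : ‖((ArithmeticFunction.moebius n : ℤ) : ℂ)‖ ≤ 1 := by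
    rw [norm_intCast]
    exact_mod_cast ArithmeticFunction.abs_moebius_le_one
  simp only [Pi.mul_apply, norm_mul]
  exact mul_le_one₀ h1 (norm_nonneg _) h2

/-! ### The coefficients λ± twisted by a character. -/

theorem twisted_zetaRatioCoeff_LSeries {k : ℕ} [NeZero k] (ψ : DirichletCharacter ℂ k) (a : ℝ)
    {s : ℂ} (hs : 1 + |a| < s.re) :
    LSeriesHasSum (fun n => zetaRatioCoeff a n * ψ n) s
      (LFunction ψ (s + a) / LFunction ψ (s - a)) := by
  have h1 : 1 < (s + a).re := by simp; linarith [neg_abs_le a]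
  have h2 : 1 < (s - a).re := by simp; linarith [le_abs_self a]
  have e1 : LSeriesHasSum ((fun n => ψ n : ℕ → ℂ) * (fun n : ℕ => (n : ℂ) ^ (-a : ℂ))) s
      (LFunction ψ (s + a)) := by
    rw [LFunction_eq_LSeries ψ h1]
    have := (LSeriesSummable_of_one_lt_re ψ h1).LSeriesHasSum
    unfold LSeriesHasSum at this ⊢
    convert! this using 1
    ext n
    have h := LSeries_term_mul_cpow (fun n => ψ n) (-a) s n
    rw [sub_neg_eq_add] at h
    exact h
  have e2 : LSeriesHasSum ((fun n => ψ n : ℕ → ℂ) *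
      (fun n : ℕ => (ArithmeticFunction.moebius n : ℂ) * (n : ℂ) ^ (a : ℂ))) s
      (LFunction ψ (s - a))⁻¹ := by
    have := (LSeriesSummable_mul ψ
      (ArithmeticFunction.LSeriesSummable_moebius_iff.mpr h2)).LSeriesHasSum
    have h := LSeries.mul_mu_eq_one ψ h2
    rw [← LFunction_eq_LSeries ψ h2] at h
    rw [eq_inv_of_mul_eq_one_right h] at this
    unfold LSeriesHasSum at this ⊢
    convert! this using 1
    ext n
    have h := LSeries_term_mul_cpow
      ((fun n => ψ n : ℕ → ℂ) * fun n => (ArithmeticFunction.moebius n : ℂ)) a s n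
    rw [← h]
    congr 1
    ext n
    simp [mul_assoc]
  have := e1.convolution e2
  -- By complete multiplicativity, twisting by ψ commutes with Dirichlet convolution.
  rw [mul_convolution_distrib] at this
  rw [div_eq_mul_inv]
  convert! this using 1
  ext n
  simp [zetaRatioCoeff, mul_comm]

theorem zetaRatioCoeff_zero (a : ℝ) : zetaRatioCoeff a 0 = 0 := by
  simp [zetaRatioCoeff]

theorem norm_natCast_cpow_ofReal {n : ℕ} (hn : n ≠ 0) (a : ℝ) :
    ‖(n : ℂ) ^ (a : ℂ)‖ = (n : ℝ) ^ a := by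
  rw [norm_natCast_cpow_of_pos (Nat.pos_of_ne_zero hn)]; simp

/-- Each divisor contributes at most n and there are at most n divisors. Such a crude bound suffices
because ϑ decays like a very high power of n. -/
theorem norm_zetaRatioCoeff_le {a : ℝ} (ha : |a| ≤ 1) (n : ℕ) :
    ‖zetaRatioCoeff a n‖ ≤ (n : ℝ) ^ 2 := by
  rw [zetaRatioCoeff, LSeries.convolution_def]
  have hterm : ∀ p ∈ n.divisorsAntidiagonal, ‖((p.1 : ℂ) ^ (-a : ℂ)) *
      ((ArithmeticFunction.moebius p.2 : ℂ) * (p.2 : ℂ) ^ (a : ℂ))‖ ≤ n := by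
    intro p hp
    obtain ⟨h1, h2⟩ := Nat.mem_divisorsAntidiagonal.mp hp
    have p1 : p.1 ≠ 0 := by rintro h; simp [h] at h1; exact h2 h1.symm
    have p2 : p.2 ≠ 0 := by rintro h; simp [h] at h1; exact h2 h1.symm
    have q1 : (1 : ℝ) ≤ p.1 := by exact_mod_cast Nat.one_le_iff_ne_zero.mpr p1
    have q2 : (1 : ℝ) ≤ p.2 := by exact_mod_cast Nat.one_le_iff_ne_zero.mpr p2
    have hm : ‖((ArithmeticFunction.moebius p.2 : ℤ) : ℂ)‖ ≤ 1 := by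
      rw [norm_intCast]
      exact_mod_cast ArithmeticFunction.abs_moebius_le_one
    have e1 : ‖(p.1 : ℂ) ^ (-a : ℂ)‖ ≤ p.1 := by
      rw [← ofReal_neg, norm_natCast_cpow_ofReal p1]
      calc (p.1 : ℝ) ^ (-a) ≤ (p.1 : ℝ) ^ (1 : ℝ) :=
            Real.rpow_le_rpow_of_exponent_le q1 (by linarith [neg_abs_le a])
        _ = p.1 := Real.rpow_one _
    have e2 : ‖(p.2 : ℂ) ^ (a : ℂ)‖ ≤ p.2 := by
      rw [norm_natCast_cpow_ofReal p2]
      calc (p.2 : ℝ) ^ a ≤ (p.2 : ℝ) ^ (1 : ℝ) :=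
            Real.rpow_le_rpow_of_exponent_le q2 (by linarith [le_abs_self a])
        _ = p.2 := Real.rpow_one _
    rw [norm_mul, norm_mul, ← h1]
    push_cast
    calc _ ≤ (p.1 : ℝ) * (1 * p.2) := by gcongr
      _ = _ := by ring
  refine (norm_sum_le_of_le _ hterm).trans ?_
  rw [Finset.sum_const, nsmul_eq_mul, pow_two]
  gcongr
  rw [← Nat.map_div_right_divisors, Finset.card_map]
  exact Nat.card_divisors_le_self n

/-! ### The weight -/

theorem bigQ_cpow (D : ℕ) (s : ℂ) : (bigQ D : ℂ) ^ s = exp ((logD D ^ 2 : ℝ) * s) := by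
  rw [bigQ, cpow_def_of_ne_zero (by exact_mod_cast (Real.exp_pos _).ne'), ← ofReal_log
    (Real.exp_pos _).le, Real.log_exp]

theorem bigQ_rpow (D : ℕ) (x : ℝ) : bigQ D ^ x = Real.exp (logD D ^ 2 * x) := by
  rw [bigQ, ← Real.exp_mul]

theorem norm_exp_ofReal_mul (A : ℝ) (z : ℂ) : ‖exp (A * z)‖ = Real.exp (A * z.re) := by
  rw [norm_exp]; simp

theorem norm_exp_sq_div_four (z : ℂ) : ‖exp (z ^ 2 / 4)‖ =
    Real.exp ((z.re ^ 2 - z.im ^ 2) / 4) := by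
  rw [norm_exp]
  congr 1
  have : z ^ 2 / 4 = ((1 / 4 : ℝ) : ℂ) * (z * z) := by push_cast; ring
  rw [this, re_ofReal_mul, mul_re]; ring

/-- The factors Q^{±z/10} are the origin of the 1/10 that accompanies κ in all later exponents. Near
0 the bound α/‖z‖² is weaker than the true size 1/‖z‖, but it is integrable along vertical lines. -/
theorem norm_weightY_le {D : ℕ} (hD : 1 ≤ logD D) (z : ℂ) :
    ‖weightY D z‖ ≤ 10 * alpha D * Real.exp (logD D ^ 2 * |z.re| / 10) *
      Real.exp ((z.re ^ 2 - z.im ^ 2) / 4) / ‖z‖ ^ 2 := by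
  have hα : 0 < alpha D := by unfold alpha; positivity
  rw [weightY, norm_div, norm_pow, norm_mul, norm_mul, norm_mul, norm_exp_sq_div_four, bigQ_cpow,
    bigQ_cpow, norm_real, Real.norm_eq_abs, abs_of_pos hα]
  have h5 : ‖(5 : ℂ)‖ = 5 := by norm_num
  rw [h5]
  have h1 : ‖exp ((logD D ^ 2 : ℝ) * (z / 10)) - exp ((logD D ^ 2 : ℝ) * (-z / 10))‖ ≤
      2 * Real.exp (logD D ^ 2 * |z.re| / 10) := by
    refine (norm_sub_le _ _).trans ?_
    rw [norm_exp_ofReal_mul, norm_exp_ofReal_mul]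
    have r1 : (z / 10).re = z.re / 10 := by simp
    have r2 : (-z / 10).re = -z.re / 10 := by simp
    rw [r1, r2, two_mul]
    have hA : 0 ≤ logD D ^ 2 := by positivity
    gcongr ?_ + ?_
    · rw [mul_div_assoc]
      gcongr
      exact le_abs_self _
    · rw [mul_div_assoc]
      gcongr
      exact neg_le_abs _
  gcongr ?_ / _
  calc 5 * alpha D * _ * Real.exp ((z.re ^ 2 - z.im ^ 2) / 4)
      ≤ 5 * alpha D * (2 * Real.exp (logD D ^ 2 * |z.re| / 10)) *
        Real.exp ((z.re ^ 2 - z.im ^ 2) / 4) := by gcongr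
    _ = _ := by ring

theorem differentiableAt_weightY (D : ℕ) {z : ℂ} (hz : z ≠ 0) :
    DifferentiableAt ℂ (weightY D) z := by
  have : weightY D = fun s => 5 * alpha D * (exp ((logD D ^ 2 : ℝ) * (s / 10)) -
      exp ((logD D ^ 2 : ℝ) * (-s / 10))) * exp (s ^ 2 / 4) / s ^ 2 := by
    ext s; rw [weightY, bigQ_cpow, bigQ_cpow]
  rw [this]
  have : z ^ 2 ≠ 0 := pow_ne_zero 2 hz
  fun_prop (disch := assumption)

theorem conj_weightY (D : ℕ) (z : ℂ) : conj (weightY D z) = weightY D (conj z) := by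
  simp only [weightY, bigQ_cpow, map_div₀, map_mul, map_sub, map_neg, map_pow, ← exp_conj,
    map_ofNat, conj_ofReal]

theorem weightY_neg (D : ℕ) (z : ℂ) : weightY D (-z) = -weightY D z := by
  simp only [weightY, bigQ_cpow, neg_neg, neg_sq]
  ring

/-- Y commutes with conjugation, so t ↦ −t conjugates the integrand. The reality of ϑ is what lets
the dual sum be written as the conjugate of a sum over ψ. -/
theorem conj_vartheta (D : ℕ) {x : ℝ} (hx : 0 < x) : conj (vartheta D x) = vartheta D x := by
  rw [vartheta, map_mul, ← integral_conj]
  congr 1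
  · simp [map_ofNat]
  · rw [← integral_neg_eq_self]
    congr 1; ext t
    have e : conj (1 + ((-t : ℝ) : ℂ) * I) = 1 + t * I := by simp
    rw [map_mul, conj_weightY, e, ← e]
    congr 1
    rw [cpow_conj _ _ (by rw [arg_ofReal_of_nonneg hx.le]; exact Real.pi_ne_zero.symm), conj_ofReal]

/-- The kernel `Q ^ (κ z) Y(z)`. -/
noncomputable def kernel (D : ℕ) (κ : ℝ) (z : ℂ) : ℂ := exp ((logD D ^ 2 * κ : ℝ) * z) * weightY D z

theorem differentiableAt_kernel (D : ℕ) (κ : ℝ) {z : ℂ} (hz : z ≠ 0) :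
    DifferentiableAt ℂ (kernel D κ) z :=
  DifferentiableAt.mul (by fun_prop) (differentiableAt_weightY D hz)

theorem norm_kernel_le {D : ℕ} (hD : 1 ≤ logD D) (κ : ℝ) (z : ℂ) :
    ‖kernel D κ z‖ ≤ 10 * alpha D * Real.exp (logD D ^ 2 * (κ * z.re + |z.re| / 10)) *
      Real.exp ((z.re ^ 2 - z.im ^ 2) / 4) / ‖z‖ ^ 2 := by
  rw [kernel, norm_mul, norm_exp_ofReal_mul]
  calc _ ≤ Real.exp (logD D ^ 2 * κ * z.re) * (10 * alpha D *
        Real.exp (logD D ^ 2 * |z.re| / 10) *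
        Real.exp ((z.re ^ 2 - z.im ^ 2) / 4) / ‖z‖ ^ 2) := by
        gcongr; exact norm_weightY_le hD z
    _ = 10 * alpha D * (Real.exp (logD D ^ 2 * κ * z.re) * Real.exp (logD D ^ 2 * |z.re| / 10)) *
        Real.exp ((z.re ^ 2 - z.im ^ 2) / 4) / ‖z‖ ^ 2 := by ring
    _ = _ := by rw [← Real.exp_add]; congr 5; ring

theorem alpha_le_one {D : ℕ} (hD : 1 ≤ logD D) : alpha D ≤ 1 := by
  unfold alpha
  exact inv_le_one_of_one_le₀ (one_le_pow₀ hD)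

theorem alpha_pos {D : ℕ} (hD : 1 ≤ logD D) : 0 < alpha D := by
  unfold alpha; positivity

/-- Decay of the kernel to the right of `Re z = 1`. -/
theorem norm_kernel_le_of_one_le {D : ℕ} (hD : 1 ≤ logD D) {κ : ℝ} {z : ℂ}
    (h1 : 1 ≤ z.re) : ‖kernel D κ z‖ ≤ 10 * Real.exp (z.re ^ 2 / 4) *
      Real.exp (logD D ^ 2 * ((κ + 1 / 10) * z.re)) * Real.exp (-(z.im ^ 2) / 4) := by
  refine (norm_kernel_le hD κ z).trans ?_
  have hz : 1 ≤ ‖z‖ ^ 2 := one_le_pow₀ (h1.trans (re_le_norm z))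
  have e : Real.exp ((z.re ^ 2 - z.im ^ 2) / 4) =
      Real.exp (z.re ^ 2 / 4) * Real.exp (-(z.im ^ 2) / 4) := by
    rw [← Real.exp_add]; congr 1; ring
  have e' : κ * z.re + |z.re| / 10 = (κ + 1 / 10) * z.re := by
    rw [abs_of_nonneg (by linarith)]; ring
  rw [e, e']
  refine (div_le_self ?_ hz).trans ?_
  · have := alpha_pos hD
    positivity
  · have := alpha_le_one hD
    calc _ ≤ 10 * 1 * Real.exp (logD D ^ 2 * ((κ + 1 / 10) * z.re)) *
        (Real.exp (z.re ^ 2 / 4) * Real.exp (-(z.im ^ 2) / 4)) := by gcongr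
      _ = _ := by ring

theorem kernel_eq_cpow_mul {D : ℕ} {κ : ℝ} {n : ℕ} (hn : n ≠ 0) (z : ℂ) :
    ((bigQ D ^ κ / n : ℝ) : ℂ) ^ z * weightY D z = kernel D κ z / (n : ℂ) ^ z := by
  have hQ : 0 < bigQ D ^ κ := Real.rpow_pos_of_pos (Real.exp_pos _) _
  have hn' : (0 : ℝ) < n := by exact_mod_cast Nat.pos_of_ne_zero hn
  have e1 : (((bigQ D ^ κ : ℝ)) : ℂ) ^ z = exp ((logD D ^ 2 * κ : ℝ) * z) := by
    rw [cpow_def_of_ne_zero (by exact_mod_cast hQ.ne'), ← ofReal_log hQ.le, bigQ_rpow, Real.log_exp]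
  have e2 : ((bigQ D ^ κ / n : ℝ) : ℂ) ^ z = (((bigQ D ^ κ : ℝ)) : ℂ) ^ z / (n : ℂ) ^ z := by
    rw [div_eq_mul_inv, ofReal_mul, mul_cpow_ofReal_nonneg hQ.le (by positivity), ofReal_inv,
      ofReal_natCast, inv_cpow _ _ (by rw [natCast_arg]; exact Real.pi_ne_zero.symm),
      div_eq_mul_inv]
  rw [e2, e1, kernel]
  ring

theorem vartheta_eq (D : ℕ) (κ : ℝ) {n : ℕ} (hn : n ≠ 0) :
    vartheta D (bigQ D ^ κ / n) = 1 / (2 * Real.pi) *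
      ∫ t : ℝ, kernel D κ ((1 : ℝ) + t * I) / (n : ℂ) ^ (((1 : ℝ) : ℂ) + t * I) := by
  rw [vartheta]
  congr 1
  congr 1; ext t
  rw [kernel_eq_cpow_mul hn, ofReal_one]

theorem ne_zero_of_re_ge_one {z : ℂ} (h : 1 ≤ z.re) : z ≠ 0 := by
  rintro rfl; norm_num at h

/-- The weight `ϑ` is negligible to the left of `1`. -/
theorem exists_norm_vartheta_le : ∃ C : ℝ, 0 < C ∧ ∀ D : ℕ, 1 ≤ logD D → ∀ κ : ℝ, ∀ n : ℕ, n ≠ 0 →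
    ‖vartheta D (bigQ D ^ κ / n)‖ ≤
      C * Real.exp (logD D ^ 2 * ((κ + 1 / 10) * 200)) / (n : ℝ) ^ (200 : ℕ) := by
  have hI : 0 ≤ ∫ t : ℝ, Real.exp (-(t ^ 2) / 4) := integral_nonneg fun t => (Real.exp_pos _).le
  refine ⟨1 / (2 * Real.pi) * (10 * Real.exp (200 ^ 2 / 4) *
    (∫ t : ℝ, Real.exp (-(t ^ 2) / 4)) + 1), by positivity, fun D hD κ n hn => ?_⟩
  have hn1 : (1 : ℝ) ≤ n := by exact_mod_cast Nat.one_le_iff_ne_zero.mpr hn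
  have hnc : (n : ℂ) ≠ 0 := by exact_mod_cast hn
  have hnorm : ∀ z : ℂ, ‖(n : ℂ) ^ z‖ = (n : ℝ) ^ z.re := fun z =>
    norm_natCast_cpow_of_pos (Nat.pos_of_ne_zero hn) z
  have hd : ∀ z : ℂ, (1 : ℝ) ≤ z.re → z.re ≤ 200 →
      DifferentiableAt ℂ (fun z => kernel D κ z / (n : ℂ) ^ z) z := by
    intro z h1 _
    apply (differentiableAt_kernel D κ (ne_zero_of_re_ge_one h1)).div
    · exact DifferentiableAt.const_cpow differentiableAt_id (Or.inl hnc)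
    · simp [cpow_eq_zero_iff, hnc]
  -- The line is moved far to the right, where the power n^{−200} is available; the shift to Re z =
  -- 200 crosses no pole.
  have hshift := integral_vertical_eq (h := fun z => kernel D κ z / (n : ℂ) ^ z) (a := 1) (b := 200)
    (B := 10 * Real.exp (200 ^ 2 / 4) * Real.exp (logD D ^ 2 * (|κ + 1 / 10| * 200))) (by norm_num)
    hd (by
      intro z h1 h2
      rw [norm_div, hnorm]
      have : 1 ≤ (n : ℝ) ^ z.re := Real.one_le_rpow hn1 (by linarith)
      refine (div_le_self (norm_nonneg _) this).trans ((norm_kernel_le_of_one_le hD h1).trans ?_)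
      gcongr
      exact le_abs_self _)
  rw [vartheta_eq D κ hn, ← hshift, norm_mul]
  have e1 : ‖(1 : ℂ) / (2 * Real.pi)‖ = 1 / (2 * Real.pi) := by
    have : (1 : ℂ) / (2 * Real.pi) = ((1 / (2 * Real.pi) : ℝ) : ℂ) := by push_cast; ring
    rw [this, norm_real, Real.norm_eq_abs, abs_of_pos (by positivity)]
  have e2 : ‖∫ t : ℝ, kernel D κ ((200 : ℝ) + t * I) / (n : ℂ) ^ (((200 : ℝ) : ℂ) + t * I)‖ ≤
      ∫ t : ℝ, (10 * Real.exp (200 ^ 2 / 4) * Real.exp (logD D ^ 2 * ((κ + 1 / 10) * 200)) /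
        (n : ℝ) ^ (200 : ℕ)) * Real.exp (-(t ^ 2) / 4) := by
    apply norm_integral_le_of_norm_le (integrable_gaussian_quarter.const_mul _)
    refine ae_of_all _ fun t => ?_
    rw [norm_div, hnorm]
    have hre : (((200 : ℝ) : ℂ) + t * I).re = 200 := by simp
    have him : (((200 : ℝ) : ℂ) + t * I).im = t := by simp
    have := norm_kernel_le_of_one_le hD (κ := κ) (z := ((200 : ℝ) : ℂ) + t * I)
      (by rw [hre]; norm_num)
    rw [hre, him] at this
    rw [hre, div_mul_eq_mul_div]
    have e3 : (n : ℝ) ^ (200 : ℝ) = (n : ℝ) ^ (200 : ℕ) := by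
      rw [← Real.rpow_natCast]; norm_num
    rw [e3]
    gcongr
  rw [integral_const_mul] at e2
  rw [e1]
  calc _ ≤ 1 / (2 * Real.pi) * (10 * Real.exp (200 ^ 2 / 4) *
          Real.exp (logD D ^ 2 * ((κ + 1 / 10) * 200)) /
        (n : ℝ) ^ (200 : ℕ) * ∫ t : ℝ, Real.exp (-(t ^ 2) / 4)) := by gcongr
    _ = 1 / (2 * Real.pi) * (10 * Real.exp (200 ^ 2 / 4) *
        (∫ t : ℝ, Real.exp (-(t ^ 2) / 4)) + 0) * Real.exp (logD D ^ 2 * ((κ + 1 / 10) * 200)) /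
        (n : ℝ) ^ (200 : ℕ) := by ring
    _ ≤ _ := by gcongr; norm_num

/-! ### Smoothed Dirichlet polynomials as contour integrals. -/

section

variable {k : ℕ} [NeZero k]

/-- The `n`-th term of the smoothed Dirichlet polynomials. -/
noncomputable def smoothTerm (D : ℕ) (ψ : DirichletCharacter ℂ k) (a κ : ℝ) (w : ℂ) (n : ℕ) : ℂ :=
  zetaRatioCoeff a n * ψ n / (n : ℂ) ^ w * vartheta D (bigQ D ^ κ / n)

/-- Termwise integration: on Re z = 1 the modulus of each Dirichlet term does not depend on t, and
the series converges absolutely because Re w + 1 > 1 + |a|. -/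
theorem hasSum_smoothTerm {D : ℕ} (hD : 1 ≤ logD D) (ψ : DirichletCharacter ℂ k) {a κ : ℝ} {w : ℂ}
    (hw : |a| < w.re) :
    HasSum (smoothTerm D ψ a κ w) (1 / (2 * Real.pi) *
      ∫ t : ℝ, LFunction ψ (w + ((1 : ℝ) + t * I) + a) / LFunction ψ (w + ((1 : ℝ) + t * I) - a) *
        kernel D κ ((1 : ℝ) + t * I)) := by
  set b : ℕ → ℂ := fun n => zetaRatioCoeff a n * ψ n with hb
  have hsum : ∀ t : ℝ, LSeriesHasSum b (w + ((1 : ℝ) + t * I))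
      (LFunction ψ (w + ((1 : ℝ) + t * I) + a) / LFunction ψ (w + ((1 : ℝ) + t * I) - a)) :=
    fun t => twisted_zetaRatioCoeff_LSeries ψ a (by simp; linarith)
  have hkint : Integrable (fun t : ℝ => kernel D κ ((1 : ℝ) + t * I)) := by
    apply integrable_vertical (B := 10 * Real.exp (1 ^ 2 / 4) *
      Real.exp (logD D ^ 2 * ((κ + 1 / 10) * 1)))
    · intro z hz
      exact differentiableAt_kernel D κ (ne_zero_of_re_ge_one hz.ge)
    · intro z hz
      have := norm_kernel_le_of_one_le hD (κ := κ) hz.ge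
      rwa [hz] at this
  have hterm : ∀ n : ℕ, ∀ t : ℝ, LSeries.term b (w + ((1 : ℝ) + t * I)) n =
      LSeries.term b w n / (n : ℂ) ^ (((1 : ℝ) : ℂ) + t * I) := by
    intro n t
    rcases eq_or_ne n 0 with rfl | hn
    · simp
    · rw [LSeries.term_of_ne_zero hn, LSeries.term_of_ne_zero hn,
        cpow_add _ _ (by exact_mod_cast hn), div_div]
  have hnorm : ∀ n : ℕ, ∀ t : ℝ, ‖LSeries.term b (w + ((1 : ℝ) + t * I)) n‖ =
      ‖LSeries.term b (w + (1 : ℝ)) n‖ := by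
    intro n t
    rw [LSeries.norm_term_eq, LSeries.norm_term_eq]; simp
  have hcont : ∀ n : ℕ, Continuous fun t : ℝ => LSeries.term b (w + ((1 : ℝ) + t * I)) n := by
    intro n
    rcases eq_or_ne n 0 with rfl | hn
    · simp only [LSeries.term_zero]; exact continuous_const
    · have hn' : (n : ℂ) ≠ 0 := by exact_mod_cast hn
      simp only [LSeries.term_of_ne_zero hn]
      apply Continuous.div continuous_const
      · apply Continuous.const_cpow (by fun_prop) (Or.inl hn')
      · intro t; simp [cpow_eq_zero_iff, hn']
  have hint : ∀ n : ℕ, Integrable (fun t : ℝ => LSeries.term b (w + ((1 : ℝ) + t * I)) n *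
      kernel D κ ((1 : ℝ) + t * I)) := fun n =>
    hkint.bdd_mul (hcont n).aestronglyMeasurable (ae_of_all _ fun t => (hnorm n t).le)
  have key := hasSum_integral_of_summable_integral_norm hint (by
    simp only [norm_mul, hnorm, integral_const_mul]
    apply Summable.mul_right
    have := (hsum 0).summable.norm
    simpa using this)
  have e1 : ∀ t : ℝ, ∑' n, LSeries.term b (w + ((1 : ℝ) + t * I)) n * kernel D κ ((1 : ℝ) + t * I) =
      LFunction ψ (w + ((1 : ℝ) + t * I) + a) / LFunction ψ (w + ((1 : ℝ) + t * I) - a) *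
        kernel D κ ((1 : ℝ) + t * I) := by
    intro t
    rw [tsum_mul_right, ← (hsum t).tsum_eq]
  simp_rw [e1] at key
  convert! key.mul_left (1 / (2 * Real.pi : ℂ)) using 1
  ext n
  rcases eq_or_ne n 0 with rfl | hn
  · simp [smoothTerm, zetaRatioCoeff_zero]
  · rw [smoothTerm, vartheta_eq D κ hn, ← mul_assoc, mul_comm _ (1 / (2 * Real.pi : ℂ)), mul_assoc,
      ← integral_const_mul]
    congr 2; ext t
    rw [hterm, LSeries.term_of_ne_zero hn]
    ring

end

section

variable {k : ℕ} [NeZero k]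

/-- Past n = Q^{κ + 1/6} the weight is tiny, since its bound is (Q^{κ + 1/10}/n)^{200}. Thus the
finite sum may be completed to the full series. -/
theorem exists_norm_smooth_tail_le : ∃ C : ℝ, 0 < C ∧ ∀ D : ℕ, 1 ≤ logD D →
    ∀ (k : ℕ) [NeZero k] (ψ : DirichletCharacter ℂ k) (a κ : ℝ) (w : ℂ) (N : ℕ) (S : ℂ),
    |a| ≤ 1 → κ ≤ 4 / 3 → 0 ≤ w.re → bigQ D ^ (κ + 1 / 6) ≤ (N : ℝ) + 1 →
    HasSum (smoothTerm D ψ a κ w) S →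
    ‖(∑ n ∈ Finset.Icc 1 N, smoothTerm D ψ a κ w n) - S‖ ≤ C * Real.exp (-(logD D ^ 2)) := by
  obtain ⟨C, hC, hv⟩ := exists_norm_vartheta_le
  have hs2 : Summable fun n : ℕ => 1 / (n : ℝ) ^ 2 := Real.summable_one_div_nat_pow.mpr (by norm_num)
  refine ⟨C * ((∑' n : ℕ, 1 / (n : ℝ) ^ 2) + 1), by
    have : 0 ≤ ∑' n : ℕ, 1 / (n : ℝ) ^ 2 := tsum_nonneg fun n => by positivity
    positivity, fun D hD k _ ψ a κ w N S ha hκ hw hN hS => ?_⟩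
  set A := logD D ^ 2 with hA
  have hA0 : 0 ≤ A := by positivity
  have hterm : ∀ n : ℕ, N + 1 ≤ n → ‖smoothTerm D ψ a κ w n‖ ≤
      C * Real.exp (-A) * (1 / (n : ℝ) ^ 2) := by
    intro n hn
    have hn0 : n ≠ 0 := by lia
    have hn1 : (1 : ℝ) ≤ n := by exact_mod_cast Nat.one_le_iff_ne_zero.mpr hn0
    have hQ : Real.exp (A * (κ + 1 / 6)) ≤ n := by
      rw [← bigQ_rpow]
      exact hN.trans (by exact_mod_cast hn)
    -- Of the 200 powers of n, four are kept: two against the coefficients, two for summability. The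
    -- other 196 are at least Q^{196(κ + 1/6)}, and 196/6 − 20 − 4κ ≥ 1 since κ ≤ 4/3.
    have hpow : Real.exp (A * ((κ + 1 / 10) * 200)) / (n : ℝ) ^ (200 : ℕ) ≤
        Real.exp (-A) / (n : ℝ) ^ 4 := by
      have e : (n : ℝ) ^ (200 : ℕ) = (n : ℝ) ^ 4 * (n : ℝ) ^ (196 : ℕ) := by ring
      have h1 : Real.exp (A * (κ + 1 / 6)) ^ 196 ≤ (n : ℝ) ^ (196 : ℕ) := by gcongr
      rw [← Real.exp_nat_mul] at h1
      rw [e, div_le_div_iff₀ (by positivity) (by positivity)]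
      have h2 : Real.exp (A * ((κ + 1 / 10) * 200)) ≤
          Real.exp (-A) * Real.exp ((196 : ℕ) * (A * (κ + 1 / 6))) := by
        rw [← Real.exp_add, Real.exp_le_exp]
        push_cast
        nlinarith
      calc _ ≤ Real.exp (-A) * (n : ℝ) ^ (196 : ℕ) * (n : ℝ) ^ 4 := by
            gcongr
            exact h2.trans (by gcongr)
        _ = _ := by ring
    rw [smoothTerm, norm_mul, norm_div, norm_mul, norm_natCast_cpow_of_pos (by lia)]
    have h3 : ‖zetaRatioCoeff a n‖ * ‖ψ n‖ / (n : ℝ) ^ w.re ≤ (n : ℝ) ^ 2 := by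
      refine (div_le_self (by positivity) (Real.one_le_rpow hn1 hw)).trans ?_
      calc _ ≤ (n : ℝ) ^ 2 * 1 := by
            gcongr
            · exact norm_zetaRatioCoeff_le ha n
            · exact ψ.norm_le_one _
        _ = _ := mul_one _
    calc _ ≤ (n : ℝ) ^ 2 * (C * Real.exp (A * ((κ + 1 / 10) * 200)) / (n : ℝ) ^ (200 : ℕ)) := by
          gcongr
          exact hv D hD κ n hn0
      _ = (n : ℝ) ^ 2 * (C * (Real.exp (A * ((κ + 1 / 10) * 200)) / (n : ℝ) ^ (200 : ℕ))) := by ring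
      _ ≤ (n : ℝ) ^ 2 * (C * (Real.exp (-A) / (n : ℝ) ^ 4)) := by gcongr
      _ = _ := by field_simp
  have hg : HasSum (fun n => if n ∈ Finset.Icc 1 N then smoothTerm D ψ a κ w n else 0)
      (∑ n ∈ Finset.Icc 1 N, smoothTerm D ψ a κ w n) := by
    have : HasSum (fun n => if n ∈ Finset.Icc 1 N then smoothTerm D ψ a κ w n else 0)
        (∑ n ∈ Finset.Icc 1 N, if n ∈ Finset.Icc 1 N then smoothTerm D ψ a κ w n else 0) :=
      hasSum_sum_of_ne_finset_zero (fun n hn => if_neg hn)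
    rwa [Finset.sum_congr rfl (fun n hn => if_pos hn)] at this
  have hd := hg.sub hS
  rw [← hd.tsum_eq]
  have := tsum_of_norm_bounded (hs2.hasSum.mul_left (C * Real.exp (-A)))
    (f := fun n => (if n ∈ Finset.Icc 1 N then smoothTerm D ψ a κ w n else 0) -
      smoothTerm D ψ a κ w n) (by
    intro n
    split_ifs with h
    · rw [sub_self, norm_zero]; positivity
    · rw [zero_sub, norm_neg]
      rcases eq_or_ne n 0 with rfl | hn
      · simp [smoothTerm, zetaRatioCoeff_zero]
      · apply hterm
        simp only [Finset.mem_Icc, not_and, not_le] at h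
        exact h (Nat.one_le_iff_ne_zero.mpr hn))
  refine this.trans ?_
  nlinarith [mul_pos hC (Real.exp_pos (-A))]

/-- The smoothed Dirichlet polynomial as a truncated contour integral. -/
theorem exists_smooth_sum_approx : ∃ C : ℝ, 0 < C ∧ ∀ D : ℕ, 1 ≤ logD D →
    ∀ (k : ℕ) [NeZero k] (ψ : DirichletCharacter ℂ k) (a κ : ℝ) (w : ℂ) (N : ℕ), ψ ≠ 1 →
    |a| ≤ 1 / 10 → κ ≤ 4 / 3 → 2 / 5 ≤ w.re → bigQ D ^ (κ + 1 / 6) ≤ (N : ℝ) + 1 →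
    ‖(∑ n ∈ Finset.Icc 1 N, smoothTerm D ψ a κ w n) - 1 / (2 * Real.pi) *
      vint (fun z => LFunction ψ (w + z + a) / LFunction ψ (w + z - a) * kernel D κ z) 1
        (8 * logD D)‖ ≤ C * Real.exp (-(logD D ^ 2)) := by
  obtain ⟨C, hC, ht⟩ := exists_norm_smooth_tail_le
  refine ⟨C + 1 / (2 * Real.pi) * (10 * (250 * Real.exp (1 / 4))), by positivity,
    fun D hD k _ ψ a κ w N hψ ha hκ hw hN => ?_⟩
  set A := logD D ^ 2 with hA
  have hA0 : 0 ≤ A := by positivity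
  have ha' := abs_le.mp ha
  set h : ℂ → ℂ := fun z => LFunction ψ (w + z + a) / LFunction ψ (w + z - a) * kernel D κ z with hh
  have hbd : ∀ z : ℂ, z.re = 1 → ‖h z‖ ≤ 250 * Real.exp (1 / 4) * Real.exp (A * (κ + 1 / 10)) *
      Real.exp (-(z.im ^ 2) / 4) := by
    intro z hz
    have h1 : 13 / 10 ≤ (w + z + a).re := by simp [hz]; linarith
    have h2 : 13 / 10 ≤ (w + z - a).re := by simp [hz]; linarith
    have b : ∀ x : ℝ, 13 / 10 ≤ x → 1 + 1 / (x - 1) ≤ 5 := by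
      intro x hx
      have : 1 / (x - 1) ≤ 4 := by
        rw [div_le_iff₀ (by linarith)]; linarith
      linarith
    have b1 := (norm_LFunction_le_of_one_lt ψ (by linarith)).trans (b _ h1)
    have b2 := (norm_inv_LFunction_le_of_one_lt ψ (by linarith)).trans (b _ h2)
    have b3 := norm_kernel_le_of_one_le hD (κ := κ) hz.ge
    rw [hz] at b3
    rw [hh, norm_mul, div_eq_mul_inv, norm_mul]
    calc _ ≤ 5 * 5 * (10 * Real.exp (1 ^ 2 / 4) * Real.exp (A * ((κ + 1 / 10) * 1)) *
          Real.exp (-(z.im ^ 2) / 4)) := by gcongr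
      _ = _ := by rw [one_pow, mul_one]; ring
  have hdiff : ∀ z : ℂ, z.re = 1 → DifferentiableAt ℂ h z := by
    intro z hz
    have hL := differentiable_LFunction hψ
    apply DifferentiableAt.mul
    · apply DifferentiableAt.div
      · exact (hL _).comp z ((differentiableAt_id.const_add w).add_const _)
      · exact (hL _).comp z ((differentiableAt_id.const_add w).sub_const _)
      · apply LFunction_ne_zero_of_one_le_re ψ (Or.inl hψ)
        simp [hz]; linarith
    · exact differentiableAt_kernel D κ (ne_zero_of_re_ge_one hz.ge)
  have hint := integrable_vertical (h := h) (c := 1) hdiff hbd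
  have htr := norm_integral_sub_truncated_le (T := 8 * logD D)
    (B := 250 * Real.exp (1 / 4) * Real.exp (A * (κ + 1 / 10))) (by linarith) (by positivity)
    hint (fun y => by simpa using hbd ((1 : ℝ) + y * I) (by simp))
  have hS := hasSum_smoothTerm hD ψ (a := a) (κ := κ) (w := w) (by linarith)
  have htail := ht D hD k ψ a κ w N _ (by linarith) hκ (by linarith) hN hS
  -- The height 8𝓛 makes the truncation error exp(−8𝓛²), which beats Q^{κ + 1/10}.
  have hexp : Real.exp (A * (κ + 1 / 10)) * Real.exp (-((8 * logD D) ^ 2) / 8) ≤ Real.exp (-A) := by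
    rw [← Real.exp_add, Real.exp_le_exp]
    have : (8 * logD D) ^ 2 = 64 * A := by rw [hA]; ring
    rw [this]
    nlinarith
  have e1 : ‖(1 : ℂ) / (2 * Real.pi)‖ = 1 / (2 * Real.pi) := by
    have : (1 : ℂ) / (2 * Real.pi) = ((1 / (2 * Real.pi) : ℝ) : ℂ) := by push_cast; ring
    rw [this, norm_real, Real.norm_eq_abs, abs_of_pos (by positivity)]
  have hsplit : ∀ x y z : ℂ, x - 1 / (2 * Real.pi) * z =
      (x - 1 / (2 * Real.pi) * y) + 1 / (2 * Real.pi) * (y - z) := fun x y z => by ring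
  rw [hsplit _ (∫ y : ℝ, h ((1 : ℝ) + y * I)) _]
  refine (norm_add_le _ _).trans ?_
  rw [add_mul]
  refine add_le_add htail ?_
  rw [norm_mul, e1]
  calc _ ≤ 1 / (2 * Real.pi) * (10 * (250 * Real.exp (1 / 4) * Real.exp (A * (κ + 1 / 10))) *
        Real.exp (-((8 * logD D) ^ 2) / 8)) := by gcongr; exact htr
    _ = 1 / (2 * Real.pi) * (10 * (250 * Real.exp (1 / 4))) * (Real.exp (A * (κ + 1 / 10)) *
        Real.exp (-((8 * logD D) ^ 2) / 8)) := by ring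
    _ ≤ _ := by gcongr

end

/-! ### The analytic facts about L(s, ψ), L(s, ψχ), F and Δ that the argument consumes. -/

/-- The analytic input about `f = L(s, ψ)`, `g = L(s, ψ χ)`, the Dirichlet polynomial `P = F(s, ψ)`
and the factors `Δf`, `Δg` of the functional equations, at height about `D`. -/
structure Setting (K : ℝ) (D : ℕ) (f g P Δf Δg : ℂ → ℂ) : Prop where
  f_diff : Differentiable ℂ f
  g_diff : Differentiable ℂ g
  P_diff : Differentiable ℂ P
  f_le : ∀ s : ℂ, 1 / 4 ≤ s.re → s.re ≤ 3 → |s.im - D| ≤ 11 * logD D →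
    ‖f s‖ ≤ Real.exp (2 * logD D ^ 2)
  g_le : ∀ s : ℂ, 1 / 4 ≤ s.re → s.re ≤ 3 → |s.im - D| ≤ 11 * logD D →
    ‖g s‖ ≤ Real.exp (2 * logD D ^ 2)
  f_le_of_one_lt : ∀ s : ℂ, 1 < s.re → ‖f s‖ ≤ 1 + 1 / (s.re - 1)
  g_le_of_one_lt : ∀ s : ℂ, 1 < s.re → ‖g s‖ ≤ 1 + 1 / (s.re - 1)
  f_inv_le : ∀ s : ℂ, 1 < s.re → ‖(f s)⁻¹‖ ≤ 1 + 1 / (s.re - 1)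
  f_ne : ∀ s : ℂ, 1 ≤ s.re → f s ≠ 0
  g_ne : ∀ s : ℂ, 1 ≤ s.re → g s ≠ 0
  f_eq : ∀ s : ℂ, |s.im - D| ≤ 11 * logD D → f s = Δf s * conj (f (1 - conj s))
  g_eq : ∀ s : ℂ, |s.im - D| ≤ 11 * logD D → g s = Δg s * conj (g (1 - conj s))
  Δf_diff : ∀ s : ℂ, |s.im - D| ≤ 11 * logD D → DifferentiableAt ℂ Δf s
  Δg_diff : ∀ s : ℂ, |s.im - D| ≤ 11 * logD D → DifferentiableAt ℂ Δg s
  Δf_norm : ∀ s : ℂ, |s.im - D| ≤ 11 * logD D → s.re = 1 / 2 → ‖Δf s‖ = 1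
  Δg_norm : ∀ s : ℂ, |s.im - D| ≤ 11 * logD D → s.re = 1 / 2 → ‖Δg s‖ = 1
  Δf_ratio : ∀ s₁ s₂ : ℂ, |s₁.im - D| ≤ 11 * logD D → |s₂.im - D| ≤ 11 * logD D →
    0 ≤ s₁.re → s₁.re ≤ 1 → 0 ≤ s₂.re → s₂.re ≤ 1 → ∃ θ : ℂ,
    Δf s₁ = Δf s₂ * exp (-(s₁ - s₂) * (logD D ^ 2 : ℝ) + θ) ∧ ‖θ‖ ≤ K * logD D * ‖s₁ - s₂‖
  Δg_ratio : ∀ s₁ s₂ : ℂ, |s₁.im - D| ≤ 11 * logD D → |s₂.im - D| ≤ 11 * logD D →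
    0 ≤ s₁.re → s₁.re ≤ 1 → 0 ≤ s₂.re → s₂.re ≤ 1 → ∃ θ : ℂ,
    Δg s₁ = Δg s₂ * exp (-(s₁ - s₂) * (logD D ^ 2 : ℝ) + θ) ∧ ‖θ‖ ≤ K * logD D * ‖s₁ - s₂‖
  P_le : ∀ s : ℂ, 1 / 2 - 2 / logD D < s.re → s.re ≤ 7 / 5 → |s.im - D| ≤ 12 * logD D →
    ‖P s‖ ≤ logD D ^ 4
  P_ge : ∀ s : ℂ, 1 / 2 - 2 / logD D < s.re → s.re ≤ 7 / 5 → |s.im - D| ≤ 12 * logD D →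
    (2 * logD D ^ 3 * Real.log (logD D))⁻¹ ≤ ‖P s‖
  P_ratio : ∀ s₁ s₂ : ℂ, |s₂.im - D| ≤ 12 * logD D →
    1 / 2 - 1 / logD D ≤ s₂.re → s₂.re ≤ 7 / 5 → ‖s₁ - s₂‖ ≤ 1 / (4 * logD D) → ∃ θ : ℂ,
    P s₁ = P s₂ * exp θ ∧ ‖θ‖ ≤ K * (logD D * Real.log (logD D)) * ‖s₁ - s₂‖
  P_ge_right : ∀ s : ℂ, s.re = 7 / 5 → |s.im - D| ≤ 12 * logD D → K⁻¹ ≤ ‖P s‖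
  P_le_left : ∀ s : ℂ, 0 ≤ s.re → s.re ≤ 1 / 2 →
    ‖P s‖ ≤ K * Real.exp (5 * logD D * (11 / 10 - s.re))
  approx : ∀ s : ℂ, 1 / 2 - 1 / 10 * alpha D * Real.log (logD D) < s.re → s.re < 1 →
    |s.im - D| < 1 + 10 * logD D →
    ‖f s * g s - (P s + Δf s * Δg s * conj (P (1 - conj s)))‖ ≤ logD D ^ (-(24 / 5) : ℝ)

/-- Comparison with the convolution 1 * 1 makes the constant independent of the characters. It
bounds G on Re s = 7/5 and, with exponent 11/10, F to the left of the critical line. -/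
theorem exists_norm_convolution_sum_le {σ : ℝ} (hσ : 1 < σ) : ∃ C : ℝ, 0 < C ∧
    ∀ (b c : ℕ → ℂ), (∀ n, ‖b n‖ ≤ 1) → (∀ n, ‖c n‖ ≤ 1) → ∀ N : ℕ,
    ∑ n ∈ Finset.Icc 1 N, ‖LSeries.convolution b c n‖ / (n : ℝ) ^ σ ≤ C := by
  have h1 : LSeriesSummable (LSeries.convolution 1 1) (σ : ℂ) := by
    have := LSeriesHasSum_one (s := (σ : ℂ)) (by simpa using hσ)
    exact (this.convolution this).LSeriesSummable
  have h2 := h1.norm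
  refine ⟨(∑' n, ‖LSeries.term (LSeries.convolution 1 1) (σ : ℂ) n‖) + 1, by
    have : 0 ≤ ∑' n, ‖LSeries.term (LSeries.convolution 1 1) (σ : ℂ) n‖ :=
      tsum_nonneg fun n => norm_nonneg _
    linarith, fun b c hb hc N => ?_⟩
  refine le_trans ?_ ((h2.sum_le_tsum (Finset.Icc 1 N) (fun _ _ => norm_nonneg _)).trans
    (by linarith))
  apply Finset.sum_le_sum
  intro n hn
  have hn0 : n ≠ 0 := by have := (Finset.mem_Icc.mp hn).1; lia
  rw [LSeries.norm_term_eq, if_neg hn0, ofReal_re]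
  gcongr
  rw [LSeries.convolution_def, LSeries.convolution_def]
  simp only [Pi.one_apply, mul_one, Finset.sum_const, nsmul_eq_mul, norm_natCast]
  have : ∀ p ∈ n.divisorsAntidiagonal, ‖b p.1 * c p.2‖ ≤ 1 := ?_
  · exact (norm_sum_le_of_le _ this).trans (by simp)
  intro p _
  rw [norm_mul]
  exact mul_le_one₀ (hb _) (norm_nonneg _) (hc _)

theorem norm_moebius_le_one (n : ℕ) : ‖((ArithmeticFunction.moebius n : ℤ) : ℂ)‖ ≤ 1 := by
  rw [norm_intCast]
  exact_mod_cast ArithmeticFunction.abs_moebius_le_one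

section

variable {D : ℕ} [NeZero D] {χ : DirichletCharacter ℂ D} {q : ℕ} [NeZero q]
  {ψ : DirichletCharacter ℂ q}

theorem F_inv_eq_conj (hχ : ∀ a : ZMod D, (χ a).im = 0) (s : ℂ) :
    F χ ψ⁻¹ s = conj (F χ ψ (conj s)) := by
  have hnu : ∀ n, conj (nu χ n) = nu χ n := by
    intro n
    rw [nu, LSeries.convolution_def, map_sum]
    refine Finset.sum_congr rfl fun p _ => ?_
    rw [map_mul, map_one, conj_eq_iff_im.mpr (hχ _)]
  simp only [F, map_sum, map_div₀, map_mul]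
  refine Finset.sum_congr rfl fun n _ => ?_
  rw [hnu, inv_apply_eq_conj, conj_natCast_cpow, conj_conj]

theorem differentiable_F : Differentiable ℂ (F χ ψ) := by
  have : F χ ψ = fun s => ∑ n ∈ Finset.Icc 1 (D ^ 5), nu χ n * ψ n / (n : ℂ) ^ s := rfl
  rw [this]
  apply Differentiable.fun_sum
  intro n hn
  have hn' : (n : ℂ) ≠ 0 := by
    have := (Finset.mem_Icc.mp hn).1
    exact_mod_cast (by lia : n ≠ 0)
  intro s
  exact (differentiableAt_const _).div (DifferentiableAt.const_cpow differentiableAt_id (Or.inl hn'))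
    (by simp [cpow_eq_zero_iff, hn'])

/-- Since √α = 1/𝓛, the rectangle Ω₁ reaches 2/𝓛 to the left of the critical line, much further than
the scale αl on which the contours live. -/
theorem mem_Omega1 (hL : 1 ≤ logD D) {s : ℂ} (h1 : 1 / 2 - 2 / logD D < s.re)
    (h2 : s.re < 3 / 2) (h3 : |s.im - D| ≤ 13 * logD D) : s ∈ Omega1 D := by
  have hα : Real.sqrt (alpha D) = 1 / logD D := by
    rw [alpha, ← inv_pow, Real.sqrt_sq (by positivity), one_div]
  have e1 : (s - sZero D).re = s.re - 1 / 2 := by simp [sZero]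
  have e2 : (s - sZero D).im = s.im - D := by simp [sZero]
  refine ⟨?_, ?_, ?_⟩
  · rw [hα, e1]
    have : -2 * (1 / logD D) = -(2 / logD D) := by ring
    rw [this]; linarith
  · rw [e1]; linarith
  · rw [e2]; linarith

theorem norm_F_lt (h : MemPsiStar χ ψ) {s : ℂ} (hs : s ∈ Omega1 D) :
    ‖F χ ψ s‖ + ‖G χ ψ s‖ < logD D ^ 3 * Real.log (logD D) := by
  obtain ⟨b, hb, h⟩ := h.ineq1
  exact (h s hs).trans_lt hb

theorem norm_F_mul_G_ge (h : MemPsiStar χ ψ) {s : ℂ} (hs : s ∈ Omega1 D) :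
    1 / 2 ≤ ‖F χ ψ s‖ * ‖G χ ψ s‖ := by
  obtain ⟨b, hb, h⟩ := h.ineq2
  have h1 := (h s hs).trans_lt hb
  have h2 := norm_sub_norm_le 1 (F χ ψ s * G χ ψ s)
  rw [norm_one, norm_sub_rev, norm_mul] at h2
  simp only at h1
  linarith

/-- From |FG| ≥ 1/2 and the upper bound for |G|. In particular F has no zeros in Ω₁. -/
theorem norm_F_ge (hL : 1 < logD D) (h : MemPsiStar χ ψ) {s : ℂ} (hs : s ∈ Omega1 D) :
    (2 * logD D ^ 3 * Real.log (logD D))⁻¹ ≤ ‖F χ ψ s‖ := by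
  have h1 := norm_F_lt h hs
  have h2 := norm_F_mul_G_ge h hs
  have hl := Real.log_pos hL
  have hpos : 0 < logD D := by linarith
  rw [inv_le_iff_one_le_mul₀ (by positivity)]
  nlinarith [norm_nonneg (F χ ψ s), norm_nonneg (G χ ψ s)]

/-- F is zero-free on a disc of radius about 1/𝓛, with values between 𝓛^{−4} and 𝓛⁴.
Borel–Carathéodory with A = 8 log 𝓛 then gives a logarithm with Lipschitz constant of order 𝓛 log 𝓛.
-/
theorem exists_exp_ratio_F (hL : 10 ≤ logD D) (hlL : 2 * Real.log (logD D) ≤ logD D)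
    (h : MemPsiStar χ ψ) {s₁ s₂ : ℂ} (h1 : |s₂.im - D| ≤ 12 * logD D)
    (h2 : 1 / 2 - 1 / logD D ≤ s₂.re) (h3 : s₂.re ≤ 7 / 5)
    (h4 : ‖s₁ - s₂‖ ≤ 1 / (4 * logD D)) :
    ∃ θ : ℂ, F χ ψ s₁ = F χ ψ s₂ * exp θ ∧
      ‖θ‖ ≤ 192 * 2 * (logD D * Real.log (logD D)) * ‖s₁ - s₂‖ := by
  have hl := Real.log_pos (by linarith : 1 < logD D)
  have hpos : 0 < logD D := by linarith
  have hr : (1 / (logD D) : ℝ) ≤ 1 / 10 := one_div_le_one_div_of_le (by norm_num) hL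
  have hr0 : 0 < 1 / logD D := by positivity
  -- The disc is shrunk so that it stays inside `Ω₁`.
  have hball : ∀ z ∈ Metric.ball s₂ (1 / logD D * (9 / 10)), z ∈ Omega1 D := by
    intro z hz
    rw [Metric.mem_ball, dist_eq_norm] at hz
    have a1 := (abs_re_le_norm (z - s₂)).trans_lt hz
    have a2 := (abs_im_le_norm (z - s₂)).trans_lt hz
    rw [sub_re, abs_lt] at a1
    rw [sub_im, abs_lt] at a2
    rw [abs_le] at h1
    apply mem_Omega1 (by linarith)
    · have : 2 / logD D = 2 * (1 / logD D) := by ring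
      rw [this]; linarith
    · linarith
    · rw [abs_le]; constructor <;> linarith
  have := exists_exp_ratio_of_ball (g := F χ ψ) (c := s₂) (r := 1 / logD D * (9 / 10))
    (A := 8 * Real.log (logD D)) (by positivity) (by positivity)
    differentiable_F.differentiableOn
    (fun z hz => by
      have := norm_F_ge (by linarith) h (hball z hz)
      have h0 : 0 < (2 * logD D ^ 3 * Real.log (logD D))⁻¹ := by positivity
      exact norm_pos_iff.mp (h0.trans_le this))
    (fun z hz => by
      have b1 := norm_F_lt h (hball z hz)
      have b2 := norm_F_ge (by linarith) h (hball s₂ (Metric.mem_ball_self (by positivity)))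
      have e : Real.exp (8 * Real.log (logD D)) = logD D ^ 8 := by
        rw [mul_comm, ← Real.rpow_def_of_pos hpos]; norm_cast
      rw [e]
      have b3 : logD D ^ 3 * Real.log (logD D) ≤ logD D ^ 4 := by
        have : logD D ^ 3 * (2 * Real.log (logD D)) ≤ logD D ^ 3 * logD D := by gcongr
        nlinarith [pow_pos hpos 3]
      have b4 : (logD D ^ 4)⁻¹ ≤ (2 * logD D ^ 3 * Real.log (logD D))⁻¹ := by
        apply inv_anti₀ (by positivity)
        have : logD D ^ 3 * (2 * Real.log (logD D)) ≤ logD D ^ 3 * logD D := by gcongr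
        nlinarith
      have b5 : logD D ^ 4 ≤ logD D ^ 8 * ‖F χ ψ s₂‖ := by
        calc logD D ^ 4 = logD D ^ 8 * (logD D ^ 4)⁻¹ := by field_simp
          _ ≤ _ := by gcongr; exact b4.trans b2
      linarith [norm_nonneg (G χ ψ z)])
    (z₁ := s₁) (z₂ := s₂)
    (by
      rw [Metric.mem_ball, dist_eq_norm]
      refine h4.trans_lt ?_
      have : 1 / (4 * logD D) = 1 / logD D * (1 / 4) := by field_simp
      rw [this]
      nlinarith)
    (Metric.mem_ball_self (by positivity))
  obtain ⟨θ, e, hθ⟩ := this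
  refine ⟨θ, e, hθ.trans ?_⟩
  gcongr
  rw [div_le_iff₀ (by positivity)]
  field_simp
  norm_num

end

theorem tendsto_logD : Tendsto logD atTop atTop :=
  Real.tendsto_log_atTop.comp tendsto_natCast_atTop_atTop

theorem eventually_logD {p : ℝ → Prop} (h : ∀ᶠ x in atTop, p x) : ∀ᶠ D in atTop, p (logD D) :=
  tendsto_logD.eventually h

section

variable {k : ℕ} [NeZero k] {ψ : DirichletCharacter ℂ k} {D : ℕ}

theorem exp_logD (hD : 1 ≤ logD D) : Real.exp (logD D) = D := by
  apply Real.exp_log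
  rcases Nat.eq_zero_or_pos D with rfl | h
  · simp [logD] at hD; linarith
  · exact_mod_cast h

/-- Modulus at most `2 D Q`. -/
theorem norm_LFunction_le_exp (hL : 10 ≤ logD D) (hDL : 22 * logD D ≤ D) (h1 : ψ ≠ 1)
    (hk : (k : ℝ) ≤ 2 * D * bigQ D) {s : ℂ} (hs1 : 1 / 4 ≤ s.re) (hs2 : s.re ≤ 3)
    (hs3 : |s.im - D| ≤ 11 * logD D) : ‖LFunction ψ s‖ ≤ Real.exp (2 * logD D ^ 2) := by
  have hs : ‖s‖ ≤ 2 * D := by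
    refine (norm_le_abs_re_add_abs_im s).trans ?_
    rw [abs_le] at hs3
    rw [abs_of_nonneg (by linarith), abs_of_nonneg (by linarith)]
    linarith
  refine (norm_LFunction_le h1 (by linarith)).trans ?_
  rw [div_le_iff₀ (by linarith)]
  have hD := exp_logD (by linarith : 1 ≤ logD D)
  have e : (D : ℝ) * D * bigQ D * 16 ≤ Real.exp (2 * logD D ^ 2) := by
    have : (16 : ℝ) ≤ Real.exp 10 := by
      have := Real.add_one_le_exp (10 : ℝ)
      have h5 : Real.exp 10 = Real.exp 5 * Real.exp 5 := by rw [← Real.exp_add]; norm_num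
      have := Real.add_one_le_exp (5 : ℝ)
      rw [h5]; nlinarith
    rw [← hD, bigQ]
    calc _ ≤ Real.exp (logD D) * Real.exp (logD D) * Real.exp (logD D ^ 2) * Real.exp 10 := by gcongr
      _ = Real.exp (logD D + logD D + logD D ^ 2 + 10) := by simp only [Real.exp_add]
      _ ≤ _ := by rw [Real.exp_le_exp]; nlinarith
  calc ‖s‖ * k ≤ (2 * D) * (2 * D * bigQ D) := by gcongr
    _ ≤ Real.exp (2 * logD D ^ 2) * (1 / 4) := by linarith
    _ ≤ _ := by gcongr

/-- The modulus k lies between Q and 2DQ, so replacing log k by log Q = 𝓛² costs only O(𝓛) in the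
Lipschitz constant, the same order as the Gamma factors at height D. -/
theorem Delta_ratio_at_height (hL : 10 ≤ logD D) (hDL : 22 * logD D ≤ D)
    (hk1 : bigQ D ≤ k) (hk : (k : ℝ) ≤ 2 * D * bigQ D) {s₁ s₂ : ℂ}
    (h1 : |s₁.im - D| ≤ 11 * logD D) (h2 : |s₂.im - D| ≤ 11 * logD D)
    (a1 : 0 ≤ s₁.re) (a2 : s₁.re ≤ 1) (b1 : 0 ≤ s₂.re) (b2 : s₂.re ≤ 1) : ∃ θ : ℂ,
    Delta ψ s₁ = Delta ψ s₂ * exp (-(s₁ - s₂) * (logD D ^ 2 : ℝ) + θ) ∧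
      ‖θ‖ ≤ 150 * logD D * ‖s₁ - s₂‖ := by
  rw [abs_le] at h1 h2
  have hDexp := exp_logD (by linarith : 1 ≤ logD D)
  have hD0 : (0 : ℝ) < D := by linarith
  have hn : ∀ s : ℂ, 0 ≤ s.re → s.re ≤ 1 → -(11 * logD D) ≤ s.im - D → s.im - D ≤ 11 * logD D →
      ‖s‖ + 2 ≤ 2 * D := by
    intro s c1 c2 c3 c4
    have := norm_le_abs_re_add_abs_im s
    rw [abs_of_nonneg (by linarith), abs_of_nonneg (by linarith)] at this
    linarith
  obtain ⟨θ, e, hθ⟩ := Delta_ratio (ψ := ψ) (s₁ := s₁) (s₂ := s₂) (X := 2 * D) (by linarith)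
    (by linarith) (by linarith) (hn _ a1 a2 h1.1 h1.2) (by linarith)
    (by linarith) (by linarith) (hn _ b1 b2 h2.1 h2.2)
  have hQ : 0 < bigQ D := Real.exp_pos _
  have hlk : |logD D ^ 2 - Real.log k| ≤ 2 * logD D := by
    have c1 : logD D ^ 2 ≤ Real.log k := by
      rw [← Real.log_exp (logD D ^ 2)]
      exact Real.log_le_log (Real.exp_pos _) hk1
    have c2 : Real.log k ≤ Real.log 2 + logD D + logD D ^ 2 := by
      refine (Real.log_le_log (hQ.trans_le hk1) hk).trans ?_
      rw [Real.log_mul (by positivity) hQ.ne', Real.log_mul (by norm_num) hD0.ne']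
      have : Real.log (bigQ D) = logD D ^ 2 := Real.log_exp _
      rw [this]; rfl
    rw [abs_le]
    constructor <;> linarith [Real.log_two_lt_d9]
  have hX : Real.log (2 * D) ≤ 2 * logD D := by
    rw [Real.log_mul (by norm_num) hD0.ne']
    have : Real.log D = logD D := rfl
    rw [this]; linarith [Real.log_two_lt_d9]
  refine ⟨θ + (s₁ - s₂) * ((logD D ^ 2 - Real.log k : ℝ) : ℂ), ?_, ?_⟩
  · rw [e]
    congr 2
    push_cast; ring
  · refine (norm_add_le _ _).trans ?_
    rw [norm_mul, norm_real, Real.norm_eq_abs]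
    calc _ ≤ 72 * (2 * logD D) * ‖s₁ - s₂‖ + ‖s₁ - s₂‖ * (2 * logD D) := by
          gcongr
          exact hθ.trans (by gcongr)
      _ ≤ _ := by nlinarith [norm_nonneg (s₁ - s₂)]

end

theorem im_ne_zero_of_height {D : ℕ} (hL : 10 ≤ logD D) (hDL : 22 * logD D ≤ D) {s : ℂ}
    (h : |s.im - D| ≤ 11 * logD D) : s.im ≠ 0 := by
  rw [abs_le] at h
  intro h0
  rw [h0] at h
  linarith

/-- All arithmetic input except the Dirichlet series of f(s + a)/f(s − a) enters through this
result; the reality of χ turns F(1 − s, ψ̄) into conj F(1 − s̄, ψ). -/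
theorem exists_setting : ∃ K : ℝ, 1 ≤ K ∧ ∀ᶠ D : ℕ in atTop, ∀ [NeZero D]
    (χ : DirichletCharacter ℂ D), (∀ a : ZMod D, (χ a).im = 0) →
    ∀ (q : ℕ) [NeZero q] (ψ : DirichletCharacter ℂ q), MemPsiStar χ ψ →
    Setting K D (LFunction ψ) (LFunction (ψ.mul χ)) (F χ ψ) (Delta ψ) (Delta (ψ.mul χ)) := by
  obtain ⟨C₁, hC₁, hc1⟩ := exists_norm_convolution_sum_le (σ := 7 / 5) (by norm_num)
  obtain ⟨C₂, hC₂, hc2⟩ := exists_norm_convolution_sum_le (σ := 11 / 10) (by norm_num)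
  refine ⟨400 + 2 * C₁ + C₂, by linarith, ?_⟩
  have ev1 : ∀ᶠ D in atTop, 10 ≤ logD D := eventually_logD (eventually_ge_atTop 10)
  have ev2 : ∀ᶠ D in atTop, 2 * Real.log (logD D) ≤ logD D := by
    apply eventually_logD (p := fun x => 2 * Real.log x ≤ x)
    have := Real.isLittleO_log_id_atTop.bound (by norm_num : (0 : ℝ) < 1 / 2)
    filter_upwards [this, eventually_ge_atTop 1] with x hx h1
    rw [Real.norm_of_nonneg (Real.log_nonneg h1), id, Real.norm_of_nonneg (by linarith)] at hx
    linarith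
  have ev3 : ∀ᶠ D : ℕ in atTop, 22 * logD D ≤ D := by
    have := Real.isLittleO_log_id_atTop.bound (by norm_num : (0 : ℝ) < 1 / 22)
    have := tendsto_natCast_atTop_atTop.eventually (this.and (eventually_ge_atTop (1 : ℝ)))
    filter_upwards [this] with D hD
    obtain ⟨hx, h1⟩ := hD
    rw [Real.norm_of_nonneg (Real.log_nonneg h1), id, Real.norm_of_nonneg (by linarith)] at hx
    have : logD D = Real.log D := rfl
    linarith
  filter_upwards [ev1, ev2, ev3] with D hL hlL hDL _ χ hχ q _ ψ hψ
  have hl := Real.log_pos (by linarith : 1 < logD D)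
  have hpos : 0 < logD D := by linarith
  have hDexp := exp_logD (by linarith : 1 ≤ logD D)
  have hD1 : (1 : ℝ) ≤ D := by linarith
  have hQ1 : 1 < bigQ D := Real.one_lt_exp_iff.mpr (by positivity)
  have hq1 := hψ.memPsi.lt_modulus
  have hq2 := hψ.memPsi.modulus_lt
  have hqne : q ≠ 1 := by
    rintro rfl
    norm_num at hq1; linarith
  have hq0 : 0 < q := NeZero.pos q
  have hk1 : bigQ D ≤ (Nat.lcm q D : ℝ) := by
    refine hq1.le.trans ?_
    exact_mod_cast Nat.le_of_dvd (NeZero.pos _) (Nat.dvd_lcm_left q D)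
  have hk2 : (Nat.lcm q D : ℝ) ≤ 2 * D * bigQ D := by
    have : (Nat.lcm q D : ℝ) ≤ (q : ℝ) * D := by
      exact_mod_cast Nat.le_of_dvd (Nat.mul_pos hq0 (NeZero.pos D)) (Nat.lcm_dvd_mul q D)
    nlinarith
  have hq3 : (q : ℝ) ≤ 2 * D * bigQ D := by nlinarith
  have hkne : Nat.lcm q D ≠ 1 := by
    intro h
    rw [h] at hk1
    norm_num at hk1; linarith
  have hψ1 : ψ ≠ 1 := ne_one_of_isPrimitive hψ.memPsi.primitive hqne
  have hψχ1 : ψ.mul χ ≠ 1 := ne_one_of_isPrimitive hψ.memPsi.primitive_mul hkne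
  have hO : ∀ s : ℂ, 1 / 2 - 2 / logD D < s.re → s.re ≤ 7 / 5 → |s.im - D| ≤ 12 * logD D →
      s ∈ Omega1 D := fun s h1 h2 h3 =>
    mem_Omega1 (by linarith) h1 (by linarith) (by linarith)
  exact
  { f_diff := differentiable_LFunction hψ1
    g_diff := differentiable_LFunction hψχ1
    P_diff := differentiable_F
    f_le := fun s h1 h2 h3 => norm_LFunction_le_exp hL hDL hψ1 hq3 h1 h2 h3
    g_le := fun s h1 h2 h3 => norm_LFunction_le_exp hL hDL hψχ1 hk2 h1 h2 h3
    f_le_of_one_lt := fun s hs => norm_LFunction_le_of_one_lt _ hs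
    g_le_of_one_lt := fun s hs => norm_LFunction_le_of_one_lt _ hs
    f_inv_le := fun s hs => norm_inv_LFunction_le_of_one_lt _ hs
    f_ne := fun s hs => LFunction_ne_zero_of_one_le_re _ (Or.inl hψ1) hs
    g_ne := fun s hs => LFunction_ne_zero_of_one_le_re _ (Or.inl hψχ1) hs
    f_eq := fun s hs => LFunction_eq_Delta_mul_conj hψ.memPsi.primitive hψ1
      (im_ne_zero_of_height hL hDL hs)
    g_eq := fun s hs => LFunction_eq_Delta_mul_conj hψ.memPsi.primitive_mul hψχ1
      (im_ne_zero_of_height hL hDL hs)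
    Δf_diff := fun s hs => differentiableAt_Delta _ (im_ne_zero_of_height hL hDL hs)
    Δg_diff := fun s hs => differentiableAt_Delta _ (im_ne_zero_of_height hL hDL hs)
    Δf_norm := fun s hs h => norm_Delta_critical hψ.memPsi.primitive hψ1 h
      (im_ne_zero_of_height hL hDL hs)
    Δg_norm := fun s hs h => norm_Delta_critical hψ.memPsi.primitive_mul hψχ1 h
      (im_ne_zero_of_height hL hDL hs)
    Δf_ratio := fun s₁ s₂ h1 h2 a1 a2 b1 b2 => by
      obtain ⟨θ, e, hθ⟩ := Delta_ratio_at_height (ψ := ψ) hL hDL hq1.le hq3 h1 h2 a1 a2 b1 b2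
      refine ⟨θ, e, hθ.trans ?_⟩
      gcongr
      linarith
    Δg_ratio := fun s₁ s₂ h1 h2 a1 a2 b1 b2 => by
      obtain ⟨θ, e, hθ⟩ := Delta_ratio_at_height (ψ := ψ.mul χ) hL hDL hk1 hk2 h1 h2 a1 a2 b1 b2
      refine ⟨θ, e, hθ.trans ?_⟩
      gcongr
      linarith
    P_le := fun s h1 h2 h3 => by
      have b1 := norm_F_lt hψ (hO s h1 h2 h3)
      have : logD D ^ 3 * (2 * Real.log (logD D)) ≤ logD D ^ 3 * logD D := by gcongr
      have := pow_pos hpos 3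
      nlinarith [norm_nonneg (G χ ψ s)]
    P_ge := fun s h1 h2 h3 => norm_F_ge (by linarith) hψ (hO s h1 h2 h3)
    P_ratio := fun s₁ s₂ h1 h2 h3 h4 => by
      obtain ⟨θ, e, hθ⟩ := exists_exp_ratio_F hL hlL hψ h1 h2 h3 h4
      refine ⟨θ, e, hθ.trans ?_⟩
      gcongr
      linarith
    -- On Re s = 7/5 the polynomial G is bounded by an absolutely convergent series, so |FG| ≥ 1/2
    -- bounds F from below by a constant.
    P_ge_right := fun s h1 h2 => by
      have hb := norm_F_mul_G_ge hψ (hO s (by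
        have : 0 < 2 / logD D := by positivity
        linarith) h1.le h2)
      have hG : ‖G χ ψ s‖ ≤ C₁ := by
        refine le_trans ?_ (hc1 (fun n => (ArithmeticFunction.moebius n : ℂ))
          (fun n => χ n * (ArithmeticFunction.moebius n : ℂ)) norm_moebius_le_one (fun n => by
            rw [norm_mul]
            exact mul_le_one₀ (χ.norm_le_one _) (norm_nonneg _) (norm_moebius_le_one n)) (D ^ 5))
        rw [G]
        refine norm_sum_le_of_le _ fun n hn => ?_
        have hn0 : 0 < n := (Finset.mem_Icc.mp hn).1
        rw [norm_div, norm_mul, norm_natCast_cpow_of_pos hn0, h1]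
        gcongr
        exact mul_le_of_le_one_right (norm_nonneg _) (ψ.norm_le_one _)
      rw [inv_le_iff_one_le_mul₀ (by linarith)]
      nlinarith [norm_nonneg (F χ ψ s), norm_nonneg (G χ ψ s)]
    -- Each n is at most D⁵, so n^{11/10 − Re s} is pulled out as exp(5𝓛(11/10 − Re s)), leaving a
    -- convergent sum at exponent 11/10.
    P_le_left := fun s h1 h2 => by
      have hsum := hc2 (fun _ => 1) (fun n => χ n) (by simp) (fun n => χ.norm_le_one _) (D ^ 5)
      have hD5 : ∀ n ∈ Finset.Icc 1 (D ^ 5), ‖nu χ n * ψ n / (n : ℂ) ^ s‖ ≤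
          Real.exp (5 * logD D * (11 / 10 - s.re)) *
            (‖LSeries.convolution (fun _ => 1) (fun n => χ n) n‖ / (n : ℝ) ^ (11 / 10 : ℝ)) := by
        intro n hn
        have hn0 : 0 < n := (Finset.mem_Icc.mp hn).1
        have hn1 : (1 : ℝ) ≤ n := by exact_mod_cast hn0
        have hnD : (n : ℝ) ≤ (D : ℝ) ^ 5 := by exact_mod_cast (Finset.mem_Icc.mp hn).2
        have e1 : (n : ℝ) ^ (11 / 10 - s.re) ≤ Real.exp (5 * logD D * (11 / 10 - s.re)) := by
          have : Real.exp (5 * logD D * (11 / 10 - s.re)) = ((D : ℝ) ^ 5) ^ (11 / 10 - s.re) := by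
            rw [← hDexp, ← Real.exp_nat_mul, ← Real.exp_mul]; norm_num
          rw [this]
          apply Real.rpow_le_rpow (by linarith) hnD (by linarith)
        have e2 : (n : ℝ) ^ (11 / 10 : ℝ) = (n : ℝ) ^ (11 / 10 - s.re) * (n : ℝ) ^ s.re := by
          rw [← Real.rpow_add (by linarith)]; ring_nf
        rw [norm_div, norm_mul, norm_natCast_cpow_of_pos hn0, e2]
        have p1 : 0 < (n : ℝ) ^ (11 / 10 - s.re) := Real.rpow_pos_of_pos (by linarith) _
        have p2 : 0 < (n : ℝ) ^ s.re := Real.rpow_pos_of_pos (by linarith) _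
        calc ‖nu χ n‖ * ‖ψ n‖ / (n : ℝ) ^ s.re ≤ ‖nu χ n‖ * 1 / (n : ℝ) ^ s.re := by
              gcongr; exact ψ.norm_le_one _
          _ = (n : ℝ) ^ (11 / 10 - s.re) *
              (‖nu χ n‖ / ((n : ℝ) ^ (11 / 10 - s.re) * (n : ℝ) ^ s.re)) := by field_simp
          _ ≤ _ := by
              gcongr
              exact le_rfl
      rw [F]
      refine (norm_sum_le_of_le _ hD5).trans ?_
      rw [← Finset.mul_sum, mul_comm]
      gcongr
      linarith
    approx := fun s h1 h2 h3 => by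
      obtain ⟨b, hb, h⟩ := hψ.ineq3
      have e1 : (s - sZero D).re = s.re - 1 / 2 := by simp [sZero]
      have e2 : (s - sZero D).im = s.im - D := by simp [sZero]
      have hs : s ∈ Omega2 D := ⟨by rw [e1]; linarith, by rw [e1]; linarith, by rw [e2]; exact h3⟩
      have := (h s hs).trans hb.le
      simp only [LL, calF, Delta1] at this
      rw [F_inv_eq_conj hχ] at this
      simpa using this }

/-! ### Consequences of the approximation fg ≈ P + dual term, and location of the zeros. -/

theorem eventually_mul_log_le (c : ℝ) {δ : ℝ} (hδ : 0 < δ) :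
    ∀ᶠ D in atTop, c * Real.log (logD D) ≤ δ * logD D := by
  apply eventually_logD (p := fun x => c * Real.log x ≤ δ * x)
  have := Real.isLittleO_log_id_atTop.bound (by positivity : 0 < δ / (|c| + 1))
  filter_upwards [this, eventually_ge_atTop 1] with x hx h1
  rw [Real.norm_of_nonneg (Real.log_nonneg h1), id, Real.norm_of_nonneg (by linarith)] at hx
  have h2 := Real.log_nonneg h1
  calc c * Real.log x ≤ (|c| + 1) * Real.log x := by
        gcongr; linarith [le_abs_self c]
    _ ≤ (|c| + 1) * (δ / (|c| + 1) * x) := by gcongr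
    _ = δ * x := by field_simp

theorem eventually_le_logD (c : ℝ) : ∀ᶠ D in atTop, c ≤ logD D :=
  eventually_logD (eventually_ge_atTop c)

theorem eventually_le_log_logD (c : ℝ) : ∀ᶠ D in atTop, c ≤ Real.log (logD D) :=
  eventually_logD (p := fun x => c ≤ Real.log x) (Real.tendsto_log_atTop.eventually_ge_atTop c)

theorem exp_mul_log_logD {D : ℕ} (hD : 1 ≤ logD D) (x : ℝ) :
    Real.exp (x * Real.log (logD D)) = logD D ^ x := by
  rw [Real.rpow_def_of_pos (by linarith), mul_comm]

theorem alpha_mul_sq {D : ℕ} (hD : 1 ≤ logD D) : alpha D * logD D ^ 2 = 1 := by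
  unfold alpha
  have : logD D ^ 2 ≠ 0 := by positivity
  field_simp

theorem alpha_mul {D : ℕ} (hD : 1 ≤ logD D) : alpha D * logD D = 1 / logD D := by
  unfold alpha
  have : logD D ≠ 0 := by positivity
  field_simp

namespace Setting

variable {K : ℝ} {D : ℕ} {f g P Δf Δg : ℂ → ℂ}

/-- The modulus of `Δf` off the critical line. -/
theorem norm_Δf_le (S : Setting K D f g P Δf Δg) {s : ℂ} (h1 : 0 ≤ s.re) (h2 : s.re ≤ 1)
    (h3 : |s.im - D| ≤ 11 * logD D) :
    ‖Δf s‖ ≤ Real.exp (-(s.re - 1 / 2) * logD D ^ 2 + K * logD D * |s.re - 1 / 2|) := by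
  set s' : ℂ := 1 / 2 + s.im * I with hs'
  have e1 : s'.re = 1 / 2 := by simp [hs']
  have e2 : s'.im = s.im := by simp [hs']
  have e3 : s - s' = ((s.re - 1 / 2 : ℝ) : ℂ) := by apply Complex.ext <;> simp [e1, e2]
  obtain ⟨θ, h, hθ⟩ := S.Δf_ratio s s' h3 (by rwa [e2]) h1 h2 (by rw [e1]; norm_num)
    (by rw [e1]; norm_num)
  rw [h, norm_mul, S.Δf_norm s' (by rwa [e2]) e1, one_mul, norm_exp]
  rw [e3, norm_real, Real.norm_eq_abs] at hθ
  rw [e3, Real.exp_le_exp, add_re, ← ofReal_neg, ← ofReal_mul, ofReal_re]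
  linarith [re_le_norm θ]

theorem norm_Δg_le (S : Setting K D f g P Δf Δg) {s : ℂ} (h1 : 0 ≤ s.re) (h2 : s.re ≤ 1)
    (h3 : |s.im - D| ≤ 11 * logD D) :
    ‖Δg s‖ ≤ Real.exp (-(s.re - 1 / 2) * logD D ^ 2 + K * logD D * |s.re - 1 / 2|) := by
  set s' : ℂ := 1 / 2 + s.im * I with hs'
  have e1 : s'.re = 1 / 2 := by simp [hs']
  have e2 : s'.im = s.im := by simp [hs']
  have e3 : s - s' = ((s.re - 1 / 2 : ℝ) : ℂ) := by apply Complex.ext <;> simp [e1, e2]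
  obtain ⟨θ, h, hθ⟩ := S.Δg_ratio s s' h3 (by rwa [e2]) h1 h2 (by rw [e1]; norm_num)
    (by rw [e1]; norm_num)
  rw [h, norm_mul, S.Δg_norm s' (by rwa [e2]) e1, one_mul, norm_exp]
  rw [e3, norm_real, Real.norm_eq_abs] at hθ
  rw [e3, Real.exp_le_exp, add_re, ← ofReal_neg, ← ofReal_mul, ofReal_re]
  linarith [re_le_norm θ]

theorem P_pos (S : Setting K D f g P Δf Δg) (hL : 1 < logD D) {s : ℂ}
    (h1 : 1 / 2 - 2 / logD D < s.re) (h2 : s.re ≤ 7 / 5)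
    (h3 : |s.im - D| ≤ 12 * logD D) : 0 < ‖P s‖ := by
  have := S.P_ge s h1 h2 h3
  have hl := Real.log_pos hL
  have h0 : 0 < (2 * logD D ^ 3 * Real.log (logD D))⁻¹ := by
    have : 0 < logD D := by linarith
    positivity
  linarith

end Setting

/-- Close to the right of the critical line the dual term decays exponentially. -/
theorem eventually_dual_near (K : ℝ) : ∀ᶠ D : ℕ in atTop, ∀ f g P Δf Δg : ℂ → ℂ,
    Setting K D f g P Δf Δg → ∀ s : ℂ, 1 / 2 ≤ s.re → s.re ≤ 1 / 2 + 1 / (8 * logD D) →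
    |s.im - D| ≤ 11 * logD D →
    ‖Δf s * Δg s * conj (P (1 - conj s))‖ ≤
      Real.exp (-(19 / 10) * (logD D ^ 2 * (s.re - 1 / 2))) * ‖P s‖ := by
  filter_upwards [eventually_le_logD 10, eventually_le_logD (40 * K), eventually_le_log_logD 1,
    eventually_mul_log_le (2 * K) (δ := 1 / 20) (by norm_num)] with D hL hLK hl hlL f g P Δf Δg S s
    h1 h2 h3
  have hpos : 0 < logD D := by linarith
  have h8 : 1 / (8 * logD D) ≤ 1 / 80 := one_div_le_one_div_of_le (by norm_num) (by linarith)
  have hi : 0 < 1 / logD D := by positivity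
  set x := s.re - 1 / 2 with hx
  have hx0 : 0 ≤ x := by linarith
  have b1 := S.norm_Δf_le (s := s) (by linarith) (by linarith) h3
  have b2 := S.norm_Δg_le (s := s) (by linarith) (by linarith) h3
  have e : (1 - conj s) - s = ((-(2 * x) : ℝ) : ℂ) := by
    apply Complex.ext <;> simp [hx]; ring
  have en : ‖(1 - conj s) - s‖ = 2 * x := by
    rw [e, norm_real, Real.norm_eq_abs, abs_neg, abs_of_nonneg (by linarith)]
  obtain ⟨θ, hθ1, hθ2⟩ := S.P_ratio (1 - conj s) s (by linarith) (by linarith) (by linarith) (by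
    rw [en]
    have : 1 / (8 * logD D) = 1 / (4 * logD D) / 2 := by field_simp; norm_num
    linarith)
  rw [en] at hθ2
  rw [norm_mul, norm_mul, norm_conj, hθ1, norm_mul, norm_exp]
  rw [← hx, abs_of_nonneg hx0] at b1 b2
  have b3 : Real.exp θ.re ≤ Real.exp (K * (logD D * Real.log (logD D)) * (2 * x)) :=
    Real.exp_le_exp.mpr ((re_le_norm θ).trans hθ2)
  calc ‖Δf s‖ * ‖Δg s‖ * (‖P s‖ * Real.exp θ.re)
      ≤ Real.exp (-x * logD D ^ 2 + K * logD D * x) * Real.exp (-x * logD D ^ 2 + K * logD D * x) *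
        (‖P s‖ * Real.exp (K * (logD D * Real.log (logD D)) * (2 * x))) := by gcongr
    _ = Real.exp (-x * logD D ^ 2 + K * logD D * x + (-x * logD D ^ 2 + K * logD D * x) +
        K * (logD D * Real.log (logD D)) * (2 * x)) * ‖P s‖ := by
        simp only [Real.exp_add]; ring
    _ ≤ _ := by
        gcongr
        -- The two Δ-factors give −2𝓛²x. The Lipschitz losses of Δf, Δg and P together cost at most
        -- 𝓛²x/10, which leaves 19/10.
        have t1 : K * logD D * x ≤ 1 / 40 * logD D * logD D * x := by
          gcongr
          linarith
        have t2 : 2 * K * Real.log (logD D) * (logD D * x) ≤ 1 / 20 * logD D * (logD D * x) := by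
          gcongr
        nlinarith

/-- Three ranges of x = Re s − 1/2. Up to 1/(8𝓛) the exponential decay applies, with 𝓛²x ≥ 1. Up to
2/𝓛 the reflected point is still in Ω₁, and Q^{−2x} beats the powers of 𝓛 bounding P. Beyond that
Q^{−2x} beats the trivial bound exp(5𝓛(x + 6/10)). -/
theorem eventually_dual_le (K : ℝ) : ∀ᶠ D : ℕ in atTop, ∀ f g P Δf Δg : ℂ → ℂ,
    Setting K D f g P Δf Δg → ∀ s : ℂ, 1 / 2 + alpha D ≤ s.re → s.re ≤ 1 →
    |s.im - D| ≤ 11 * logD D →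
    ‖Δf s * Δg s * conj (P (1 - conj s))‖ ≤ 1 / 3 * ‖P s‖ := by
  filter_upwards [eventually_dual_near K, eventually_le_logD 10, eventually_le_logD (100 * K),
    eventually_le_log_logD 1, eventually_mul_log_le 100 (δ := 1) (by norm_num),
    eventually_le_logD (100 * Real.log (|K| + 1)), eventually_le_logD 100] with
    D hnear hL hLK hl hlL hLK2 hL100 f g P Δf Δg S s h1 h2 h3
  have hpos : 0 < logD D := by linarith
  have hα := alpha_pos (by linarith : 1 ≤ logD D)
  have hα2 := alpha_mul_sq (by linarith : 1 ≤ logD D)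
  have hexp : ∀ y : ℝ, y ≤ -(19 / 10) → Real.exp y ≤ 1 / 3 := by
    intro y hy
    have h3 : 3 ≤ Real.exp (19 / 10) := by
      have := Real.quadratic_le_exp_of_nonneg (by norm_num : (0 : ℝ) ≤ 19 / 10)
      norm_num at this ⊢; linarith
    calc Real.exp y ≤ Real.exp (-(19 / 10)) := Real.exp_le_exp.mpr hy
      _ = (Real.exp (19 / 10))⁻¹ := Real.exp_neg _
      _ ≤ 3⁻¹ := inv_anti₀ (by norm_num) h3
      _ = 1 / 3 := by norm_num
  set x := s.re - 1 / 2 with hx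
  have hxα : alpha D ≤ x := by linarith
  rcases le_or_gt s.re (1 / 2 + 1 / (8 * logD D)) with hc | hc
  · refine (hnear f g P Δf Δg S s (by linarith) hc h3).trans ?_
    gcongr
    apply hexp
    have : 1 ≤ logD D ^ 2 * x := by rw [← hα2, mul_comm]; gcongr
    rw [← hx]
    linarith
  have hx0 : 0 ≤ x := by linarith
  have b1 := S.norm_Δf_le (s := s) (by linarith) (by linarith) h3
  have b2 := S.norm_Δg_le (s := s) (by linarith) (by linarith) h3
  rw [← hx, abs_of_nonneg hx0] at b1 b2
  have hi : 0 < 2 / logD D := by positivity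
  have b4 : Real.exp (-4 * Real.log (logD D)) ≤ ‖P s‖ := by
    refine le_trans ?_ (S.P_ge s (by linarith) (by linarith) (by linarith))
    rw [exp_mul_log_logD (by linarith)]
    have : logD D ^ (-4 : ℝ) = (logD D ^ 4)⁻¹ := by
      rw [Real.rpow_neg hpos.le]; norm_cast
    rw [this]
    apply inv_anti₀ (by positivity)
    have : logD D ^ 3 * (2 * Real.log (logD D)) ≤ logD D ^ 3 * logD D := by
      gcongr; linarith
    nlinarith
  have hKL : K * logD D * x ≤ 1 / 100 * logD D * logD D * x := by
    gcongr
    linarith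
  rw [norm_mul, norm_mul, norm_conj]
  have main : ∀ y : ℝ, ‖P (1 - conj s)‖ ≤ Real.exp y →
      -(2 * x) * logD D ^ 2 + 1 / 50 * logD D ^ 2 * x + y + 4 * Real.log (logD D) ≤ -(19 / 10) →
      ‖Δf s‖ * ‖Δg s‖ * ‖P (1 - conj s)‖ ≤ 1 / 3 * ‖P s‖ := by
    intro y hy1 hy2
    calc ‖Δf s‖ * ‖Δg s‖ * ‖P (1 - conj s)‖
        ≤ Real.exp (-x * logD D ^ 2 + K * logD D * x) *
          Real.exp (-x * logD D ^ 2 + K * logD D * x) * Real.exp y := by gcongr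
      _ = Real.exp ((-x * logD D ^ 2 + K * logD D * x) + (-x * logD D ^ 2 + K * logD D * x) + y +
          4 * Real.log (logD D)) * Real.exp (-4 * Real.log (logD D)) := by
          simp only [← Real.exp_add]; ring_nf
      _ ≤ 1 / 3 * ‖P s‖ := by
          gcongr
          apply hexp
          nlinarith
  rcases lt_or_ge x (2 / logD D) with hc2 | hc2
  · apply main (4 * Real.log (logD D))
    · rw [exp_mul_log_logD (by linarith)]
      have := S.P_le (1 - conj s) (by simp; linarith) (by simp; linarith) (by simpa using by linarith)
      refine this.trans (le_of_eq ?_)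
      norm_cast
    · have : 1 / 8 * logD D ≤ logD D ^ 2 * x := by
        have h9 : 1 / (8 * logD D) ≤ x := by linarith
        calc 1 / 8 * logD D = logD D ^ 2 * (1 / (8 * logD D)) := by field_simp
          _ ≤ _ := by gcongr
      nlinarith
  · apply main (Real.log (|K| + 1) + 5 * logD D * (x + 6 / 10))
    · have := S.P_le_left (1 - conj s) (by simp; linarith) (by simp; linarith)
      refine this.trans ?_
      rw [Real.exp_add, Real.exp_log (by positivity)]
      have e : 11 / 10 - (1 - conj s).re = x + 6 / 10 := by simp [hx]; ring
      rw [e]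
      gcongr
      linarith [le_abs_self K]
    · have t1 : 2 * logD D ≤ logD D ^ 2 * x := by
        calc 2 * logD D = logD D ^ 2 * (2 / logD D) := by field_simp
          _ ≤ _ := by gcongr
      have t2 : 100 * logD D * x ≤ logD D * logD D * x := by gcongr
      nlinarith

/-- The error in the approximate functional equation is small compared with `P`. -/
theorem eventually_error_le (K : ℝ) : ∀ᶠ D : ℕ in atTop, ∀ f g P Δf Δg : ℂ → ℂ,
    Setting K D f g P Δf Δg → ∀ s : ℂ, 1 / 2 - 2 / logD D < s.re → s.re ≤ 7 / 5 →
    |s.im - D| ≤ 12 * logD D → logD D ^ (-(24 / 5) : ℝ) ≤ (logD D)⁻¹ * ‖P s‖ := by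
  have ev : ∀ᶠ D in atTop, 2 * Real.log (logD D) ≤ logD D ^ (4 / 5 : ℝ) := by
    apply eventually_logD (p := fun x => 2 * Real.log x ≤ x ^ (4 / 5 : ℝ))
    have := (isLittleO_log_rpow_atTop (by norm_num : (0 : ℝ) < 4 / 5)).bound
      (by norm_num : (0 : ℝ) < 1 / 2)
    filter_upwards [this, eventually_ge_atTop 1] with x hx h1
    rw [Real.norm_of_nonneg (Real.log_nonneg h1),
      Real.norm_of_nonneg (Real.rpow_nonneg (by linarith) _)] at hx
    linarith
  filter_upwards [eventually_le_logD 10, ev, eventually_le_log_logD 1] with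
    D hL hlL hl f g P Δf Δg S s h1 h2 h3
  have hpos : 0 < logD D := by linarith
  have hP := S.P_ge s h1 h2 h3
  refine le_trans ?_ (mul_le_mul_of_nonneg_left hP (by positivity))
  rw [← mul_inv, Real.rpow_neg hpos.le]
  apply inv_anti₀ (by positivity)
  -- The lower bound for P costs 2𝓛³ log 𝓛 and the claim one more 𝓛; the spare power 𝓛^{4/5} pays
  -- for 2 log 𝓛.
  have e : logD D ^ (24 / 5 : ℝ) = logD D ^ 4 * logD D ^ (4 / 5 : ℝ) := by
    rw [← Real.rpow_natCast, ← Real.rpow_add hpos]; norm_num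
  rw [e]
  calc logD D * (2 * logD D ^ 3 * Real.log (logD D)) = logD D ^ 4 * (2 * Real.log (logD D)) := by ring
    _ ≤ _ := by gcongr

theorem alpha_le_hundredth {D : ℕ} (hL : 10 ≤ logD D) : alpha D ≤ 1 / 100 := by
  rw [alpha, inv_le_comm₀ (by positivity) (by norm_num)]
  nlinarith

/-- To the right of the critical line `L(s, ψ) L(s, ψ χ)` has the size of `P`. -/
theorem eventually_LL_bounds (K : ℝ) : ∀ᶠ D : ℕ in atTop, ∀ f g P Δf Δg : ℂ → ℂ,
    Setting K D f g P Δf Δg → ∀ s : ℂ, 1 / 2 + alpha D ≤ s.re → s.re < 1 →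
    |s.im - D| < 1 + 10 * logD D →
    1 / 2 * ‖P s‖ ≤ ‖f s * g s‖ ∧ ‖f s * g s‖ ≤ 2 * ‖P s‖ := by
  filter_upwards [eventually_error_le K, eventually_dual_le K, eventually_le_logD 10,
    eventually_le_log_logD 1] with D herr hdual hL hl f g P Δf Δg S s h1 h2 h3
  have hpos : 0 < logD D := by linarith
  have hα := alpha_pos (by linarith : 1 ≤ logD D)
  have hi : 0 < 2 / logD D := by positivity
  have b1 := herr f g P Δf Δg S s (by linarith) (by linarith) (by linarith)
  have b2 := hdual f g P Δf Δg S s h1 h2.le (by linarith)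
  have b3 := S.approx s (by nlinarith) h2 h3
  have b4 : (logD D)⁻¹ * ‖P s‖ ≤ 1 / 10 * ‖P s‖ := by
    gcongr
    rw [inv_le_comm₀ hpos (by norm_num)]
    norm_num; exact hL
  set E := f s * g s - (P s + Δf s * Δg s * conj (P (1 - conj s))) with hE
  have e1 : f s * g s = P s + (Δf s * Δg s * conj (P (1 - conj s)) + E) := by rw [hE]; ring
  have b5 : ‖Δf s * Δg s * conj (P (1 - conj s)) + E‖ ≤ 1 / 2 * ‖P s‖ :=
    (norm_add_le _ _).trans (by linarith [norm_nonneg (P s)])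
  rw [e1]
  constructor
  · have := norm_sub_le_norm_add (P s) (Δf s * Δg s * conj (P (1 - conj s)) + E)
    linarith
  · refine (norm_add_le _ _).trans ?_
    linarith [norm_nonneg (P s)]

/-- The zeros of `L(s, ψ) L(s, ψ χ)` near height `D` are close to the critical line. -/
theorem eventually_zero_near (K : ℝ) : ∀ᶠ D : ℕ in atTop, ∀ f g P Δf Δg : ℂ → ℂ,
    Setting K D f g P Δf Δg → ∀ ρ : ℂ, f ρ * g ρ = 0 → |ρ.im - D| < 1 →
    |ρ.re - 1 / 2| < alpha D := by
  filter_upwards [eventually_LL_bounds K, eventually_le_logD 10] with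
    D hLL hL f g P Δf Δg S ρ h0 h1
  have hpos : 0 < logD D := by linarith
  have hα := alpha_pos (by linarith : 1 ≤ logD D)
  have hi : 0 < 2 / logD D := by positivity
  have right : ∀ s : ℂ, f s * g s = 0 → |s.im - D| < 1 → s.re < 1 / 2 + alpha D := by
    intro s hs1 hs2
    by_contra! hc
    rcases lt_or_ge s.re 1 with h | h
    · have b1 := (hLL f g P Δf Δg S s hc h (by linarith)).1
      have b2 := S.P_pos (by linarith) (s := s) (by linarith) (by linarith) (by linarith)
      rw [hs1, norm_zero] at b1
      linarith
    · rcases mul_eq_zero.mp hs1 with h' | h'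
      · exact S.f_ne s h h'
      · exact S.g_ne s h h'
  -- The functional equations reflect a zero across the critical line, so the bound on the right
  -- also bounds it on the left.
  have hrefl : f (1 - conj ρ) * g (1 - conj ρ) = 0 := by
    have him : |(1 - conj ρ).im - D| ≤ 11 * logD D := by simp; linarith
    rcases mul_eq_zero.mp h0 with h' | h'
    · rw [S.f_eq _ him]; simp [h']
    · rw [S.g_eq _ him]; simp [h']
  have a1 := right ρ h0 h1
  have a2 := right _ hrefl (by simpa using h1)
  simp at a2
  rw [abs_lt]
  constructor <;> linarith

/-- At a zero the approximation reads P(ρ) + dual term = O(𝓛^{−24/5}); dividing by P(ρ) gives the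
value −1, the source of the minus sign before the dual sum. -/
theorem eventually_dual_at_zero (K : ℝ) : ∀ᶠ D : ℕ in atTop, ∀ f g P Δf Δg : ℂ → ℂ,
    Setting K D f g P Δf Δg → ∀ ρ : ℂ, f ρ * g ρ = 0 → |ρ.im - D| < 1 →
    ‖Δf ρ * Δg ρ * conj (P (1 - conj ρ)) / P ρ + 1‖ ≤ (logD D)⁻¹ := by
  filter_upwards [eventually_zero_near K, eventually_error_le K, eventually_le_logD 10,
    eventually_le_log_logD 11] with D hz herr hL hl f g P Δf Δg S ρ h0 h1
  have hpos : 0 < logD D := by linarith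
  have hα := alpha_pos (by linarith : 1 ≤ logD D)
  have hα1 : alpha D * logD D ^ 2 = 1 := alpha_mul_sq (by linarith)
  have hα2 : alpha D < 2 / logD D := by
    rw [lt_div_iff₀ hpos]; nlinarith
  have hα3 := alpha_le_hundredth hL
  have h2 := abs_lt.mp (hz f g P Δf Δg S ρ h0 h1)
  have b0 := S.P_pos (by linarith) (s := ρ) (by linarith) (by linarith) (by linarith)
  have b1 := herr f g P Δf Δg S ρ (by linarith) (by linarith) (by linarith)
  -- The zero lies within α of the critical line, hence in the range αl/10 of the approximation
  -- because l ≥ 11.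
  have b3 := S.approx ρ (by nlinarith) (by linarith) (by linarith)
  rw [h0, zero_sub, norm_neg] at b3
  have hne := norm_pos_iff.mp b0
  have e : Δf ρ * Δg ρ * conj (P (1 - conj ρ)) / P ρ + 1 =
      (P ρ + Δf ρ * Δg ρ * conj (P (1 - conj ρ))) / P ρ := by
    field_simp; ring
  rw [e, norm_div, div_le_iff₀ b0]
  linarith

/-! ### Bounds for the quotient on and to the right of the critical line. -/

/-- `f(u + a) g(u - a) / P(u)`. -/
noncomputable def quot (f g P : ℂ → ℂ) (a : ℝ) (u : ℂ) : ℂ := f (u + a) * g (u - a) / P u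

theorem Setting.differentiableAt_quot {K : ℝ} {D : ℕ} {f g P Δf Δg : ℂ → ℂ}
    (S : Setting K D f g P Δf Δg) (a : ℝ) {u : ℂ} (hP : P u ≠ 0) :
    DifferentiableAt ℂ (quot f g P a) u := by
  apply DifferentiableAt.div _ (S.P_diff u) hP
  exact ((S.f_diff _).comp u (differentiableAt_id.add_const _)).mul
    ((S.g_diff _).comp u (differentiableAt_id.sub_const _))

/-- Convexity-free bounds e^{2𝓛²} for f and g and e^{𝓛²} for 1/P. It is meant for horizontal sides,
where a Gaussian factor absorbs it. -/
theorem Setting.norm_quot_le {K : ℝ} {D : ℕ} {f g P Δf Δg : ℂ → ℂ}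
    (S : Setting K D f g P Δf Δg) (hL : 10 ≤ logD D) (hl : 1 ≤ Real.log (logD D))
    (hlL : 100 * Real.log (logD D) ≤ logD D) {a : ℝ} (ha : |a| ≤ alpha D) {u : ℂ}
    (h1 : 1 / 2 - 1 / logD D ≤ u.re) (h2 : u.re ≤ 7 / 5) (h3 : |u.im - D| ≤ 11 * logD D) :
    ‖quot f g P a u‖ ≤ Real.exp (5 * logD D ^ 2) := by
  have hpos : 0 < logD D := by linarith
  have hα1 : alpha D * logD D ^ 2 = 1 := alpha_mul_sq (by linarith)
  have hα3 := alpha_le_hundredth hL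
  have ha' := abs_le.mp ha
  have hi : 0 < 1 / logD D := by positivity
  have hi2 : 1 / logD D ≤ 1 / 10 := one_div_le_one_div_of_le (by norm_num) hL
  have h2i : 2 / logD D = 2 * (1 / logD D) := by ring
  have b1 := S.f_le (u + a) (by simp; linarith) (by simp; linarith) (by simpa using h3)
  have b2 := S.g_le (u - a) (by simp; linarith) (by simp; linarith) (by simpa using h3)
  have b3 := S.P_ge u (by linarith) h2 (by linarith)
  have b4 : Real.exp (-(logD D ^ 2)) ≤ ‖P u‖ := by
    refine le_trans ?_ b3
    rw [Real.exp_neg]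
    apply inv_anti₀ (by positivity)
    have e : Real.exp (4 * Real.log (logD D)) = logD D ^ 4 := by
      rw [exp_mul_log_logD (by linarith)]; norm_cast
    have : 2 * logD D ^ 3 * Real.log (logD D) ≤ logD D ^ 4 := by
      have : logD D ^ 3 * (2 * Real.log (logD D)) ≤ logD D ^ 3 * logD D := by
        gcongr; linarith
      nlinarith
    refine this.trans ?_
    rw [← e, Real.exp_le_exp]
    nlinarith
  rw [quot, norm_div, norm_mul, div_le_iff₀ ((Real.exp_pos _).trans_le b4)]
  calc _ ≤ Real.exp (2 * logD D ^ 2) * Real.exp (2 * logD D ^ 2) := by gcongr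
    _ = Real.exp (5 * logD D ^ 2) * Real.exp (-(logD D ^ 2)) := by
      rw [← Real.exp_add, ← Real.exp_add]; ring_nf
    _ ≤ _ := by gcongr

/-- For Re u = 1/2 the reflection of u − α is u + α, so the factor at u − α can be moved to u + α at
bounded cost. Then both factors sit at u + α, where fg has the size of P, and P(u + α) is comparable
with P(u). -/
theorem eventually_norm_quot_critical_le (K : ℝ) : ∀ᶠ D : ℕ in atTop, ∀ f g P Δf Δg : ℂ → ℂ,
    Setting K D f g P Δf Δg → ∀ a : ℝ, a = alpha D ∨ a = -alpha D → ∀ u : ℂ, u.re = 1 / 2 →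
    |u.im - D| ≤ 10 * logD D → ‖quot f g P a u‖ ≤ 2 * Real.exp 3 := by
  filter_upwards [eventually_LL_bounds K, eventually_le_logD 10, eventually_le_logD K,
    eventually_mul_log_le K (δ := 1) (by norm_num)] with D hLL hL hLK hlL f g P Δf Δg S a ha u h1 h2
  have hpos : 0 < logD D := by linarith
  have hα := alpha_pos (by linarith : 1 ≤ logD D)
  have hα1 : alpha D * logD D ^ 2 = 1 := alpha_mul_sq (by linarith)
  have hα3 := alpha_le_hundredth hL
  have hi : 0 < 1 / logD D := by positivity
  have hα4 : alpha D ≤ 1 / (4 * logD D) := by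
    rw [le_div_iff₀ (by positivity)]
    nlinarith
  have hPu := S.P_pos (by linarith) (s := u) (by rw [h1]; have : 2 / logD D = 2 * (1 / logD D) := by ring
                                                 linarith) (by rw [h1]; norm_num) (by linarith)
  have hLLu := (hLL f g P Δf Δg S (u + alpha D) (by simp [h1]) (by simp [h1]; linarith)
    (by simp; linarith)).2
  have hexp : Real.exp (-(-alpha D) * logD D ^ 2 + K * logD D * alpha D) ≤ Real.exp 2 := by
    rw [Real.exp_le_exp]
    have : K * logD D * alpha D ≤ logD D * logD D * alpha D := by gcongr
    nlinarith
  have him : |(u - alpha D).im - D| ≤ 11 * logD D := by simp; linarith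
  have hΔ1 : ‖Δf (u - alpha D)‖ ≤ Real.exp 2 := by
    refine (S.norm_Δf_le (by simp [h1]; linarith) (by simp [h1]; linarith) him).trans ?_
    have e : (u - alpha D).re - 1 / 2 = -alpha D := by simp [h1]
    rw [e, abs_neg, abs_of_pos hα]
    exact hexp
  have hΔ2 : ‖Δg (u - alpha D)‖ ≤ Real.exp 2 := by
    refine (S.norm_Δg_le (by simp [h1]; linarith) (by simp [h1]; linarith) him).trans ?_
    have e : (u - alpha D).re - 1 / 2 = -alpha D := by simp [h1]
    rw [e, abs_neg, abs_of_pos hα]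
    exact hexp
  have hrefl : 1 - conj (u - alpha D) = u + alpha D := by
    apply Complex.ext
    · simp [h1]; ring
    · simp
  obtain ⟨θ, hθ1, hθ2⟩ := S.P_ratio (u + alpha D) u (by linarith) (by linarith) (by linarith)
    (by simpa [abs_of_pos hα] using hα4)
  have hP : ‖P (u + alpha D)‖ ≤ ‖P u‖ * Real.exp 1 := by
    rw [hθ1, norm_mul, norm_exp]
    gcongr
    refine (re_le_norm θ).trans (hθ2.trans ?_)
    simp only [add_sub_cancel_left, norm_real, Real.norm_eq_abs, abs_of_pos hα]
    have : K * Real.log (logD D) * (logD D * alpha D) ≤ 1 * logD D * (logD D * alpha D) := by gcongr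
    nlinarith
  have key : ‖f (u + a) * g (u - a)‖ ≤ Real.exp 2 * ‖f (u + alpha D) * g (u + alpha D)‖ := by
    rcases ha with rfl | rfl
    · rw [S.g_eq _ him, hrefl, norm_mul, norm_mul, norm_conj, norm_mul]
      nlinarith [mul_le_mul_of_nonneg_right hΔ2 (mul_nonneg (norm_nonneg (f (u + alpha D)))
        (norm_nonneg (g (u + alpha D))))]
    · have e1 : u + ((-alpha D : ℝ) : ℂ) = u - alpha D := by push_cast; ring
      have e2 : u - ((-alpha D : ℝ) : ℂ) = u + alpha D := by push_cast; ring
      rw [e1, e2, S.f_eq _ him, hrefl, norm_mul, norm_mul, norm_conj, norm_mul]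
      nlinarith [mul_le_mul_of_nonneg_right hΔ1 (mul_nonneg (norm_nonneg (f (u + alpha D)))
        (norm_nonneg (g (u + alpha D))))]
  rw [quot, norm_div, div_le_iff₀ hPu]
  calc _ ≤ Real.exp 2 * (2 * (‖P u‖ * Real.exp 1)) := key.trans (by gcongr; exact hLLu.trans (by gcongr))
    _ = 2 * (Real.exp 2 * Real.exp 1) * ‖P u‖ := by ring
    _ = _ := by rw [← Real.exp_add]; norm_num

/-- The quotient is bounded to the right of the critical line. -/
theorem eventually_norm_quot_le (K : ℝ) (hK : 1 ≤ K) : ∃ C : ℝ, 0 < C ∧ ∀ᶠ D : ℕ in atTop,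
    ∀ f g P Δf Δg : ℂ → ℂ,
    Setting K D f g P Δf Δg → ∀ a : ℝ, a = alpha D ∨ a = -alpha D → ∀ u : ℂ, 1 / 2 ≤ u.re →
    u.re ≤ 7 / 5 → |u.im - D| ≤ 9 * logD D → ‖quot f g P a u‖ ≤ C := by
  refine ⟨Real.exp 10 * (2 * Real.exp 3 + 25 * K), by positivity, ?_⟩
  filter_upwards [eventually_norm_quot_critical_le K, eventually_le_logD 10,
    eventually_le_log_logD 1, eventually_mul_log_le 100 (δ := 1) (by norm_num)] with
    D hcrit hL hl hlL f g P Δf Δg S a ha u h1 h2 h3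
  have hpos : 0 < logD D := by linarith
  have hα := alpha_pos (by linarith : 1 ≤ logD D)
  have hα1 : alpha D * logD D ^ 2 = 1 := alpha_mul_sq (by linarith)
  have hα3 := alpha_le_hundredth hL
  have haα : |a| ≤ alpha D := by
    rcases ha with rfl | rfl
    · rw [abs_of_pos hα]
    · rw [abs_neg, abs_of_pos hα]
  have ha' := abs_le.mp haα
  have hi : 0 < 1 / logD D := by positivity
  have h2i : 2 / logD D = 2 * (1 / logD D) := by ring
  -- The left side is the critical line, the right side lies in the region of absolute convergence.
  -- The margin 𝓛 between the heights 9𝓛 and 10𝓛 lets the Gaussian absorb the crude bound e^{5𝓛²}.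
  apply norm_le_of_rect (h := quot f g P a) (a := 1 / 2) (b := 7 / 5) (y := D) (T := 10 * logD D)
    (δ := logD D) (by norm_num) (by norm_num) (by positivity) (by positivity) (by positivity)
    _ _ _ h1 h2 (by linarith)
  · intro z z1 z2 z3
    apply S.differentiableAt_quot
    exact norm_pos_iff.mp (S.P_pos (by linarith) (by linarith) z2 (by linarith))
  · rintro z (hz | hz) z3
    · refine (hcrit f g P Δf Δg S a ha z hz z3).trans ?_
      linarith
    · have b1 := S.f_le_of_one_lt (z + a) (by simp [hz]; linarith)
      have b2 := S.g_le_of_one_lt (z - a) (by simp [hz]; linarith)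
      have b3 := S.P_ge_right z hz (by linarith)
      have b : ∀ x : ℝ, 13 / 10 ≤ x → 1 + 1 / (x - 1) ≤ 5 := by
        intro x hx
        have : 1 / (x - 1) ≤ 4 := by
          rw [div_le_iff₀ (by linarith)]; linarith
        linarith
      have c1 := b1.trans (b _ (by simp [hz]; linarith))
      have c2 := b2.trans (b _ (by simp [hz]; linarith))
      have hP0 : 0 < ‖P z‖ := lt_of_lt_of_le (by positivity) b3
      rw [quot, norm_div, norm_mul, div_le_iff₀ hP0]
      calc _ ≤ (5 : ℝ) * 5 := by gcongr
        _ = 25 * K * K⁻¹ := by field_simp; norm_num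
        _ ≤ (2 * Real.exp 3 + 25 * K) * ‖P z‖ := by
          gcongr
          linarith [Real.exp_pos 3]
  · intro z z1 z2 z3
    refine (S.norm_quot_le hL hl (by linarith) haα (by linarith) z2 (by linarith)).trans ?_
    have : (1 : ℝ) ≤ 2 * Real.exp 3 + 25 * K := by linarith [Real.exp_pos 3]
    calc Real.exp (5 * logD D ^ 2) ≤ 1 * Real.exp (10 * logD D ^ 2) := by
          rw [one_mul, Real.exp_le_exp]; nlinarith
      _ ≤ _ := by gcongr

theorem eventually_mul_log_sq_le (c : ℝ) :
    ∀ᶠ D in atTop, c * Real.log (logD D) ^ 2 ≤ logD D := by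
  apply eventually_logD (p := fun x => c * Real.log x ^ 2 ≤ x)
  have := (Real.isLittleO_pow_log_id_atTop (n := 2)).bound (by positivity : 0 < 1 / (|c| + 1))
  filter_upwards [this, eventually_ge_atTop 1] with x hx h1
  rw [Real.norm_of_nonneg (by positivity), id, Real.norm_of_nonneg (by linarith)] at hx
  calc c * Real.log x ^ 2 ≤ (|c| + 1) * Real.log x ^ 2 := by
        gcongr; linarith [le_abs_self c]
    _ ≤ (|c| + 1) * (1 / (|c| + 1) * x) := by gcongr
    _ = x := by field_simp

/-! ### The functional equation of the quotient and its factor near a zero. -/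

/-- The factor in the functional equation of `quot`. -/
noncomputable def dualRatio (P Δf Δg : ℂ → ℂ) (a : ℝ) (u : ℂ) : ℂ :=
  Δf (u + a) * Δg (u - a) * conj (P (1 - conj u)) / P u

/-- Reflection sends u + a to (1 − ū) − a, which is why a changes sign. -/
theorem Setting.quot_eq {K : ℝ} {D : ℕ} {f g P Δf Δg : ℂ → ℂ} (S : Setting K D f g P Δf Δg)
    (a : ℝ) {u : ℂ} (hu : |u.im - D| ≤ 11 * logD D) (hP : P (1 - conj u) ≠ 0) :
    quot f g P a u = dualRatio P Δf Δg a u * conj (quot f g P (-a) (1 - conj u)) := by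
  have hP' : conj (P (1 - conj u)) ≠ 0 := by simpa using hP
  have e1 : 1 - conj (u + a) = 1 - conj u + ((-a : ℝ) : ℂ) := by simp; ring
  have e2 : 1 - conj (u - a) = 1 - conj u - ((-a : ℝ) : ℂ) := by simp; ring
  rw [quot, quot, dualRatio, S.f_eq (u + a) (by simpa using hu), S.g_eq (u - a) (by simpa using hu),
    e1, e2]
  simp only [map_div₀, map_mul]
  field_simp

theorem norm_mul_exp_add_one_le {m θ : ℂ} {δ : ℝ} (hm : ‖m + 1‖ ≤ δ) (hδ : δ ≤ 1) (hθ : ‖θ‖ ≤ 1) :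
    ‖m * exp θ + 1‖ ≤ 4 * ‖θ‖ + δ := by
  have e : m * exp θ + 1 = m * (exp θ - 1) + (m + 1) := by ring
  have h1 : ‖m‖ ≤ 2 := by
    have := norm_sub_le (m + 1) 1
    rw [add_sub_cancel_right, norm_one] at this
    linarith
  have h2 := norm_exp_sub_one_le hθ
  rw [e]
  refine (norm_add_le _ _).trans (add_le_add ?_ hm)
  rw [norm_mul]
  calc ‖m‖ * ‖exp θ - 1‖ ≤ 2 * (2 * ‖θ‖) := by gcongr
    _ = _ := by ring

theorem alpha_mul_log_le {D : ℕ} (hL : 10 ≤ logD D) (hlL : 100 * Real.log (logD D) ≤ 1 * logD D) :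
    alpha D * Real.log (logD D) ≤ 1 / 100 * (1 / logD D) := by
  have hpos : 0 < logD D := by linarith
  have e : alpha D = 1 / logD D * (1 / logD D) := by rw [alpha]; field_simp
  calc alpha D * Real.log (logD D) = 1 / logD D * (1 / logD D * Real.log (logD D)) := by rw [e]; ring
    _ ≤ 1 / logD D * (1 / logD D * (logD D / 100)) := by gcongr; linarith
    _ = _ := by field_simp

/-- The size of the factor in the functional equation near the critical line. -/
theorem eventually_norm_dualRatio_le (K : ℝ) (hK : 1 ≤ K) : ∀ᶠ D : ℕ in atTop,
    ∀ f g P Δf Δg : ℂ → ℂ, Setting K D f g P Δf Δg → ∀ a : ℝ, |a| ≤ alpha D →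
    alpha D ≤ 1 / 10 * (alpha D * Real.log (logD D)) →
    ∀ u : ℂ, |u.re - 1 / 2| ≤ 3 / 10 * (alpha D * Real.log (logD D)) →
    |u.im - D| ≤ 11 * logD D →
    ‖dualRatio P Δf Δg a u‖ ≤ Real.exp 2 * Real.exp (-(2 * logD D ^ 2) * (u.re - 1 / 2)) := by
  filter_upwards [eventually_le_logD 10,
    eventually_le_log_logD 1, eventually_mul_log_le 100 (δ := 1) (by norm_num),
    eventually_mul_log_le (2 * K) (δ := 1) (by norm_num),
    eventually_mul_log_sq_le K] with
    D hL hl hlL hKl hKl2 f g P Δf Δg S a ha hαl' u hu1 huim1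
  have hpos : 0 < logD D := by linarith
  have hα := alpha_pos (by linarith : 1 ≤ logD D)
  have hα1 : alpha D * logD D ^ 2 = 1 := alpha_mul_sq (by linarith)
  have ha' := abs_le.mp ha
  have hi : 0 < 1 / logD D := by positivity
  have hi1 : 1 / logD D ≤ 1 / 10 := one_div_le_one_div_of_le (by norm_num) hL
  have h2i : 2 / logD D = 2 * (1 / logD D) := by ring
  have h4i : 1 / (4 * logD D) = 1 / 4 * (1 / logD D) := by field_simp
  have hαl := alpha_mul_log_le hL hlL
  set l := Real.log (logD D) with hldef
  set α := alpha D with hαdef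
  have hlpos : 0 < l := by linarith
  have hu := abs_le.mp hu1
  have hPu0 : 0 < ‖P u‖ := S.P_pos (by linarith) (by linarith) (by linarith) (by linarith)
  have b1 := S.norm_Δf_le (s := u + a) (by simp; linarith) (by simp; linarith)
    (by simpa using huim1)
  have b2 := S.norm_Δg_le (s := u - a) (by simp; linarith) (by simp; linarith)
    (by simpa using huim1)
  have hd : (1 - conj u) - u = ((-(2 * (u.re - 1 / 2)) : ℝ) : ℂ) := by
    apply Complex.ext <;> simp; ring
  have hdn : ‖(1 - conj u) - u‖ ≤ 6 / 10 * (α * l) := by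
    rw [hd, norm_real, Real.norm_eq_abs, abs_neg, abs_mul, abs_of_pos (by norm_num : (0 : ℝ) < 2)]
    linarith
  obtain ⟨θ, e3, b3⟩ := S.P_ratio (1 - conj u) u (by linarith) (by linarith) (by linarith)
    (by linarith)
  have b3' : θ.re ≤ 6 / 10 := by
    refine (re_le_norm θ).trans (b3.trans ?_)
    calc K * (logD D * l) * ‖1 - conj u - u‖ ≤ K * (logD D * l) * (6 / 10 * (α * l)) := by gcongr
      _ = 6 / 10 * ((K * l ^ 2) * (logD D * α)) := by ring
      _ ≤ 6 / 10 * (logD D * (logD D * α)) := by gcongr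
      _ = 6 / 10 := by linear_combination 6 / 10 * hα1
  have hKα : K * logD D * α * l ≤ 1 / 2 := by
    calc K * logD D * α * l = 1 / 2 * (2 * K * l * (logD D * α)) := by ring
      _ ≤ 1 / 2 * (1 * logD D * (logD D * α)) := by gcongr
      _ = 1 / 2 := by linear_combination 1 / 2 * hα1
  have ab : ∀ x : ℝ, -(4 / 10 * (α * l)) ≤ x → x ≤ 4 / 10 * (α * l) → K * logD D * |x| ≤ 1 / 2 := by
    intro x x1 x2
    have : |x| ≤ 4 / 10 * (α * l) := abs_le.mpr ⟨x1, x2⟩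
    calc K * logD D * |x| ≤ K * logD D * (4 / 10 * (α * l)) := by gcongr
      _ ≤ _ := by linarith
  have a1 := ab ((u + a).re - 1 / 2) (by simp; linarith) (by simp; linarith)
  have a2 := ab ((u - a).re - 1 / 2) (by simp; linarith) (by simp; linarith)
  rw [dualRatio, norm_div, norm_mul, norm_mul, norm_conj, div_le_iff₀ hPu0, e3, norm_mul, norm_exp]
  calc _ ≤ Real.exp (-((u + a).re - 1 / 2) * logD D ^ 2 + 1 / 2) *
        Real.exp (-((u - a).re - 1 / 2) * logD D ^ 2 + 1 / 2) * (‖P u‖ * Real.exp (6 / 10)) := by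
          gcongr
          · exact b1.trans (Real.exp_le_exp.mpr (by linarith))
          · exact b2.trans (Real.exp_le_exp.mpr (by linarith))
    _ = Real.exp ((-((u + a).re - 1 / 2) * logD D ^ 2 + 1 / 2) +
        (-((u - a).re - 1 / 2) * logD D ^ 2 + 1 / 2) + 6 / 10) * ‖P u‖ := by
          simp only [Real.exp_add]; ring
    _ ≤ _ := by
          rw [← Real.exp_add]
          refine mul_le_mul_of_nonneg_right (Real.exp_le_exp.mpr ?_) hPu0.le
          -- The shifts a and −a cancel between the two Δ-factors; the losses 1/2 + 1/2 + 6/10 stay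
          -- below 2.
          simp only [add_re, sub_re, ofReal_re]
          linarith

set_option maxHeartbeats 1000000 in
/-- The factor in the functional equation, compared with its value at a zero. -/
theorem eventually_dualRatio (K : ℝ) (hK : 1 ≤ K) : ∃ C : ℝ, 0 < C ∧ ∀ᶠ D : ℕ in atTop,
    ∀ f g P Δf Δg : ℂ → ℂ, Setting K D f g P Δf Δg → ∀ a : ℝ, |a| ≤ alpha D →
    ∀ ρ : ℂ, f ρ * g ρ = 0 → |ρ.im - D| < 1 →
    ∀ s : ℂ, ‖s‖ + alpha D ≤ 1 / 10 * alpha D * Real.log (logD D) →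
    ∀ z : ℂ, z.re = 1 / 5 * alpha D * Real.log (logD D) → |z.im| ≤ 8 * logD D →
    ‖dualRatio P Δf Δg a (ρ + s - z) + exp (-(2 * logD D ^ 2 : ℝ) * (s - z))‖ ≤
      C * (logD D * Real.log (logD D)) * ‖z‖ * Real.exp (2 * logD D ^ 2 * (z.re - s.re)) := by
  refine ⟨10 * K * (Real.exp 5 + 1) + 40 * K + 5, by positivity, ?_⟩
  filter_upwards [eventually_zero_near K, eventually_dual_at_zero K,
    eventually_norm_dualRatio_le K hK, eventually_le_logD 10,
    eventually_le_log_logD 1, eventually_mul_log_le 100 (δ := 1) (by norm_num)] with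
    D hzero hdual hfar hL hl hlL f g P Δf Δg S a ha ρ h0 h1 s hs z hz1 hz2
  have hpos : 0 < logD D := by linarith
  have hlpos : 0 < Real.log (logD D) := by linarith
  have hα := alpha_pos (by linarith : 1 ≤ logD D)
  have hα1 : alpha D * logD D ^ 2 = 1 := alpha_mul_sq (by linarith)
  have hα3 := alpha_le_hundredth hL
  have hρ := hzero f g P Δf Δg S ρ h0 h1
  have hm := hdual f g P Δf Δg S ρ h0 h1
  have hρ' := abs_lt.mp hρ
  have h1' := abs_lt.mp h1
  have hz2' := abs_le.mp hz2
  have ha' := abs_le.mp ha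
  have hi : 0 < 1 / logD D := by positivity
  have hi1 : 1 / logD D ≤ 1 / 10 := one_div_le_one_div_of_le (by norm_num) hL
  have h2i : 2 / logD D = 2 * (1 / logD D) := by ring
  have h4i : 1 / (4 * logD D) = 1 / 4 * (1 / logD D) := by field_simp
  set l := Real.log (logD D) with hldef
  set α := alpha D with hαdef
  have hαl : α * l ≤ 1 / 100 * (1 / logD D) := alpha_mul_log_le hL hlL
  have hs1 := abs_le.mp (abs_re_le_norm s)
  have hs2 := abs_le.mp (abs_im_le_norm s)
  have hzn : 1 / 5 * α * l ≤ ‖z‖ := hz1 ▸ re_le_norm z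
  have hαl0 := mul_pos hα hlpos
  have hαz : α ≤ ‖z‖ := by linarith [norm_nonneg s]
  have hsz : ‖s‖ ≤ ‖z‖ := by linarith
  set u := ρ + s - z with hu
  have hure : u.re = ρ.re + s.re - z.re := by simp [hu]
  have huim : u.im = ρ.im + s.im - z.im := by simp [hu]
  have huρ : u - ρ = s - z := by rw [hu]; ring
  have hure1 : -(3 / 10 * (α * l)) ≤ u.re - 1 / 2 := by
    rw [hure, hz1]; linarith
  have hure2 : u.re - 1 / 2 ≤ 0 := by
    rw [hure, hz1]; linarith
  have huim1 : |u.im - D| ≤ 11 * logD D := by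
    have : ‖s‖ ≤ 1 := by linarith
    rw [huim, abs_le]; constructor <;> linarith
  have hρim1 : |ρ.im - D| ≤ 11 * logD D := by linarith
  have hnorm : ‖exp (-(2 * logD D ^ 2 : ℝ) * (s - z))‖ =
      Real.exp (2 * logD D ^ 2 * (z.re - s.re)) := by
    rw [← ofReal_neg, norm_exp_ofReal_mul]; simp; ring
  have hszn : ‖s - z‖ ≤ 2 * ‖z‖ := (norm_sub_le _ _).trans (by linarith)
  have hPu0 : 0 < ‖P u‖ := S.P_pos (by linarith) (by linarith) (by linarith) (by linarith)
  have hPρ0 : 0 < ‖P ρ‖ := S.P_pos (by linarith) (by linarith) (by linarith) (by linarith)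
  set X := logD D * l with hX
  have hXpos : 0 < X := by positivity
  -- Either the accumulated logarithmic error θ is at most 1, so exp θ − 1 is linear in θ, or the
  -- asserted bound already exceeds the sum of the trivial bounds of the two terms.
  rcases le_or_gt (10 * K * (X * ‖z‖)) 1 with hc | hc
  · -- close to the zero
    have hzL : ‖z‖ ≤ 1 / 10 * (1 / logD D) := by
      have t1 : logD D * ‖z‖ ≤ K * (X * ‖z‖) := by
        have : logD D * 1 ≤ X := by rw [hX]; gcongr
        have t : 1 * (logD D * ‖z‖) ≤ K * (X * ‖z‖) := by gcongr; linarith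
        linarith
      have : ‖z‖ = (logD D * ‖z‖) * (1 / logD D) := by field_simp
      rw [this]; gcongr; linarith
    obtain ⟨θ₁, e1, b1⟩ := S.Δf_ratio (u + a) ρ (by simpa using huim1) hρim1
      (by simp; linarith) (by simp; linarith) (by linarith) (by linarith)
    obtain ⟨θ₂, e2, b2⟩ := S.Δg_ratio (u - a) ρ (by simpa using huim1) hρim1
      (by simp; linarith) (by simp; linarith) (by linarith) (by linarith)
    obtain ⟨θ₃, e3, b3⟩ := S.P_ratio (1 - conj u) (1 - conj ρ) (by simpa using by linarith)
      (by simp only [sub_re, one_re, conj_re]; linarith)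
      (by simp only [sub_re, one_re, conj_re]; linarith) (by
        have : (1 - conj u) - (1 - conj ρ) = -conj (u - ρ) := by simp
        rw [this, norm_neg, norm_conj, huρ]
        linarith)
    obtain ⟨θ₄, e4, b4⟩ := S.P_ratio u ρ (by linarith)
      (by linarith) (by linarith) (by rw [huρ]; linarith)
    have hdiff : (1 - conj u) - (1 - conj ρ) = -conj (u - ρ) := by simp
    rw [hdiff, norm_neg, norm_conj, huρ] at b3
    rw [huρ] at b4
    have c1 : ‖(u + a) - ρ‖ ≤ 3 * ‖z‖ := by
      have : (u + a) - ρ = (s - z) + a := by rw [hu]; ring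
      rw [this]
      refine (norm_add_le _ _).trans ?_
      rw [norm_real, Real.norm_eq_abs]; linarith
    have c2 : ‖(u - a) - ρ‖ ≤ 3 * ‖z‖ := by
      have : (u - a) - ρ = (s - z) - a := by rw [hu]; ring
      rw [this]
      refine (norm_sub_le _ _).trans ?_
      rw [norm_real, Real.norm_eq_abs]; linarith
    set θ := θ₁ + θ₂ + conj θ₃ - θ₄ with hθ
    have hθn : ‖θ‖ ≤ 10 * K * (X * ‖z‖) := by
      have t0 : K * logD D * (3 * ‖z‖) ≤ 3 * (K * (X * ‖z‖)) := by
        have : logD D * 1 ≤ X := by rw [hX]; gcongr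
        have : K * (logD D * 1) * (3 * ‖z‖) ≤ K * X * (3 * ‖z‖) := by gcongr
        linarith
      have t1 := b1.trans (by gcongr : _ ≤ K * logD D * (3 * ‖z‖))
      have t2 := b2.trans (by gcongr : _ ≤ K * logD D * (3 * ‖z‖))
      have t3 := b3.trans (by gcongr : _ ≤ K * X * (2 * ‖z‖))
      have t4 := b4.trans (by gcongr : _ ≤ K * X * (2 * ‖z‖))
      have : ‖θ‖ ≤ ‖θ₁‖ + ‖θ₂‖ + ‖θ₃‖ + ‖θ₄‖ := by
        rw [hθ, ← norm_conj θ₃]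
        exact (norm_sub_le _ _).trans (by gcongr; exact norm_add₃_le)
      linarith
    have key : dualRatio P Δf Δg a u + exp (-(2 * logD D ^ 2 : ℝ) * (s - z)) =
        exp (-(2 * logD D ^ 2 : ℝ) * (s - z)) *
          (Δf ρ * Δg ρ * conj (P (1 - conj ρ)) / P ρ * exp θ + 1) := by
      have hne := norm_pos_iff.mp hPρ0
      rw [dualRatio, e1, e2, e3, e4, map_mul, ← exp_conj]
      have hexp : exp (-(u + a - ρ) * (logD D ^ 2 : ℝ) + θ₁) *
          exp (-(u - a - ρ) * (logD D ^ 2 : ℝ) + θ₂) * exp (conj θ₃) =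
          exp (-(2 * logD D ^ 2 : ℝ) * (s - z)) * exp θ * exp θ₄ := by
        simp only [← exp_add]
        congr 1
        rw [hθ, hu]; push_cast; ring
      have hne4 := exp_ne_zero θ₄
      generalize exp (-(u + a - ρ) * (logD D ^ 2 : ℝ) + θ₁) = E₁ at hexp ⊢
      generalize exp (-(u - a - ρ) * (logD D ^ 2 : ℝ) + θ₂) = E₂ at hexp ⊢
      generalize exp (-(2 * logD D ^ 2 : ℝ) * (s - z)) = E₃ at hexp ⊢
      field_simp
      linear_combination Δf ρ * Δg ρ * conj (P (1 - conj ρ)) * hexp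
    rw [key, norm_mul, hnorm, mul_comm]
    gcongr
    refine (norm_mul_exp_add_one_le hm (by
      rw [inv_le_one₀ hpos]; linarith) (hθn.trans hc)).trans ?_
    -- The error 1/𝓛 in the value at ρ is absorbed because ‖z‖ ≥ αl/5, so that 𝓛l‖z‖ ≥ l²/(5𝓛).
    have hX2 : (logD D)⁻¹ ≤ 5 * (X * ‖z‖) := by
      have : 5 * (X * (1 / 5 * α * l)) = (logD D)⁻¹ * l ^ 2 := by
        rw [hX]; field_simp; linear_combination hα1
      calc (logD D)⁻¹ = (logD D)⁻¹ * 1 ^ 2 := by ring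
        _ ≤ (logD D)⁻¹ * l ^ 2 := by gcongr
        _ ≤ _ := by rw [← this]; gcongr
    have : 0 ≤ 10 * K * (Real.exp 5 + 1) * (X * ‖z‖) := by positivity
    linarith
  · -- far from the zero
    have hd1 : ‖dualRatio P Δf Δg a u‖ ≤ Real.exp 5 * Real.exp (2 * logD D ^ 2 * (z.re - s.re)) := by
      refine (hfar f g P Δf Δg S a ha (by linarith [norm_nonneg s]) u
        (abs_le.mpr ⟨by linarith, by linarith⟩) huim1).trans ?_
      rw [← Real.exp_add, ← Real.exp_add, Real.exp_le_exp, hure]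
      have : -α * logD D ^ 2 ≤ (ρ.re - 1 / 2) * logD D ^ 2 := by gcongr; linarith
      linarith
    refine (norm_add_le _ _).trans ?_
    rw [hnorm]
    calc _ ≤ (Real.exp 5 + 1) * Real.exp (2 * logD D ^ 2 * (z.re - s.re)) := by linarith
      _ ≤ ((10 * K * (Real.exp 5 + 1) + 40 * K + 5) * X * ‖z‖) *
          Real.exp (2 * logD D ^ 2 * (z.re - s.re)) := by
        gcongr
        have : (Real.exp 5 + 1) * 1 ≤ (Real.exp 5 + 1) * (10 * K * (X * ‖z‖)) := by gcongr
        have : 0 ≤ (40 * K + 5) * (X * ‖z‖) := by positivity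
        linarith

/-! ### From f(u + a)/f(u − a) to the quotient by moving the contour. -/

theorem norm_vint_mul_kernel_le {D : ℕ} (hD : 1 ≤ logD D) {h : ℂ → ℂ} {κ c T B : ℝ} (hc : 0 < c)
    (hc1 : c ≤ 1) (hT : 0 ≤ T) (hB : 0 ≤ B) (hle : ∀ z : ℂ, z.re = c → |z.im| ≤ T → ‖h z‖ ≤ B) :
    ‖vint (fun z => h z * kernel D κ z) c T‖ ≤
      B * (80 * (alpha D / c) * Real.exp (logD D ^ 2 * ((κ + 1 / 10) * c))) := by
  have hα := alpha_pos hD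
  set M := Real.exp (logD D ^ 2 * ((κ + 1 / 10) * c)) with hM
  have hint : IntervalIntegrable (fun y : ℝ => B * (20 * alpha D * M) * (1 / (c ^ 2 + y ^ 2)))
      volume (-T) T := by
    apply Continuous.intervalIntegrable
    have : ∀ y : ℝ, c ^ 2 + y ^ 2 ≠ 0 := fun y => by positivity
    fun_prop (disch := exact this _)
  refine (norm_vint_le hT hint ?_).trans ?_
  · intro y hy
    have hre : ((c : ℂ) + y * I).re = c := by simp
    have him : ((c : ℂ) + y * I).im = y := by simp
    have hk := norm_kernel_le hD κ ((c : ℂ) + y * I)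
    rw [hre, him, abs_of_pos hc] at hk
    have hn : ‖(c : ℂ) + y * I‖ ^ 2 = c ^ 2 + y ^ 2 := by
      rw [← normSq_eq_norm_sq, normSq_apply, hre, him]; ring
    have he : κ * c + c / 10 = (κ + 1 / 10) * c := by ring
    rw [hn, he] at hk
    have hg : Real.exp ((c ^ 2 - y ^ 2) / 4) ≤ 2 := by
      have : Real.exp ((c ^ 2 - y ^ 2) / 4) ≤ Real.exp (1 / 4) :=
        Real.exp_le_exp.mpr (by nlinarith [sq_nonneg y])
      have h2 := Real.exp_bound_div_one_sub_of_interval (by norm_num : (0 : ℝ) ≤ 1 / 4)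
        (by norm_num)
      norm_num at h2
      linarith
    rw [norm_mul]
    calc _ ≤ B * (10 * alpha D * M * 2 / (c ^ 2 + y ^ 2)) := by
          gcongr
          · exact hle _ hre (by rwa [him])
          · refine hk.trans ?_
            gcongr
      _ = _ := by ring
  · rw [intervalIntegral.integral_const_mul]
    -- Integrating α/‖z‖² along the line gives the factor α/c. For c of order αl this saves 1/l,
    -- while the power of Q is only a power of 𝓛.
    calc _ ≤ B * (20 * alpha D * M) * (4 / c) := by
          gcongr; exact integral_one_div_sq_le hc
      _ = _ := by ring

/-- The kernel is negligible on the horizontal sides. -/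
theorem norm_kernel_top_le {D : ℕ} (hD : 10 ≤ logD D) {κ : ℝ} (hκ : 0 ≤ κ) (hκ' : κ ≤ 4 / 3) {z : ℂ}
    (h1 : |z.re| ≤ 1) (h2 : |z.im| = 8 * logD D) : ‖kernel D κ z‖ ≤ Real.exp (-14 * logD D ^ 2) := by
  have hα := alpha_pos (by linarith : 1 ≤ logD D)
  have hα2 := alpha_le_hundredth hD
  have hz : 1 ≤ ‖z‖ ^ 2 := one_le_pow₀ (by
    have := abs_im_le_norm z
    linarith)
  refine (norm_kernel_le (by linarith) κ z).trans ?_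
  have him : z.im ^ 2 = 64 * logD D ^ 2 := by rw [← sq_abs, h2]; ring
  have hre : z.re ^ 2 ≤ 1 := by rw [← sq_abs]; exact pow_le_one₀ (abs_nonneg _) h1
  have hκz : κ * z.re + |z.re| / 10 ≤ 3 / 2 := by
    have : κ * z.re ≤ 4 / 3 * 1 :=
      (mul_le_mul_of_nonneg_left ((le_abs_self _).trans h1) hκ).trans (by linarith)
    linarith
  refine (div_le_self (by positivity) hz).trans ?_
  calc _ ≤ 1 * Real.exp (logD D ^ 2 * (3 / 2)) * Real.exp ((1 - 64 * logD D ^ 2) / 4) := by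
        rw [him]
        gcongr
        linarith
    _ = Real.exp (logD D ^ 2 * (3 / 2) + (1 - 64 * logD D ^ 2) / 4) := by
        rw [one_mul, ← Real.exp_add]
    _ ≤ _ := by
        rw [Real.exp_le_exp]; nlinarith

theorem Setting.norm_deriv_f_le {K : ℝ} {D : ℕ} {f g P Δf Δg : ℂ → ℂ}
    (S : Setting K D f g P Δf Δg) (hL : 10 ≤ logD D) {v : ℂ} (h1 : 1 / 2 ≤ v.re) (h2 : v.re ≤ 2)
    (h3 : |v.im - D| ≤ 10 * logD D) : ‖deriv f v‖ ≤ 4 * Real.exp (2 * logD D ^ 2) := by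
  have := norm_deriv_le_of_forall_mem_sphere_norm_le (f := f) (c := v) (R := 1 / 4)
    (C := Real.exp (2 * logD D ^ 2)) (by norm_num)
    (S.f_diff.diffContOnCl) (by
      intro z hz
      rw [mem_sphere_iff_norm] at hz
      have a1 := abs_le.mp ((abs_re_le_norm (z - v)).trans_eq hz)
      have a2 := abs_le.mp ((abs_im_le_norm (z - v)).trans_eq hz)
      rw [sub_re] at a1
      rw [sub_im] at a2
      rw [abs_le] at h3
      exact S.f_le z (by linarith) (by linarith) (abs_le.mpr ⟨by linarith, by linarith⟩))
  refine this.trans (le_of_eq ?_)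
  ring

/-- A crude lower bound for `L(s, ψ)` to the right of the critical line. -/
theorem eventually_f_inv_le (K : ℝ) : ∀ᶠ D : ℕ in atTop, ∀ f g P Δf Δg : ℂ → ℂ,
    Setting K D f g P Δf Δg → ∀ v : ℂ, 1 / 2 + alpha D ≤ v.re → v.re ≤ 2 →
    |v.im - D| ≤ 10 * logD D → f v ≠ 0 ∧ ‖(f v)⁻¹‖ ≤ Real.exp (8 * logD D ^ 2) := by
  filter_upwards [eventually_LL_bounds K, eventually_le_logD 10, eventually_le_log_logD 1,
    eventually_mul_log_le 100 (δ := 1) (by norm_num)] with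
    D hLL hL hl hlL f g P Δf Δg S v h1 h2 h3
  have hpos : 0 < logD D := by linarith
  have hα := alpha_pos (by linarith : 1 ≤ logD D)
  have hα3 := alpha_le_hundredth hL
  have hi : 0 < 2 / logD D := by positivity
  have hLsq : 100 ≤ logD D ^ 2 := by nlinarith
  have hsmall : Real.exp (-6 * logD D ^ 2) ≤ 1 / 100 := by
    rw [neg_mul, Real.exp_neg, one_div]
    apply inv_anti₀ (by norm_num)
    linarith [Real.add_one_le_exp (6 * logD D ^ 2)]
  -- A lower bound for fg by P and an upper bound for g bound f from below, but only for Re v < 1.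
  have low : ∀ v : ℂ, 1 / 2 + alpha D ≤ v.re → v.re < 1 → |v.im - D| ≤ 10 * logD D →
      Real.exp (-(7 / 2) * logD D ^ 2) ≤ ‖f v‖ := by
    intro v h1 h2 h3
    have b1 := (hLL f g P Δf Δg S v h1 h2 (by linarith)).1
    have b2 := S.P_ge v (by linarith) (by linarith) (by linarith)
    have b3 := S.g_le v (by linarith) (by linarith) (by linarith)
    rw [norm_mul] at b1
    have b4 : 2 * Real.exp (-(3 / 2) * logD D ^ 2) ≤ ‖P v‖ := by
      refine le_trans ?_ b2
      have e : Real.exp (4 * Real.log (logD D)) = logD D ^ 4 := by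
        rw [exp_mul_log_logD (by linarith)]; norm_cast
      have t : logD D ^ 3 * (2 * Real.log (logD D)) ≤ logD D ^ 3 * logD D := by
        gcongr; linarith
      have t2 : 2 * logD D ^ 3 * Real.log (logD D) ≤ Real.exp (4 * Real.log (logD D)) := by
        rw [e]; nlinarith
      calc 2 * Real.exp (-(3 / 2) * logD D ^ 2) ≤ Real.exp 1 * Real.exp (-(3 / 2) * logD D ^ 2) := by
            gcongr; linarith [Real.add_one_le_exp (1 : ℝ)]
        _ ≤ (Real.exp (4 * Real.log (logD D)))⁻¹ := by
            rw [← Real.exp_add, ← Real.exp_neg, Real.exp_le_exp]; nlinarith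
        _ ≤ _ := inv_anti₀ (by positivity) t2
    have b5 : ‖f v‖ * ‖g v‖ ≤ ‖f v‖ * Real.exp (2 * logD D ^ 2) := by gcongr
    have b6 : Real.exp (-(7 / 2) * logD D ^ 2) * Real.exp (2 * logD D ^ 2) =
        Real.exp (-(3 / 2) * logD D ^ 2) := by rw [← Real.exp_add]; ring_nf
    have : Real.exp (-(7 / 2) * logD D ^ 2) * Real.exp (2 * logD D ^ 2) ≤
        ‖f v‖ * Real.exp (2 * logD D ^ 2) := by rw [b6]; linarith
    exact le_of_mul_le_mul_right this (Real.exp_pos _)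
  have conv : ∀ v : ℂ, Real.exp (-8 * logD D ^ 2) ≤ ‖f v‖ →
      f v ≠ 0 ∧ ‖(f v)⁻¹‖ ≤ Real.exp (8 * logD D ^ 2) := by
    intro v hv
    refine ⟨norm_pos_iff.mp ((Real.exp_pos _).trans_le hv), ?_⟩
    rw [norm_inv, inv_le_comm₀ ((Real.exp_pos _).trans_le hv) (Real.exp_pos _), ← Real.exp_neg]
    convert! hv using 2
    ring
  rcases lt_or_ge v.re 1 with hv | hv
  · apply conv
    refine le_trans ?_ (low v h1 hv h3)
    rw [Real.exp_le_exp]; nlinarith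
  rcases le_or_gt (1 + Real.exp (-6 * logD D ^ 2)) v.re with hv2 | hv2
  · have h0 : 1 < v.re := by linarith [Real.exp_pos (-6 * logD D ^ 2)]
    refine ⟨S.f_ne v hv, (S.f_inv_le v h0).trans ?_⟩
    have : 1 / (v.re - 1) ≤ Real.exp (6 * logD D ^ 2) := by
      rw [div_le_iff₀ (by linarith)]
      calc 1 = Real.exp (6 * logD D ^ 2) * Real.exp (-6 * logD D ^ 2) := by
            rw [← Real.exp_add]; simp
        _ ≤ _ := by gcongr; linarith
    have h2e : Real.exp (6 * logD D ^ 2) * 3 ≤ Real.exp (8 * logD D ^ 2) := by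
      calc Real.exp (6 * logD D ^ 2) * 3 ≤ Real.exp (6 * logD D ^ 2) * Real.exp (2 * logD D ^ 2) := by
            gcongr; linarith [Real.add_one_le_exp (2 * logD D ^ 2)]
        _ = _ := by rw [← Real.exp_add]; ring_nf
    have : 1 ≤ Real.exp (6 * logD D ^ 2) := Real.one_le_exp (by positivity)
    linarith
  · -- The gap between the two ranges is bridged by the mean value inequality.
    apply conv
    set δ := Real.exp (-6 * logD D ^ 2) with hδ
    have hδ0 : 0 < δ := Real.exp_pos _
    set v' : ℂ := v - ((2 * δ : ℝ) : ℂ) with hv'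
    have hre : v'.re = v.re - 2 * δ := by simp [hv']
    have him : v'.im = v.im := by simp [hv']
    have b1 := low v' (by rw [hre]; linarith) (by rw [hre]; linarith) (by rwa [him])
    have b2 : ‖f v' - f v‖ ≤ 4 * Real.exp (2 * logD D ^ 2) * ‖v' - v‖ := by
      apply (convex_segment v v').norm_image_sub_le_of_norm_deriv_le (𝕜 := ℂ)
        (fun x _ => S.f_diff x) _ (left_mem_segment ℝ v v') (right_mem_segment ℝ v v')
      intro x hx
      rw [segment_eq_image'] at hx
      obtain ⟨t, ht, rfl⟩ := hx
      have hr : (v + t • (v' - v)).re = v.re - t * (2 * δ) := by simp [hv']; ring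
      have hi : (v + t • (v' - v)).im = v.im := by simp [hv']
      have : t * (2 * δ) ≤ 1 * (2 * δ) := by gcongr; exact ht.2
      have : 0 ≤ t * (2 * δ) := mul_nonneg ht.1 (by linarith)
      exact S.norm_deriv_f_le hL (by rw [hr]; linarith) (by rw [hr]; linarith) (by rwa [hi])
    have hn : ‖v' - v‖ = 2 * δ := by
      have : v' - v = ((-(2 * δ) : ℝ) : ℂ) := by rw [hv']; push_cast; ring
      rw [this, norm_real, Real.norm_eq_abs, abs_neg, abs_of_pos (by linarith)]
    rw [hn] at b2
    have b3 : 4 * Real.exp (2 * logD D ^ 2) * (2 * δ) = 8 * Real.exp (-4 * logD D ^ 2) := by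
      have : Real.exp (2 * logD D ^ 2) * δ = Real.exp (-4 * logD D ^ 2) := by
        rw [hδ, ← Real.exp_add]; ring_nf
      rw [← this]; ring
    have b4 : 10 * Real.exp (-4 * logD D ^ 2) ≤ Real.exp (-(7 / 2) * logD D ^ 2) := by
      calc 10 * Real.exp (-4 * logD D ^ 2) ≤
            Real.exp (1 / 2 * logD D ^ 2) * Real.exp (-4 * logD D ^ 2) := by
            gcongr; linarith [Real.add_one_le_exp (1 / 2 * logD D ^ 2)]
        _ = _ := by rw [← Real.exp_add]; ring_nf
    have b5 : Real.exp (-8 * logD D ^ 2) ≤ Real.exp (-4 * logD D ^ 2) := by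
      rw [Real.exp_le_exp]; nlinarith
    have := norm_sub_norm_le (f v') (f v)
    linarith [Real.exp_pos (-4 * logD D ^ 2)]

theorem abs_eq_alpha {D : ℕ} (hD : 1 ≤ logD D) {a : ℝ} (ha : a = alpha D ∨ a = -alpha D) :
    |a| = alpha D := by
  have := alpha_pos hD
  rcases ha with rfl | rfl
  · exact abs_of_pos this
  · rw [abs_neg, abs_of_pos this]

/-- Moving the line of integration for `L(s + a, ψ) / L(s - a, ψ)` next to the critical line. -/
theorem eventually_vint_div_shift (K : ℝ) : ∀ᶠ D : ℕ in atTop, ∀ f g P Δf Δg : ℂ → ℂ,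
    Setting K D f g P Δf Δg → ∀ a : ℝ, |a| ≤ alpha D → ∀ κ : ℝ, 0 ≤ κ → κ ≤ 4 / 3 →
    ∀ c : ℝ, 5 * alpha D ≤ c → c ≤ 1 → ∀ w : ℂ, 1 / 2 + 2 * alpha D ≤ w.re + c →
    w.re ≤ 6 / 10 → |w.im - D| ≤ 2 →
    ‖vint (fun z => f (w + z + a) / f (w + z - a) * kernel D κ z) 1 (8 * logD D) -
      vint (fun z => f (w + z + a) / f (w + z - a) * kernel D κ z) c (8 * logD D)‖ ≤
      2 * Real.exp (-4 * logD D ^ 2) := by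
  filter_upwards [eventually_f_inv_le K, eventually_le_logD 10] with
    D hinv hL f g P Δf Δg S a ha κ hκ hκ' c hc hc1 w hw hw2 hw3
  have hpos : 0 < logD D := by linarith
  have hα := alpha_pos (by linarith : 1 ≤ logD D)
  have hα3 := alpha_le_hundredth hL
  have ha' := abs_le.mp ha
  have hw3' := abs_le.mp hw3
  have hf : ∀ z : ℂ, c ≤ z.re → z.re ≤ 1 → |z.im| ≤ 8 * logD D → f (w + z - a) ≠ 0 ∧
      ‖(f (w + z - a))⁻¹‖ ≤ Real.exp (8 * logD D ^ 2) := by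
    intro z h1 h2 h3
    rw [abs_le] at h3
    apply hinv f g P Δf Δg S _ (by simp; linarith) (by simp; linarith)
    rw [abs_le]; simp; constructor <;> linarith
  refine (norm_vint_sub_le (ε := Real.exp (-4 * logD D ^ 2)) hc1 (by positivity) ?_ ?_).trans ?_
  · intro z h1 h2 h3
    have hz : z ≠ 0 := by
      rintro rfl
      simp at h1; linarith
    refine DifferentiableAt.mul (DifferentiableAt.div ?_ ?_ (hf z h1 h2 h3).1)
      (differentiableAt_kernel D κ hz)
    · exact (S.f_diff _).comp z ((differentiableAt_id.const_add w).add_const _)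
    · exact (S.f_diff _).comp z ((differentiableAt_id.const_add w).sub_const _)
  · intro z h1 h2 h3
    have b1 : ‖f (w + z + a)‖ ≤ Real.exp (2 * logD D ^ 2) := by
      have h3' := abs_le.mp h3.le
      apply S.f_le _ (by simp; linarith) (by simp; linarith)
      rw [abs_le]; simp; constructor <;> linarith
    have b2 := (hf z h1 h2 h3.le).2
    have b3 := norm_kernel_top_le hL hκ hκ' (z := z) (abs_le.mpr ⟨by linarith, h2⟩) h3
    rw [div_eq_mul_inv, norm_mul, norm_mul]
    calc _ ≤ Real.exp (2 * logD D ^ 2) * Real.exp (8 * logD D ^ 2) * Real.exp (-14 * logD D ^ 2) := by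
          gcongr
      _ = _ := by rw [← Real.exp_add, ← Real.exp_add]; ring_nf
  · have := Real.exp_pos (-4 * logD D ^ 2)
    have h1c : 1 - c ≤ 1 := by linarith
    calc 2 * Real.exp (-4 * logD D ^ 2) * (1 - c) ≤ 2 * Real.exp (-4 * logD D ^ 2) * 1 := by gcongr
      _ = _ := mul_one _

/-- The dual term of the approximate functional equation. -/
noncomputable def dualTerm (P Δf Δg : ℂ → ℂ) (s : ℂ) : ℂ := Δf s * Δg s * conj (P (1 - conj s))

/-- The part of `L(s + a, ψ) / L(s - a, ψ)` which is close to `quot`. -/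
noncomputable def quotMain (f g P Δf Δg : ℂ → ℂ) (a : ℝ) (u : ℂ) : ℂ :=
  quot f g P a u * ((P u + dualTerm P Δf Δg (u - a)) / (f (u - a) * g (u - a)))

theorem Setting.differentiableAt_dualTerm {K : ℝ} {D : ℕ} {f g P Δf Δg : ℂ → ℂ}
    (S : Setting K D f g P Δf Δg) {s : ℂ} (hs : |s.im - D| ≤ 11 * logD D) :
    DifferentiableAt ℂ (dualTerm P Δf Δg) s := by
  refine ((S.Δf_diff s hs).mul (S.Δg_diff s hs)).mul ?_
  have h1 : DifferentiableAt ℂ (conj ∘ P ∘ conj) (1 - s) := by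
    have := (S.P_diff (conj (1 - s))).conj_conj
    rwa [conj_conj] at this
  have h2 : (fun s => conj (P (1 - conj s))) = fun s => (conj ∘ P ∘ conj) (1 - s) := by
    ext s; simp
  rw [h2]
  exact h1.comp s (differentiableAt_id.const_sub 1)

/-- Indeed f(u + a)/f(u − a) = quot(u) P(u) / (fg)(u − a), and the main part carries the dual term
in addition to P(u). -/
theorem div_sub_quotMain {f g P Δf Δg : ℂ → ℂ} {a : ℝ} {u : ℂ} (hP : P u ≠ 0)
    (hf : f (u - a) ≠ 0) (hg : g (u - a) ≠ 0) :
    f (u + a) / f (u - a) - quotMain f g P Δf Δg a u =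
      -(quot f g P a u * (dualTerm P Δf Δg (u - a) / (f (u - a) * g (u - a)))) := by
  rw [quotMain, quot]
  field_simp
  ring

/-- `quotMain` is close to `quot`. -/
theorem eventually_quotMain (K : ℝ) (hK : 1 ≤ K) : ∃ C : ℝ, 0 < C ∧ ∀ᶠ D : ℕ in atTop,
    ∀ f g P Δf Δg : ℂ → ℂ, Setting K D f g P Δf Δg → ∀ a : ℝ, a = alpha D ∨ a = -alpha D →
    ∀ u : ℂ, 1 / 2 + 2 * alpha D ≤ u.re → u.re ≤ 6 / 10 → |u.im - D| ≤ 9 * logD D →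
    DifferentiableAt ℂ (quotMain f g P Δf Δg a) u ∧
    ‖quotMain f g P Δf Δg a u - quot f g P a u‖ ≤ C * (Real.log (logD D) / logD D) := by
  obtain ⟨C, hC, hquot⟩ := eventually_norm_quot_le K hK
  refine ⟨C * (6 * K), by positivity, ?_⟩
  filter_upwards [hquot, eventually_LL_bounds K, eventually_error_le K, eventually_le_logD 10,
    eventually_le_log_logD 1, eventually_mul_log_le K (δ := 1) (by norm_num)] with
    D hquot hLL herr hL hl hKl f g P Δf Δg S a ha u h1 h2 h3
  have hpos : 0 < logD D := by linarith
  have hα := alpha_pos (by linarith : 1 ≤ logD D)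
  have hα3 := alpha_le_hundredth hL
  have haα := abs_eq_alpha (by linarith) ha
  have ha' := abs_le.mp haα.le
  have hi : 0 < 1 / logD D := by positivity
  have h2i : 2 / logD D = 2 * (1 / logD D) := by ring
  have e1 : (u - a).re = u.re - a := by simp
  have e2 : (u - a).im = u.im := by simp
  have bLL := hLL f g P Δf Δg S (u - a) (by rw [e1]; linarith) (by rw [e1]; linarith)
    (by rw [e2]; linarith)
  have bE := herr f g P Δf Δg S (u - a) (by rw [e1]; linarith) (by rw [e1]; linarith)
    (by rw [e2]; linarith)
  have bA := S.approx (u - a) (by rw [e1]; nlinarith) (by rw [e1]; linarith) (by rw [e2]; linarith)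
  have hPv := S.P_pos (by linarith) (s := u - a) (by rw [e1]; linarith) (by rw [e1]; linarith)
    (by rw [e2]; linarith)
  have hPu := norm_pos_iff.mp (S.P_pos (by linarith) (s := u) (by linarith) (by linarith)
    (by linarith))
  have hfg : 0 < ‖f (u - a) * g (u - a)‖ := by linarith
  have hfg' := norm_pos_iff.mp hfg
  have hne := mul_ne_zero_iff.mp hfg'
  have hα1 : alpha D * logD D = 1 / logD D := alpha_mul (by linarith)
  refine ⟨?_, ?_⟩
  · refine (S.differentiableAt_quot a hPu).mul (DifferentiableAt.div ?_ ?_ hfg')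
    · refine (S.P_diff u).add ?_
      exact (S.differentiableAt_dualTerm (by rw [e2]; linarith)).comp u
        (differentiableAt_id.sub_const _)
    · exact ((S.f_diff _).comp u (differentiableAt_id.sub_const _)).mul
        ((S.g_diff _).comp u (differentiableAt_id.sub_const _))
  · obtain ⟨θ, hθ1, hθ2⟩ := S.P_ratio u (u - a) (by rw [e2]; linarith) (by rw [e1]; linarith)
      (by rw [e1]; linarith) (by
        simp only [sub_sub_cancel, norm_real, Real.norm_eq_abs, haα]
        rw [le_div_iff₀ (by positivity)]
        have : 1 / logD D ≤ 1 / 10 := one_div_le_one_div_of_le (by norm_num) hL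
        linarith)
    simp only [sub_sub_cancel, norm_real, Real.norm_eq_abs, haα] at hθ2
    have hθ3 : ‖θ‖ ≤ K * (Real.log (logD D) / logD D) := by
      refine hθ2.trans (le_of_eq ?_)
      calc _ = K * Real.log (logD D) * (alpha D * logD D) := by ring
        _ = _ := by rw [hα1]; ring
    have hθ4 : ‖θ‖ ≤ 1 := by
      refine hθ3.trans ?_
      rw [← mul_div_assoc, div_le_one hpos]; linarith
    have hPP : ‖P u - P (u - a)‖ ≤ 2 * K * (Real.log (logD D) / logD D) * ‖P (u - a)‖ := by
      have e : P u - P (u - a) = (exp θ - 1) * P (u - a) := by rw [hθ1]; ring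
      rw [e, norm_mul]
      gcongr
      exact (norm_exp_sub_one_le hθ4).trans (by linarith)
    -- The numerator is the change of P over a distance α, of relative size αl𝓛 = l/𝓛, minus the
    -- error of the approximation, of relative size at most 1/𝓛.
    have hsplit : quotMain f g P Δf Δg a u - quot f g P a u = quot f g P a u *
        ((P u - P (u - a) - (f (u - a) * g (u - a) - (P (u - a) + dualTerm P Δf Δg (u - a)))) /
          (f (u - a) * g (u - a))) := by
      rw [quotMain]
      have := hne.1
      have := hne.2
      field_simp
      ring
    rw [hsplit, norm_mul, norm_div, mul_assoc]
    have hquot' := hquot f g P Δf Δg S a ha u (by linarith) (by linarith) h3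
    gcongr
    rw [div_le_iff₀ hfg]
    refine (norm_sub_le _ _).trans ?_
    have hinv : (logD D)⁻¹ ≤ K * (Real.log (logD D) / logD D) := by
      rw [← mul_div_assoc, inv_eq_one_div]
      gcongr
      nlinarith
    calc _ ≤ 2 * K * (Real.log (logD D) / logD D) * ‖P (u - a)‖ + (logD D)⁻¹ * ‖P (u - a)‖ :=
          add_le_add hPP (bA.trans bE)
      _ ≤ 2 * K * (Real.log (logD D) / logD D) * ‖P (u - a)‖ +
          K * (Real.log (logD D) / logD D) * ‖P (u - a)‖ := by gcongr
      _ = 6 * K * (Real.log (logD D) / logD D) * (1 / 2 * ‖P (u - a)‖) := by ring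
      _ ≤ _ := by
        gcongr
        exact bLL.1

set_option maxHeartbeats 2000000 in
-- Two lines are needed. At Re z = 3αl the dual term is small enough to be dropped in spite of the
-- kernel, but the error l/𝓛 of the main part would be too costly there. At Re z = αl/5 the kernel
-- is cheap, but the dual term is not negligible. So the ratio is replaced by `quotMain` on the
-- first line, `quotMain` is moved to the second, and only there replaced by `quot`.
theorem eventually_vint_div (K : ℝ) (hK : 1 ≤ K) : ∃ C : ℝ, 0 < C ∧ ∀ᶠ D : ℕ in atTop,
    ∀ f g P Δf Δg : ℂ → ℂ, Setting K D f g P Δf Δg → ∀ a : ℝ, a = alpha D ∨ a = -alpha D →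
    ∀ κ : ℝ, 0 ≤ κ → κ ≤ 4 / 3 → ∀ w : ℂ, |w.re - 1 / 2| ≤ 1 / 10 * alpha D * Real.log (logD D) →
    |w.im - D| ≤ 2 →
    ‖vint (fun z => f (w + z + a) / f (w + z - a) * kernel D κ z) 1 (8 * logD D) -
      vint (fun z => quot f g P a (w + z) * kernel D κ z) (1 / 5 * alpha D * Real.log (logD D))
        (8 * logD D)‖ ≤
      C * Real.exp (-Real.log (logD D) + 1 / 5 * (κ + 1 / 10) * Real.log (logD D)) := by
  obtain ⟨C₀, hC₀, hquot⟩ := eventually_norm_quot_le K hK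
  obtain ⟨C₁, hC₁, hmain⟩ := eventually_quotMain K hK
  refine ⟨2 + 160 * C₀ + 2 * (C₀ + C₁) + 400 * C₁, by positivity, ?_⟩
  filter_upwards [hquot, hmain, eventually_vint_div_shift K, eventually_dual_near K,
    eventually_LL_bounds K, eventually_f_inv_le K, eventually_le_logD 10, eventually_le_log_logD 100,
    eventually_mul_log_le 100 (δ := 1) (by norm_num)] with
    D hquot hmain hshift hdual hLL hinv hL hl hlL f g P Δf Δg S a ha κ hκ hκ' w hw1 hw2
  have hpos : 0 < logD D := by linarith
  have hα := alpha_pos (by linarith : 1 ≤ logD D)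
  have hα1 := alpha_mul_sq (by linarith : 1 ≤ logD D)
  have hα3 := alpha_le_hundredth hL
  have haα := abs_eq_alpha (by linarith) ha
  have hi : 0 < 1 / logD D := by positivity
  have hi1 : 1 / logD D ≤ 1 / 10 := one_div_le_one_div_of_le (by norm_num) hL
  have hαl := alpha_mul_log_le hL hlL
  specialize hquot f g P Δf Δg S a ha
  specialize hmain f g P Δf Δg S a ha
  specialize hshift f g P Δf Δg S a haα.le κ hκ hκ'
  specialize hdual f g P Δf Δg S
  specialize hLL f g P Δf Δg S
  specialize hinv f g P Δf Δg S
  set l := Real.log (logD D) with hldef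
  set α := alpha D with hαdef
  set T := 8 * logD D with hTdef
  have hT : 0 ≤ T := by positivity
  have hαl0 : 100 * α ≤ α * l := by nlinarith
  set c₁ := 1 / 5 * α * l with hc₁
  set c₂ := 3 * α * l with hc₂
  have ha' := abs_le.mp haα.le
  have hw1' := abs_le.mp hw1
  have hw2' := abs_le.mp hw2
  have hc₁0 : 0 < c₁ := by rw [hc₁]; linarith
  have hc₂0 : 0 < c₂ := by rw [hc₂]; linarith
  have hc₂1 : c₂ ≤ 1 := by rw [hc₂]; linarith
  have hc₁₂ : c₁ ≤ c₂ := by rw [hc₁, hc₂]; linarith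
  have hure : ∀ z : ℂ, c₁ ≤ z.re → z.re ≤ c₂ →
      1 / 2 + 2 * α ≤ (w + z).re ∧ (w + z).re ≤ 6 / 10 := by
    intro z h1 h2
    rw [add_re]; constructor <;> linarith
  have huim : ∀ z : ℂ, |z.im| ≤ T → |(w + z).im - D| ≤ 9 * logD D := by
    intro z h
    have h := abs_le.mp h
    rw [abs_le, add_im]; constructor <;> linarith
  have hz0 : ∀ z : ℂ, c₁ ≤ z.re → z ≠ 0 := by
    rintro z h rfl
    rw [zero_re] at h; linarith
  have hre : ∀ z : ℂ, (w + z - a).re = (w + z).re - a := fun z => by simp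
  have him : ∀ z : ℂ, (w + z - a).im = (w + z).im := fun z => by simp
  have hfne : ∀ z : ℂ, c₁ ≤ z.re → z.re ≤ c₂ → |z.im| ≤ T → f (w + z - a) ≠ 0 := by
    intro z h1 h2 h3
    have := hure z h1 h2
    have := huim z h3
    exact (hinv _ (by rw [hre]; linarith) (by rw [hre]; linarith) (by rw [him]; linarith)).1
  have hPne : ∀ z : ℂ, c₁ ≤ z.re → z.re ≤ c₂ → |z.im| ≤ T → P (w + z) ≠ 0 := by
    intro z h1 h2 h3
    have := hure z h1 h2
    have := huim z h3
    have h2i : 2 / logD D = 2 * (1 / logD D) := by ring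
    exact norm_pos_iff.mp (S.P_pos (by linarith) (by linarith) (by linarith) (by linarith))
  have dJ : ∀ z : ℂ, c₁ ≤ z.re → z.re ≤ c₂ → |z.im| ≤ T →
      DifferentiableAt ℂ (fun z => quotMain f g P Δf Δg a (w + z) * kernel D κ z) z := by
    intro z h1 h2 h3
    refine DifferentiableAt.mul ?_ (differentiableAt_kernel D κ (hz0 z h1))
    have := hure z h1 h2
    exact (hmain (w + z) this.1 this.2 (huim z h3)).1.comp z (differentiableAt_id.const_add w)
  have dK : ∀ z : ℂ, c₁ ≤ z.re → z.re ≤ c₂ → |z.im| ≤ T →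
      DifferentiableAt ℂ (fun z => quot f g P a (w + z) * kernel D κ z) z := by
    intro z h1 h2 h3
    refine DifferentiableAt.mul ?_ (differentiableAt_kernel D κ (hz0 z h1))
    exact (S.differentiableAt_quot a (hPne z h1 h2 h3)).comp z (differentiableAt_id.const_add w)
  have dΦ : ∀ z : ℂ, c₁ ≤ z.re → z.re ≤ c₂ → |z.im| ≤ T →
      DifferentiableAt ℂ (fun z => f (w + z + a) / f (w + z - a) * kernel D κ z) z := by
    intro z h1 h2 h3
    refine DifferentiableAt.mul (DifferentiableAt.div ?_ ?_ (hfne z h1 h2 h3))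
      (differentiableAt_kernel D κ (hz0 z h1))
    · exact (S.f_diff _).comp z ((differentiableAt_id.const_add w).add_const _)
    · exact (S.f_diff _).comp z ((differentiableAt_id.const_add w).sub_const _)
  have hLl : l / logD D ≤ 1 := by rw [div_le_one hpos]; linarith
  have bquot : ∀ z : ℂ, c₁ ≤ z.re → z.re ≤ c₂ → |z.im| ≤ T → ‖quot f g P a (w + z)‖ ≤ C₀ := by
    intro z h1 h2 h3
    have := hure z h1 h2
    exact hquot (w + z) (by linarith) (by linarith) (huim z h3)
  have bJK : ∀ z : ℂ, c₁ ≤ z.re → z.re ≤ c₂ → |z.im| ≤ T →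
      ‖quotMain f g P Δf Δg a (w + z) - quot f g P a (w + z)‖ ≤ C₁ * (l / logD D) := by
    intro z h1 h2 h3
    have := hure z h1 h2
    exact (hmain (w + z) this.1 this.2 (huim z h3)).2
  have hαc₁ : α / c₁ * l = 5 := by
    rw [hc₁]
    have : l ≠ 0 := by linarith
    field_simp
  have hαc₂ : α / c₂ ≤ 1 := by
    rw [div_le_one hc₂0, hc₂]; linarith
  set X := Real.exp (-l + 1 / 5 * (κ + 1 / 10) * l) with hX
  have hκl : 0 ≤ κ * l := mul_nonneg hκ (by linarith)
  have hlL2 : l ≤ logD D ^ 2 := by nlinarith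
  have step1 : 2 * Real.exp (-4 * logD D ^ 2) ≤ 2 * X := by
    rw [hX]; gcongr; linarith
  -- Here Re(u − a) − 1/2 ≥ 2.8αl, so the dual term is at most exp(−1.9 · 2.8 l) = exp(−5.32 l)
  -- relative to P. The kernel costs exp(3(κ + 1/10)l) ≤ exp(4.3 l).
  have step2 : ‖vint (fun z => f (w + z + a) / f (w + z - a) * kernel D κ z) c₂ T -
      vint (fun z => quotMain f g P Δf Δg a (w + z) * kernel D κ z) c₂ T‖ ≤ 160 * C₀ * X := by
    rw [← vint_sub hT (fun z h1 h2 => dΦ z (by linarith) h1.le h2)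
      (fun z h1 h2 => dJ z (by linarith) h1.le h2)]
    simp only [← sub_mul]
    refine (norm_vint_mul_kernel_le (by linarith) (B := C₀ * (2 * Real.exp (-(532 / 100) * l))) hc₂0
      hc₂1 hT (by positivity) ?_).trans ?_
    · intro z h1 h2
      have hc := hure z (by linarith) h1.le
      have hm := huim z h2
      have h1' : (w + z).re = w.re + c₂ := by rw [add_re, h1]
      have hgne : g (w + z - a) ≠ 0 := by
        have b1 := hLL (w + z - a) (by rw [hre]; linarith) (by rw [hre]; linarith)
          (by rw [him]; linarith)
        have h2i : 2 / logD D = 2 * (1 / logD D) := by ring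
        have b2 := S.P_pos (by linarith) (s := w + z - a) (by rw [hre]; linarith)
          (by rw [hre]; linarith) (by rw [him]; linarith)
        intro h
        rw [h, mul_zero, norm_zero] at b1
        linarith [b1.1]
      rw [div_sub_quotMain (hPne z (by linarith) h1.le h2) (hfne z (by linarith) h1.le h2) hgne,
        norm_neg, norm_mul, norm_div]
      gcongr
      · exact bquot z (by linarith) h1.le h2
      have b1 := hLL (w + z - a) (by rw [hre]; linarith) (by rw [hre]; linarith)
        (by rw [him]; linarith)
      have h2i : 2 / logD D = 2 * (1 / logD D) := by ring
      have h8i : 1 / (8 * logD D) = 1 / 8 * (1 / logD D) := by field_simp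
      have b2 := S.P_pos (by linarith) (s := w + z - a) (by rw [hre]; linarith)
        (by rw [hre]; linarith) (by rw [him]; linarith)
      have b3 := hdual (w + z - a) (by rw [hre]; linarith)
        (by rw [hre, h1', h8i]; linarith) (by rw [him]; linarith)
      rw [div_le_iff₀ (by linarith), dualTerm]
      calc _ ≤ Real.exp (-(532 / 100) * l) * ‖P (w + z - a)‖ := by
            refine b3.trans (mul_le_mul_of_nonneg_right (Real.exp_le_exp.mpr ?_) (norm_nonneg _))
            have t : 28 / 10 * l ≤ logD D ^ 2 * ((w + z - a).re - 1 / 2) := by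
              calc 28 / 10 * l = logD D ^ 2 * (28 / 10 * (α * l)) := by
                    linear_combination -(28 / 10 * l) * hα1
                _ ≤ _ := by
                    gcongr
                    rw [hre, h1']; linarith
            linarith
        _ = 2 * Real.exp (-(532 / 100) * l) * (1 / 2 * ‖P (w + z - a)‖) := by ring
        _ ≤ _ := by gcongr; exact b1.1
    · have e : logD D ^ 2 * ((κ + 1 / 10) * c₂) = 3 * (κ + 1 / 10) * l := by
        rw [hc₂]; linear_combination (3 * (κ + 1 / 10) * l) * hα1
      rw [e]
      calc _ ≤ C₀ * (2 * Real.exp (-(532 / 100) * l)) *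
            (80 * 1 * Real.exp (3 * (κ + 1 / 10) * l)) := by gcongr
        _ = 160 * C₀ * Real.exp (-(532 / 100) * l + 3 * (κ + 1 / 10) * l) := by
            rw [Real.exp_add]; ring
        _ ≤ 160 * C₀ * X := by
            rw [hX]
            have : κ * l ≤ 4 / 3 * l := by gcongr
            refine mul_le_mul_of_nonneg_left (Real.exp_le_exp.mpr ?_) (by positivity)
            linarith
  have step3 : ‖vint (fun z => quotMain f g P Δf Δg a (w + z) * kernel D κ z) c₂ T -
      vint (fun z => quotMain f g P Δf Δg a (w + z) * kernel D κ z) c₁ T‖ ≤ 2 * (C₀ + C₁) * X := by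
    refine (norm_vint_sub_le (ε := (C₀ + C₁) * Real.exp (-14 * logD D ^ 2)) hc₁₂ hT dJ ?_).trans ?_
    · intro z h1 h2 h3
      rw [norm_mul]
      gcongr
      · have b1 := bquot z h1 h2 h3.le
        have b2 := bJK z h1 h2 h3.le
        have b3 := norm_add_le (quotMain f g P Δf Δg a (w + z) - quot f g P a (w + z))
          (quot f g P a (w + z))
        rw [sub_add_cancel] at b3
        have b4 : C₁ * (l / logD D) ≤ C₁ * 1 := by gcongr
        linarith
      · exact norm_kernel_top_le hL hκ hκ' (abs_le.mpr ⟨by linarith, by linarith⟩) h3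
    · calc _ ≤ 2 * ((C₀ + C₁) * Real.exp (-14 * logD D ^ 2)) * 1 := by
            gcongr; linarith
        _ = 2 * (C₀ + C₁) * Real.exp (-14 * logD D ^ 2) := by ring
        _ ≤ _ := by
            rw [hX]
            refine mul_le_mul_of_nonneg_left (Real.exp_le_exp.mpr ?_) (by positivity)
            nlinarith
  -- The factor α/c₁ = 5/l cancels the logarithm in the error l/𝓛.
  have step4 : ‖vint (fun z => quotMain f g P Δf Δg a (w + z) * kernel D κ z) c₁ T -
      vint (fun z => quot f g P a (w + z) * kernel D κ z) c₁ T‖ ≤ 400 * C₁ * X := by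
    rw [← vint_sub hT (fun z h1 h2 => dJ z h1.ge (by linarith) h2)
      (fun z h1 h2 => dK z h1.ge (by linarith) h2)]
    simp only [← sub_mul]
    refine (norm_vint_mul_kernel_le (by linarith) (B := C₁ * (l / logD D)) hc₁0
      (by linarith) hT (by positivity) (fun z h1 h2 => bJK z h1.ge (by linarith) h2)).trans ?_
    have e : logD D ^ 2 * ((κ + 1 / 10) * c₁) = 1 / 5 * (κ + 1 / 10) * l := by
      rw [hc₁]; linear_combination (1 / 5 * (κ + 1 / 10) * l) * hα1
    have e2 : Real.exp (-l) = 1 / logD D := by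
      rw [Real.exp_neg, hldef, Real.exp_log hpos, one_div]
    apply le_of_eq
    rw [e, hX, Real.exp_add, e2]
    calc _ = 80 * C₁ * (α / c₁ * l) * (1 / logD D * Real.exp (1 / 5 * (κ + 1 / 10) * l)) := by ring
      _ = _ := by rw [hαc₁]; ring
  have hs := hshift c₂ (by rw [hc₂]; linarith) hc₂1 w (by rw [hc₂]; linarith) (by linarith) hw2
  have tri : ∀ p q r s t : ℂ, ‖p - t‖ ≤ ‖p - q‖ + ‖q - r‖ + ‖r - s‖ + ‖s - t‖ := by
    intro p q r s t
    have : p - t = (p - q) + (q - r) + (r - s) + (s - t) := by ring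
    rw [this]
    exact (norm_add_le _ _).trans (by gcongr; exact norm_add₃_le)
  refine (tri _ _ _ _ _).trans ((add_le_add (add_le_add (add_le_add (hs.trans step1) step2) step3)
    step4).trans (le_of_eq ?_))
  ring

/-! ### The residue at the origin and the integral to the left. -/

theorem vint_neg (h : ℂ → ℂ) (c T : ℝ) : vint h (-c) T = vint (fun z => h (-z)) c T := by
  have := intervalIntegral.integral_comp_neg (a := -T) (b := T)
    (fun y : ℝ => h (((-c : ℝ) : ℂ) + y * I))
  rw [neg_neg] at this
  unfold vint
  rw [← this]
  congr 1; ext y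
  congr 1; push_cast; ring

theorem conj_vint (h : ℂ → ℂ) (c T : ℝ) :
    conj (vint h c T) = vint (fun z => conj (h (conj z))) c T := by
  have := intervalIntegral.integral_comp_neg (a := -T) (b := T)
    (fun y : ℝ => conj (h ((c : ℂ) + y * I)))
  rw [neg_neg] at this
  unfold vint
  rw [← intervalIntegral.intervalIntegral_conj, ← this]
  congr 1; ext y
  simp

/-- The weight has a simple pole with residue `1` at the origin. -/
theorem exists_weightY_eq_div {D : ℕ} (hD : 1 ≤ logD D) : ∃ y : ℂ → ℂ, Differentiable ℂ y ∧
    y 0 = 1 ∧ ∀ z, weightY D z = y z / z := by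
  set b : ℂ := ((logD D ^ 2 / 10 : ℝ) : ℂ) with hb
  set k : ℂ → ℂ := fun z => 5 * alpha D * (exp (b * z) - exp (-b * z)) with hk
  have hkd : Differentiable ℂ k := by rw [hk]; fun_prop
  refine ⟨fun z => dslope k 0 z * exp (z ^ 2 / 4), ?_, ?_, ?_⟩
  · refine Differentiable.mul ?_ (by fun_prop)
    have := (differentiableOn_dslope (f := k) (c := 0) (s := univ) univ_mem).mpr
      hkd.differentiableOn
    exact differentiableOn_univ.mp this
  · have h1 : HasDerivAt k (5 * alpha D * (exp (b * 0) * (b * 1) - exp (-b * 0) * (-b * 1))) 0 := by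
      rw [hk]
      exact ((((hasDerivAt_id (0 : ℂ)).const_mul b).cexp).sub
        (((hasDerivAt_id (0 : ℂ)).const_mul (-b)).cexp)).const_mul _
    have h2 : (alpha D : ℂ) * (logD D : ℂ) ^ 2 = 1 := by exact_mod_cast alpha_mul_sq hD
    simp only [dslope_same, h1.deriv, hb]
    simp
    linear_combination h2
  · intro z
    rcases eq_or_ne z 0 with rfl | hz
    · simp [weightY]
    · have e1 : ((logD D ^ 2 : ℝ) : ℂ) * (z / 10) = b * z := by rw [hb]; push_cast; ring
      have e2 : ((logD D ^ 2 : ℝ) : ℂ) * (-z / 10) = -b * z := by rw [hb]; push_cast; ring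
      have hk0 : k 0 = 0 := by simp [hk]
      simp only
      rw [weightY, bigQ_cpow, bigQ_cpow, e1, e2, dslope_of_ne _ hz, slope_def_field, hk0]
      field_simp
      simp only [hk]; ring_nf

theorem conj_kernel (D : ℕ) (κ : ℝ) (z : ℂ) : conj (kernel D κ z) = kernel D κ (conj z) := by
  rw [kernel, kernel, map_mul, conj_weightY, ← exp_conj, map_mul, conj_ofReal]

/-- Since Y is odd, reflection yields a sign and Q^{−κz} = Q^{−μz} Q^{(μ−κ)z}. With κ = 4/3 and μ =
2 this produces the dual length Q^{2/3}. -/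
theorem kernel_neg (D : ℕ) (κ μ : ℝ) (z : ℂ) :
    kernel D κ (-z) = -(exp (-(logD D ^ 2 * μ : ℝ) * z) * kernel D (μ - κ) z) := by
  rw [kernel, kernel, weightY_neg, ← mul_assoc, ← exp_add, mul_neg]
  congr 3
  push_cast; ring

/-- `quot` is at most a small power of `log D` near the critical line. -/
theorem eventually_norm_quot_near_le (K : ℝ) (hK : 1 ≤ K) : ∃ C : ℝ, 0 < C ∧ ∀ᶠ D : ℕ in atTop,
    ∀ f g P Δf Δg : ℂ → ℂ, Setting K D f g P Δf Δg → ∀ a : ℝ, a = alpha D ∨ a = -alpha D →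
    ∀ u : ℂ, |u.re - 1 / 2| ≤ 1 / 10 * (alpha D * Real.log (logD D)) → |u.im - D| ≤ 9 * logD D →
    ‖quot f g P a u‖ ≤ C * Real.exp (1 / 5 * Real.log (logD D)) := by
  obtain ⟨C, hC, hquot⟩ := eventually_norm_quot_le K hK
  refine ⟨Real.exp 2 * C, by positivity, ?_⟩
  filter_upwards [hquot, eventually_norm_dualRatio_le K hK, eventually_le_logD 10,
    eventually_le_log_logD 10, eventually_mul_log_le 100 (δ := 1) (by norm_num)] with
    D hquot hdual hL hl hlL f g P Δf Δg S a ha u h1 h2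
  have hpos : 0 < logD D := by linarith
  have hα := alpha_pos (by linarith : 1 ≤ logD D)
  have hα1 := alpha_mul_sq (by linarith : 1 ≤ logD D)
  have hαl := alpha_mul_log_le hL hlL
  have hi : 0 < 1 / logD D := by positivity
  have hi1 : 1 / logD D ≤ 1 / 10 := one_div_le_one_div_of_le (by norm_num) hL
  have h2i : 2 / logD D = 2 * (1 / logD D) := by ring
  set l := Real.log (logD D) with hldef
  have h1' := abs_le.mp h1
  have he : 1 ≤ Real.exp (1 / 5 * l) := Real.one_le_exp (by linarith)
  have he2 : 1 ≤ Real.exp 2 := Real.one_le_exp (by norm_num)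
  rcases le_or_gt (1 / 2) u.re with hu | hu
  · refine (hquot f g P Δf Δg S a ha u hu (by linarith) h2).trans ?_
    calc C = 1 * C * 1 := by ring
      _ ≤ _ := by gcongr
  · have hP := norm_pos_iff.mp (S.P_pos (by linarith) (s := 1 - conj u) (by simp; linarith)
      (by simp; linarith) (by simp; linarith))
    rw [S.quot_eq a (by linarith) hP, norm_mul, norm_conj]
    have b1 := hdual f g P Δf Δg S a (abs_eq_alpha (by linarith) ha).le (by nlinarith) u
      (by linarith [mul_pos hα (by linarith : 0 < l)]) (by linarith)
    have b2 := hquot f g P Δf Δg S (-a) (by rcases ha with rfl | rfl <;> simp) (1 - conj u)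
      (by simp; linarith) (by simp; linarith) (by simpa using h2)
    have b3 : Real.exp (-(2 * logD D ^ 2) * (u.re - 1 / 2)) ≤ Real.exp (1 / 5 * l) := by
      rw [Real.exp_le_exp]
      calc _ = 2 * logD D ^ 2 * (1 / 2 - u.re) := by ring
        _ ≤ 2 * logD D ^ 2 * (1 / 10 * (alpha D * l)) := by gcongr; linarith
        _ = 1 / 5 * l := by linear_combination 1 / 5 * l * hα1
    calc _ ≤ Real.exp 2 * Real.exp (1 / 5 * l) * C :=
          mul_le_mul (b1.trans (by gcongr)) b2 (norm_nonneg _) (by positivity)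
      _ = _ := by ring

/-- Cauchy's formula for `quot` against the kernel. -/
theorem eventually_quot_residue (K : ℝ) (hK : 1 ≤ K) : ∃ C : ℝ, 0 < C ∧ ∀ᶠ D : ℕ in atTop,
    ∀ f g P Δf Δg : ℂ → ℂ, Setting K D f g P Δf Δg → ∀ a : ℝ, a = alpha D ∨ a = -alpha D →
    ∀ κ : ℝ, 0 ≤ κ → κ ≤ 4 / 3 → ∀ w : ℂ,
    |w.re - 1 / 2| ≤ 1 / 10 * (alpha D * Real.log (logD D)) → |w.im - D| ≤ 2 →
    ‖vint (fun z => quot f g P a (w + z) * kernel D κ z) (1 / 5 * alpha D * Real.log (logD D))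
        (8 * logD D) -
      vint (fun z => quot f g P a (w + z) * kernel D κ z) (-(1 / 5 * alpha D * Real.log (logD D)))
        (8 * logD D) - 2 * Real.pi * quot f g P a w‖ ≤
      C * Real.exp (-Real.log (logD D)) := by
  obtain ⟨C, hC, hnear⟩ := eventually_norm_quot_near_le K hK
  refine ⟨1 + C, by positivity, ?_⟩
  filter_upwards [hnear, eventually_le_logD 10, eventually_le_log_logD 100,
    eventually_mul_log_le 100 (δ := 1) (by norm_num)] with
    D hnear hL hl hlL f g P Δf Δg S a ha κ hκ hκ' w hw1 hw2
  have hpos : 0 < logD D := by linarith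
  have hα := alpha_pos (by linarith : 1 ≤ logD D)
  have hα3 := alpha_le_hundredth hL
  have haα := abs_eq_alpha (by linarith) ha
  have hi : 0 < 1 / logD D := by positivity
  have hi1 : 1 / logD D ≤ 1 / 10 := one_div_le_one_div_of_le (by norm_num) hL
  have h2i : 2 / logD D = 2 * (1 / logD D) := by ring
  have hαl := alpha_mul_log_le hL hlL
  have hel : Real.exp (Real.log (logD D)) = logD D := Real.exp_log hpos
  obtain ⟨y, hy, hy0, hyY⟩ := exists_weightY_eq_div (by linarith : 1 ≤ logD D)
  have hnw := hnear f g P Δf Δg S a ha w hw1 (by linarith)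
  set l := Real.log (logD D) with hldef
  set c := 1 / 5 * alpha D * l with hc
  have hαl0 : 100 * alpha D ≤ alpha D * l := by nlinarith
  have hc0 : 0 < c := by rw [hc]; linarith
  have hw1' := abs_le.mp hw1
  have hw2' := abs_le.mp hw2
  have hu1 : ∀ z : ℂ, -c ≤ z.re → z.re ≤ c → 1 / 2 - 1 / logD D ≤ (w + z).re ∧
      (w + z).re ≤ 7 / 5 := by
    intro z h1 h2
    rw [add_re]; constructor <;> linarith
  have hu2 : ∀ z : ℂ, |z.im| ≤ 8 * logD D → |(w + z).im - D| ≤ 11 * logD D := by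
    intro z h
    have h := abs_le.mp h
    rw [abs_le, add_im]; constructor <;> linarith
  set h : ℂ → ℂ := fun z => quot f g P a (w + z) * (exp ((logD D ^ 2 * κ : ℝ) * z) * y z) with hh
  have hhz : (fun z => quot f g P a (w + z) * kernel D κ z) = fun z => h z / z := by
    ext z
    rw [kernel, hyY, hh]
    ring
  have hh0 : h 0 = quot f g P a w := by simp [hh, hy0]
  -- The first term bounds the integrand on the horizontal sides (exponents 5 − 14); the second is
  -- there so that Tε dominates the value at the pole.
  set ε := Real.exp (-9 * logD D ^ 2) + C * Real.exp (1 / 5 * l) / (8 * logD D) with hε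
  have key := rect_residue (h := h) (c := c) (T := 8 * logD D) (ε := ε) hc0 (by positivity) ?_ ?_ ?_
  · rw [hhz, ← hh0]
    refine key.trans ?_
    have hc1 : 12 * c ≤ 1 := by rw [hc]; linarith
    have e1 : Real.exp (-9 * logD D ^ 2) ≤ Real.exp (-l) := by
      rw [Real.exp_le_exp]; nlinarith
    have e2 : C * Real.exp (1 / 5 * l) / (8 * logD D) * (12 * c) ≤ C * Real.exp (-l) := by
      have hcl : 12 * c ≤ 3 * (l * Real.exp (-l) * Real.exp (-l)) := by
        have : alpha D = Real.exp (-l) * Real.exp (-l) := by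
          rw [Real.exp_neg, hel, alpha]; field_simp
        rw [hc, this]
        have : 0 ≤ Real.exp (-l) * Real.exp (-l) * l := by positivity
        linarith
      have hle : l * Real.exp (-l) ≤ 1 := by
        rw [Real.exp_neg, hel, mul_inv_le_iff₀ hpos]; linarith
      have h5 : Real.exp (1 / 5 * l) / (8 * logD D) ≤ 1 / 8 := by
        rw [div_le_iff₀ (by positivity), ← hel]
        have : Real.exp (1 / 5 * l) ≤ Real.exp l := Real.exp_le_exp.mpr (by linarith)
        linarith
      calc _ = C * (Real.exp (1 / 5 * l) / (8 * logD D)) * (12 * c) := by ring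
        _ ≤ C * (1 / 8) * (3 * (1 * Real.exp (-l))) := by
          refine mul_le_mul (by gcongr) (hcl.trans ?_) (by positivity) (by positivity)
          gcongr
        _ ≤ C * Real.exp (-l) := by nlinarith [mul_pos hC (Real.exp_pos (-l))]
    calc 12 * ε * c = Real.exp (-9 * logD D ^ 2) * (12 * c) +
          C * Real.exp (1 / 5 * l) / (8 * logD D) * (12 * c) := by rw [hε]; ring
      _ ≤ Real.exp (-l) * 1 + C * Real.exp (-l) := by gcongr
      _ = _ := by ring
  · intro z h1 h2 h3
    have hP := S.P_pos (by linarith) (s := w + z) (by linarith [(hu1 z h1 h2).1]) (hu1 z h1 h2).2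
      (by linarith [hu2 z h3])
    refine DifferentiableAt.mul ?_ (DifferentiableAt.mul (by fun_prop) (hy z))
    exact (S.differentiableAt_quot a (norm_pos_iff.mp hP)).comp z (differentiableAt_id.const_add w)
  · intro z h1 h2 h3
    have e : quot f g P a (w + z) * kernel D κ z = h z / z := congrFun hhz z
    rw [← e, norm_mul]
    have b1 := S.norm_quot_le hL (by linarith) (by linarith) haα.le (hu1 z h1 h2).1 (hu1 z h1 h2).2
      (hu2 z h3.le)
    have b2 := norm_kernel_top_le hL hκ hκ' (z := z)
      (abs_le.mpr ⟨by linarith, by linarith⟩) h3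
    calc _ ≤ Real.exp (5 * logD D ^ 2) * Real.exp (-14 * logD D ^ 2) := by gcongr
      _ = Real.exp (-9 * logD D ^ 2) := by rw [← Real.exp_add]; ring_nf
      _ ≤ ε := by rw [hε]; linarith [(by positivity : 0 ≤ C * Real.exp (1 / 5 * l) / (8 * logD D))]
  · rw [hh0]
    refine hnw.trans ?_
    have : 0 ≤ 8 * logD D * Real.exp (-9 * logD D ^ 2) := by positivity
    have e : 8 * logD D * ε = 8 * logD D * Real.exp (-9 * logD D ^ 2) + C * Real.exp (1 / 5 * l) := by
      rw [hε]; field_simp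
    linarith

theorem vint_const_mul (b : ℂ) (h : ℂ → ℂ) (c T : ℝ) :
    vint (fun z => b * h z) c T = b * vint h c T := by
  unfold vint
  exact intervalIntegral.integral_const_mul _ _

/-- The squared logarithm is at most 1250 e^{l/25}, and 1 − 53/150 − 1/25 = 91/150 exceeds 3/5. This
is the tightest point of the whole error analysis. -/
theorem sq_mul_exp_le {l : ℝ} (hl : 0 ≤ l) :
    l ^ 2 * Real.exp (-l + 53 / 150 * l) ≤ 1250 * Real.exp (-(3 / 5) * l) := by
  have h1 := Real.quadratic_le_exp_of_nonneg (by positivity : 0 ≤ 1 / 25 * l)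
  have h2 : l ^ 2 ≤ 1250 * Real.exp (1 / 25 * l) := by nlinarith
  calc _ ≤ 1250 * Real.exp (1 / 25 * l) * Real.exp (-l + 53 / 150 * l) := by gcongr
    _ = 1250 * Real.exp (1 / 25 * l + (-l + 53 / 150 * l)) := by rw [Real.exp_add (1 / 25 * l)]; ring
    _ ≤ _ := by gcongr; linarith

set_option maxHeartbeats 2000000 in
/-- The integral to the left of the critical line, transformed by the functional equation. -/
theorem eventually_vint_left (K : ℝ) (hK : 1 ≤ K) : ∃ C : ℝ, 0 < C ∧ ∀ᶠ D : ℕ in atTop,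
    ∀ f g P Δf Δg : ℂ → ℂ, Setting K D f g P Δf Δg → ∀ a : ℝ, a = alpha D ∨ a = -alpha D →
    ∀ ρ : ℂ, f ρ * g ρ = 0 → |ρ.im - D| < 1 →
    ∀ s : ℂ, ‖s‖ + alpha D ≤ 1 / 10 * alpha D * Real.log (logD D) →
    ‖vint (fun z => quot f g P a (ρ + s + z) * kernel D (4 / 3) z)
        (-(1 / 5 * alpha D * Real.log (logD D))) (8 * logD D) -
      exp (-(2 * logD D ^ 2 : ℝ) * s) *
        conj (vint (fun z => quot f g P (-a) (1 - conj (ρ + s) + z) * kernel D (2 / 3) z)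
          (1 / 5 * alpha D * Real.log (logD D)) (8 * logD D))‖ ≤
      C * Real.exp (-(3 / 5) * Real.log (logD D)) := by
  obtain ⟨C₀, hC₀, hquot⟩ := eventually_norm_quot_le K hK
  obtain ⟨C₁, hC₁, hdual⟩ := eventually_dualRatio K hK
  refine ⟨240 * C₀ * C₁ * 1250, by positivity, ?_⟩
  filter_upwards [hquot, hdual, eventually_zero_near K, eventually_le_logD 10,
    eventually_le_log_logD 100, eventually_mul_log_le 100 (δ := 1) (by norm_num)] with
    D hquot hdual hzero hL hl hlL f g P Δf Δg S a ha ρ h0 h1 s hs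
  have hpos : 0 < logD D := by linarith
  have hα := alpha_pos (by linarith : 1 ≤ logD D)
  have hα1 := alpha_mul_sq (by linarith : 1 ≤ logD D)
  have hα3 := alpha_le_hundredth hL
  have haα := abs_eq_alpha (by linarith) ha
  have hi : 0 < 1 / logD D := by positivity
  have hi1 : 1 / logD D ≤ 1 / 10 := one_div_le_one_div_of_le (by norm_num) hL
  have h2i : 2 / logD D = 2 * (1 / logD D) := by ring
  have hαl := alpha_mul_log_le hL hlL
  have hel : Real.exp (Real.log (logD D)) = logD D := Real.exp_log hpos
  have hρ := abs_lt.mp (hzero f g P Δf Δg S ρ h0 h1)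
  replace hdual := hdual f g P Δf Δg S a haα.le ρ h0 h1 s hs
  replace hquot := hquot f g P Δf Δg S (-a) (by rcases ha with rfl | rfl <;> simp)
  set l := Real.log (logD D) with hldef
  set c := 1 / 5 * alpha D * l with hc
  have hT : 0 ≤ 8 * logD D := by positivity
  have hαl0 : 100 * alpha D ≤ alpha D * l := by nlinarith
  have hc0 : 0 < c := by rw [hc]; linarith
  have h1' := abs_lt.mp h1
  have hs0 := norm_nonneg s
  have hs1 := abs_le.mp (abs_re_le_norm s)
  have hs2 := abs_le.mp (abs_im_le_norm s)
  set w := ρ + s with hw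
  have hwre : w.re = ρ.re + s.re := by rw [hw, add_re]
  have hwim : w.im = ρ.im + s.im := by rw [hw, add_im]
  have hrefl : ∀ z : ℂ, 1 - conj (w - z) = 1 - conj w + conj z := fun z => by
    rw [map_sub]; ring
  have hre : ∀ z : ℂ, (1 - conj w + conj z).re = 1 - w.re + z.re := fun z => by simp
  have him : ∀ z : ℂ, (1 - conj w + conj z).im = w.im - z.im := fun z => by
    simp [sub_eq_add_neg]
  have hv1 : ∀ z : ℂ, z.re = c → 1 / 2 ≤ (1 - conj w + conj z).re ∧
      (1 - conj w + conj z).re ≤ 6 / 10 := by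
    intro z hz
    rw [hre, hwre, hz, hc]; constructor <;> linarith
  have hv2 : ∀ z : ℂ, |z.im| ≤ 8 * logD D → |(1 - conj w + conj z).im - D| ≤ 9 * logD D := by
    intro z hz
    have hz := abs_le.mp hz
    rw [him, hwim, abs_le]; constructor <;> linarith
  have hz0 : ∀ z : ℂ, z.re = c → z ≠ 0 := by
    rintro z hz rfl
    rw [zero_re] at hz; linarith
  have hP1 : ∀ z : ℂ, z.re = c → |z.im| ≤ 8 * logD D → P (1 - conj w + conj z) ≠ 0 := by
    intro z h1 h2
    have a1 := hv1 z h1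
    have a2 := hv2 z h2
    exact norm_pos_iff.mp (S.P_pos (by linarith) (by linarith) (by linarith) (by linarith))
  have hP2 : ∀ z : ℂ, z.re = c → |z.im| ≤ 8 * logD D → P (w - z) ≠ 0 := by
    intro z h1 h2
    have a1 := hv1 z h1
    have a2 := hv2 z h2
    rw [him] at a2
    rw [hre] at a1
    exact norm_pos_iff.mp (S.P_pos (by linarith) (by rw [sub_re]; linarith)
      (by rw [sub_re]; linarith) (by rw [sub_im]; linarith))
  rw [vint_neg, conj_vint, ← vint_const_mul]
  rw [← vint_sub hT]
  rotate_left
  · intro z h1 h2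
    refine DifferentiableAt.mul ?_ ?_
    · have : DifferentiableAt ℂ (quot f g P a) (w + -z) :=
        S.differentiableAt_quot a (by rw [← sub_eq_add_neg]; exact hP2 z h1 h2)
      exact this.comp z (differentiableAt_id.neg.const_add w)
    · have : DifferentiableAt ℂ (kernel D (4 / 3)) (-z) :=
        differentiableAt_kernel D _ (neg_ne_zero.mpr (hz0 z h1))
      exact this.comp z differentiableAt_id.neg
  · intro z h1 h2
    refine DifferentiableAt.const_mul ?_ _
    have : DifferentiableAt ℂ (fun z => quot f g P (-a) (1 - conj w + z) * kernel D (2 / 3) z)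
        (conj z) := by
      refine DifferentiableAt.mul ?_ (differentiableAt_kernel D _ (by simpa using hz0 z h1))
      have := S.differentiableAt_quot (-a) (hP1 z h1 h2)
      exact this.comp (conj z) (differentiableAt_id.const_add (1 - conj w))
    have := this.conj_conj
    rwa [conj_conj] at this
  -- The exponent 53/150 is 1/5 from Q^{−2s}, as ‖s‖ ≤ αl/10, plus (2/3 + 1/10)/5 = 23/150 from the
  -- kernel at Re z = αl/5. One factor ‖z‖ from the error of `dualRatio` leaves an integrand of
  -- order 1/‖z‖, whose integral costs one more logarithm.
  set B := 20 * C₀ * C₁ * (alpha D * logD D * l) * Real.exp (53 / 150 * l) with hB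
  have hcont : Continuous (fun y : ℝ => 2 * B * (1 / (c + |y|))) := by
    have : ∀ y : ℝ, c + |y| ≠ 0 := fun y => by positivity
    fun_prop (disch := exact this _)
  refine (norm_vint_le hT (hcont.intervalIntegrable _ _) ?_).trans ?_
  · intro y hy
    set z : ℂ := (c : ℂ) + y * I with hz
    have hzre : z.re = c := by simp [hz]
    have hzim : z.im = y := by simp [hz]
    have hzT : |z.im| ≤ 8 * logD D := by rwa [hzim]
    have hzn : 0 < ‖z‖ := norm_pos_iff.mpr (hz0 z hzre)
    have b1 := hdual z hzre hzT
    have b2 := hquot (1 - conj w + conj z) (hv1 z hzre).1 (by linarith [(hv1 z hzre).2]) (hv2 z hzT)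
    have b3 := norm_kernel_le (by linarith : 1 ≤ logD D) (2 / 3) z
    -- After z ↦ −z the difference of integrands is exactly the error of `dualRatio` times bounded
    -- factors, because Q^{−2(s − z)} Q^{−2z} = Q^{−2s}.
    have e : quot f g P a (w + -z) * kernel D (4 / 3) (-z) - exp (-(2 * logD D ^ 2 : ℝ) * s) *
        conj (quot f g P (-a) (1 - conj w + conj z) * kernel D (2 / 3) (conj z)) =
        -((dualRatio P Δf Δg a (w - z) + exp (-(2 * logD D ^ 2 : ℝ) * (s - z))) *
          conj (quot f g P (-a) (1 - conj w + conj z)) *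
          (exp (-(logD D ^ 2 * 2 : ℝ) * z) * kernel D (2 / 3) z)) := by
      have h3 : exp (-(2 * logD D ^ 2 : ℝ) * s) = exp (-(2 * logD D ^ 2 : ℝ) * (s - z)) *
          exp (-(logD D ^ 2 * 2 : ℝ) * z) := by
        rw [← exp_add]; congr 1; push_cast; ring
      rw [← sub_eq_add_neg, S.quot_eq a (u := w - z) _ (by rw [hrefl]; exact hP1 z hzre hzT), hrefl,
        kernel_neg D (4 / 3) 2, map_mul, conj_kernel, conj_conj, h3]
      · rw [show (2 - 4 / 3 : ℝ) = 2 / 3 by norm_num]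
        ring
      · have := hv2 z hzT
        rw [him] at this
        rw [sub_im]; linarith
    rw [e, norm_neg, norm_mul, norm_mul, norm_mul, norm_conj]
    have h4 : ‖exp (-(logD D ^ 2 * 2 : ℝ) * z)‖ = Real.exp (-(2 * logD D ^ 2 * c)) := by
      rw [← ofReal_neg, norm_exp_ofReal_mul, hzre]; ring_nf
    rw [hzre, hzim, abs_of_pos hc0] at b3
    have h5 : Real.exp ((c ^ 2 - y ^ 2) / 4) ≤ 2 := by
      have : Real.exp ((c ^ 2 - y ^ 2) / 4) ≤ Real.exp (1 / 4) :=
        Real.exp_le_exp.mpr (by nlinarith [sq_nonneg y])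
      have h2 := Real.exp_bound_div_one_sub_of_interval (by norm_num : (0 : ℝ) ≤ 1 / 4)
        (by norm_num)
      norm_num at h2
      linarith
    have h6 : logD D ^ 2 * (2 / 3 * c + c / 10) = 23 / 150 * l := by
      rw [hc]; linear_combination (23 / 150 * l) * hα1
    have h7 : Real.exp (2 * logD D ^ 2 * (c - s.re)) ≤
        Real.exp (2 * logD D ^ 2 * c) * Real.exp (1 / 5 * l) := by
      rw [← Real.exp_add, Real.exp_le_exp]
      have : logD D ^ 2 * -s.re ≤ logD D ^ 2 * (1 / 10 * alpha D * l) := by gcongr; linarith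
      have e : logD D ^ 2 * (1 / 10 * alpha D * l) = 1 / 10 * l := by
        linear_combination (1 / 10 * l) * hα1
      linarith
    rw [h6] at b3
    rw [hzre] at b1
    have hcy : c + |y| ≤ 2 * ‖z‖ := by
      have a1 := re_le_norm z
      have a2 := abs_im_le_norm z
      rw [hzre] at a1
      rw [hzim] at a2
      linarith
    calc _ ≤ (C₁ * (logD D * l) * ‖z‖ * (Real.exp (2 * logD D ^ 2 * c) * Real.exp (1 / 5 * l))) * C₀ *
          (Real.exp (-(2 * logD D ^ 2 * c)) *
            (10 * alpha D * Real.exp (23 / 150 * l) * 2 / ‖z‖ ^ 2)) := by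
          rw [h4]
          gcongr
          · exact b1.trans (by gcongr)
          · exact b3.trans (by gcongr)
      _ = B * (1 / ‖z‖) := by
          have e1 : Real.exp (2 * logD D ^ 2 * c) * Real.exp (-(2 * logD D ^ 2 * c)) = 1 := by
            rw [← Real.exp_add]; simp
          have e2 : Real.exp (53 / 150 * l) = Real.exp (1 / 5 * l) * Real.exp (23 / 150 * l) := by
            rw [← Real.exp_add]; ring_nf
          rw [hB, e2]
          generalize Real.exp (2 * logD D ^ 2 * c) = E₁ at e1 ⊢
          generalize Real.exp (-(2 * logD D ^ 2 * c)) = E₂ at e1 ⊢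
          field_simp
          linear_combination 20 * e1
      _ ≤ B * (2 / (c + |y|)) := by
          gcongr ?_ * ?_
          rw [div_le_div_iff₀ hzn (by positivity)]
          linarith
      _ = _ := by ring
  · rw [intervalIntegral.integral_const_mul]
    have hlog : Real.log (2 * (8 * logD D) / c) ≤ 3 * l := by
      have : (2 * (8 * logD D) / c) ≤ logD D ^ 3 := by
        rw [div_le_iff₀ hc0, hc]
        have e : logD D ^ 3 * (1 / 5 * alpha D * l) = 1 / 5 * l * logD D := by
          linear_combination (1 / 5 * l * logD D) * hα1
        rw [e]
        nlinarith
      calc _ ≤ Real.log (logD D ^ 3) := Real.log_le_log (by positivity) this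
        _ = 3 * l := by rw [Real.log_pow, ← hldef]; norm_num
    have hI := integral_one_div_norm_le hc0 (T := 8 * logD D) (by rw [hc]; linarith)
    have hαL : alpha D * logD D = Real.exp (-l) := by
      rw [alpha_mul (by linarith), Real.exp_neg, hel, one_div]
    calc 2 * B * ∫ y in (-(8 * logD D))..(8 * logD D), 1 / (c + |y|) ≤ 2 * B * (2 * (3 * l)) := by
          gcongr
          exact hI.trans (by gcongr)
      _ = 240 * C₀ * C₁ * (l ^ 2 * Real.exp (-l + 53 / 150 * l)) := by
          rw [hB, hαL, Real.exp_add]; ring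
      _ ≤ 240 * C₀ * C₁ * (1250 * Real.exp (-(3 / 5) * l)) := by
          exact mul_le_mul_of_nonneg_left (sq_mul_exp_le (by linarith)) (by positivity)
      _ = _ := by ring

theorem norm_exp_neg_mul_le {D : ℕ} (hD : 1 ≤ logD D) {s : ℂ}
    (hs : ‖s‖ ≤ 1 / 10 * alpha D * Real.log (logD D)) :
    ‖exp (-(2 * logD D ^ 2 : ℝ) * s)‖ ≤ Real.exp (1 / 5 * Real.log (logD D)) := by
  rw [← ofReal_neg, norm_exp_ofReal_mul, Real.exp_le_exp]
  have h := (neg_le_of_abs_le (abs_re_le_norm s))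
  have e : logD D ^ 2 * (1 / 10 * alpha D * Real.log (logD D)) = 1 / 10 * Real.log (logD D) := by
    linear_combination (1 / 10 * Real.log (logD D)) * alpha_mul_sq hD
  have : logD D ^ 2 * -s.re ≤ logD D ^ 2 * (1 / 10 * alpha D * Real.log (logD D)) := by
    gcongr; linarith
  linarith

/-! ### Assembly, and return to Dirichlet polynomials. -/

/-- `quot` near a zero, in terms of integrals of `f(s + a) / f(s - a)`. -/
theorem eventually_quot_eq (K : ℝ) (hK : 1 ≤ K) : ∃ C : ℝ, 0 < C ∧ ∀ᶠ D : ℕ in atTop,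
    ∀ f g P Δf Δg : ℂ → ℂ, Setting K D f g P Δf Δg → ∀ a : ℝ, a = alpha D ∨ a = -alpha D →
    ∀ ρ : ℂ, f ρ * g ρ = 0 → |ρ.im - D| < 1 →
    ∀ s : ℂ, ‖s‖ + alpha D ≤ 1 / 10 * alpha D * Real.log (logD D) →
    |(ρ + s).re - 1 / 2| ≤ 1 / 10 ∧
    ‖2 * Real.pi * quot f g P a (ρ + s) -
      (vint (fun z => f (ρ + s + z + a) / f (ρ + s + z - a) * kernel D (4 / 3) z) 1 (8 * logD D) -
        exp (-(2 * logD D ^ 2 : ℝ) * s) *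
          conj (vint (fun z => f (1 - conj (ρ + s) + z + (-a : ℝ)) /
            f (1 - conj (ρ + s) + z - (-a : ℝ)) * kernel D (2 / 3) z) 1 (8 * logD D)))‖ ≤
      C * Real.exp (-(3 / 5) * Real.log (logD D)) := by
  obtain ⟨C₁, hC₁, h₁⟩ := eventually_quot_residue K hK
  obtain ⟨C₂, hC₂, h₂⟩ := eventually_vint_left K hK
  obtain ⟨C₃, hC₃, h₃⟩ := eventually_vint_div K hK
  refine ⟨C₁ + C₂ + 2 * C₃, by positivity, ?_⟩
  filter_upwards [h₁, h₂, h₃, eventually_zero_near K, eventually_le_logD 10,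
    eventually_le_log_logD 100, eventually_mul_log_le 100 (δ := 1) (by norm_num)] with
    D h₁ h₂ h₃ hzero hL hl hlL f g P Δf Δg S a ha ρ h0 h1 s hs
  have hα := alpha_pos (by linarith : 1 ≤ logD D)
  have hα3 := alpha_le_hundredth hL
  have hi1 : 1 / logD D ≤ 1 / 10 := one_div_le_one_div_of_le (by norm_num) hL
  have hαl := alpha_mul_log_le hL hlL
  have hρ := abs_lt.mp (hzero f g P Δf Δg S ρ h0 h1)
  have hs0 := norm_nonneg s
  have hs1 := abs_le.mp (abs_re_le_norm s)
  have hs2 := abs_le.mp (abs_im_le_norm s)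
  have h1' := abs_lt.mp h1
  have hw1 : |(ρ + s).re - 1 / 2| ≤ 1 / 10 * (alpha D * Real.log (logD D)) := by
    rw [add_re, abs_le]; constructor <;> linarith
  have hw2 : |(ρ + s).im - D| ≤ 2 := by
    rw [add_im, abs_le]; constructor <;> linarith
  have hw1' : |(1 - conj (ρ + s)).re - 1 / 2| ≤ 1 / 10 * alpha D * Real.log (logD D) := by
    have e : (1 - conj (ρ + s)).re - 1 / 2 = -((ρ + s).re - 1 / 2) := by
      simp only [sub_re, one_re, conj_re]; ring
    rw [e, abs_neg, mul_assoc]; exact hw1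
  have hw2' : |(1 - conj (ρ + s)).im - D| ≤ 2 := by
    simpa [add_comm] using hw2
  have ha' : -a = alpha D ∨ -a = -alpha D := by rcases ha with rfl | rfl <;> simp
  have b1 := h₁ f g P Δf Δg S a ha (4 / 3) (by norm_num) le_rfl (ρ + s) hw1 hw2
  have b2 := h₂ f g P Δf Δg S a ha ρ h0 h1 s hs
  have b3 := h₃ f g P Δf Δg S a ha (4 / 3) (by norm_num) le_rfl (ρ + s)
    (by rw [mul_assoc]; exact hw1) hw2
  have b4 := h₃ f g P Δf Δg S (-a) ha' (2 / 3) (by norm_num) (by norm_num) (1 - conj (ρ + s)) hw1' hw2'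
  have b5 := norm_exp_neg_mul_le (by linarith : 1 ≤ logD D) (s := s) (by linarith)
  refine ⟨hw1.trans (by linarith), ?_⟩
  clear h₁ h₂ h₃
  set l := Real.log (logD D) with hldef
  set V₁ := vint (fun z => quot f g P a (ρ + s + z) * kernel D (4 / 3) z) (1 / 5 * alpha D * l)
    (8 * logD D)
  set V₂ := vint (fun z => quot f g P a (ρ + s + z) * kernel D (4 / 3) z) (-(1 / 5 * alpha D * l))
    (8 * logD D)
  set V₃ := vint (fun z => quot f g P (-a) (1 - conj (ρ + s) + z) * kernel D (2 / 3) z)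
    (1 / 5 * alpha D * l) (8 * logD D)
  set V₄ := vint (fun z => f (ρ + s + z + a) / f (ρ + s + z - a) * kernel D (4 / 3) z) 1 (8 * logD D)
  set V₅ := vint (fun z => f (1 - conj (ρ + s) + z + (-a : ℝ)) /
            f (1 - conj (ρ + s) + z - (-a : ℝ)) * kernel D (2 / 3) z) 1 (8 * logD D)
  set e := exp (-(2 * logD D ^ 2 : ℝ) * s)
  set q := quot f g P a (ρ + s)
  -- The four errors are the residue formula, the transformed left integral, and the passage between
  -- f(u + a)/f(u − a) and `quot` for the main and for the dual integral.
  have key : 2 * Real.pi * q - (V₄ - e * conj V₅) =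
      -(V₁ - V₂ - 2 * Real.pi * q) - (V₂ - e * conj V₃) - (V₄ - V₁) + e * conj (V₅ - V₃) := by
    rw [map_sub]; ring
  have b6 : ‖e * conj (V₅ - V₃)‖ ≤ C₃ * Real.exp (-(3 / 5) * l) := by
    rw [norm_mul, norm_conj]
    calc _ ≤ Real.exp (1 / 5 * l) * (C₃ * Real.exp (-l + 1 / 5 * (2 / 3 + 1 / 10) * l)) := by gcongr
      _ = C₃ * Real.exp (1 / 5 * l + (-l + 1 / 5 * (2 / 3 + 1 / 10) * l)) := by
          rw [Real.exp_add (1 / 5 * l)]; ring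
      _ ≤ _ := mul_le_mul_of_nonneg_left (Real.exp_le_exp.mpr (by linarith)) hC₃.le
  have b7 : C₁ * Real.exp (-l) ≤ C₁ * Real.exp (-(3 / 5) * l) :=
    mul_le_mul_of_nonneg_left (Real.exp_le_exp.mpr (by linarith)) hC₁.le
  have b8 : C₃ * Real.exp (-l + 1 / 5 * (4 / 3 + 1 / 10) * l) ≤ C₃ * Real.exp (-(3 / 5) * l) :=
    mul_le_mul_of_nonneg_left (Real.exp_le_exp.mpr (by linarith)) hC₃.le
  rw [key]
  refine (norm_add_le _ _).trans ((add_le_add ((norm_sub_le _ _).trans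
    (add_le_add ((norm_sub_le _ _).trans (add_le_add (norm_neg _).le le_rfl)) le_rfl)) le_rfl).trans ?_)
  linarith

theorem conj_zetaRatioCoeff (a : ℝ) (n : ℕ) : conj (zetaRatioCoeff a n) = zetaRatioCoeff a n := by
  rw [zetaRatioCoeff, LSeries.convolution_def, map_sum]
  refine Finset.sum_congr rfl fun p _ => ?_
  simp [conj_natCast_cpow]

theorem conj_smoothTerm (D : ℕ) {k : ℕ} [NeZero k] (ψ : DirichletCharacter ℂ k) (a κ : ℝ) (w : ℂ)
    {n : ℕ} (hn : n ≠ 0) :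
    conj (smoothTerm D ψ a κ w n) = smoothTerm D ψ⁻¹ a κ (conj w) n := by
  have hx : 0 < bigQ D ^ κ / n :=
    div_pos (Real.rpow_pos_of_pos (Real.exp_pos _) _) (by exact_mod_cast Nat.pos_of_ne_zero hn)
  simp only [smoothTerm, map_mul, map_div₀]
  rw [conj_zetaRatioCoeff, conj_natCast_cpow, conj_vartheta D hx, inv_apply_eq_conj]

/-- Dropping the floor gives 3R ≤ l/10 − 3π/2, and the term −3π/2 makes room for the extra α. -/
theorem three_omega_add_alpha_le {D : ℕ} (hD : 1 ≤ logD D) :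
    3 * omega D + alpha D ≤ 1 / 10 * alpha D * Real.log (logD D) := by
  have hα := alpha_pos hD
  have hπ := Real.pi_gt_three
  have h : bigR D ≤ Real.log (logD D) / 30 - Real.pi / 2 := by
    rw [bigR]
    have := Int.floor_le (Real.log (logD D) / (30 * Real.pi))
    have : Real.pi * ⌊Real.log (logD D) / (30 * Real.pi)⌋ ≤
        Real.pi * (Real.log (logD D) / (30 * Real.pi)) := by gcongr
    have e : Real.pi * (Real.log (logD D) / (30 * Real.pi)) = Real.log (logD D) / 30 := by
      field_simp
    linarith
  have h2 : alpha D * bigR D ≤ alpha D * (Real.log (logD D) / 30 - Real.pi / 2) := by gcongr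
  rw [omega]
  nlinarith

theorem bigQ_rpow_le_floor_add_one {D : ℕ} {x y : ℝ} (hxy : x ≤ y) :
    bigQ D ^ x ≤ (⌊bigQ D ^ y⌋₊ : ℝ) + 1 := by
  refine le_trans ?_ (Nat.lt_floor_add_one _).le
  exact Real.rpow_le_rpow_of_exponent_le (Real.one_le_exp (by positivity)) hxy

/-- Both assertions at once: the sign of a selects 𝓚₊ or 𝓚₋ and interchanges λ₊ and λ₋. -/
theorem eventually_quot_smooth_sum : ∃ C : ℝ, 0 < C ∧ ∀ᶠ D : ℕ in atTop, ∀ [NeZero D]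
    (χ : DirichletCharacter ℂ D), (∀ a : ZMod D, (χ a).im = 0) →
    ∀ (q : ℕ) [NeZero q] (ψ : DirichletCharacter ℂ q), MemPsiStar χ ψ →
    ∀ a : ℝ, a = alpha D ∨ a = -alpha D → ∀ ρ ∈ zeroSet χ ψ, ∀ s : ℂ, ‖s‖ ≤ 3 * omega D →
    ‖quot (LFunction ψ) (LFunction (ψ.mul χ)) (F χ ψ) a (ρ + s) -
      ((∑ n ∈ Finset.Icc 1 ⌊bigQ D ^ (3 / 2 : ℝ)⌋₊, smoothTerm D ψ a (4 / 3) (ρ + s) n) -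
        (bigQ D : ℂ) ^ (-2 * s) *
          ∑ n ∈ Finset.Icc 1 ⌊bigQ D⌋₊, smoothTerm D ψ⁻¹ (-a) (2 / 3) (1 - ρ - s) n)‖ ≤
      C * logD D ^ (-(3 / 5) : ℝ) := by
  obtain ⟨K, hK, hset⟩ := exists_setting
  obtain ⟨C₁, hC₁, h₁⟩ := eventually_quot_eq K hK
  obtain ⟨C₂, hC₂, h₂⟩ := exists_smooth_sum_approx
  refine ⟨C₁ + 2 * C₂, by positivity, ?_⟩
  filter_upwards [hset, h₁, eventually_le_logD 10, eventually_le_log_logD 100,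
    eventually_mul_log_le 100 (δ := 1) (by norm_num)] with
    D hset h₁ hL hl hlL _ χ hχ q _ ψ hψ a ha ρ hρ s hs
  have S := hset χ hχ q ψ hψ
  have hα := alpha_pos (by linarith : 1 ≤ logD D)
  have hα3 := alpha_le_hundredth hL
  have haα := abs_eq_alpha (by linarith) ha
  have hω := three_omega_add_alpha_le (by linarith : 1 ≤ logD D)
  have hs' : ‖s‖ + alpha D ≤ 1 / 10 * alpha D * Real.log (logD D) := by linarith
  obtain ⟨hw, b1⟩ := h₁ _ _ _ _ _ S a ha ρ hρ.1 hρ.2 s hs'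
  have hw' := abs_le.mp hw
  have hψ1 : ψ ≠ 1 := by
    refine ne_one_of_isPrimitive hψ.memPsi.primitive ?_
    rintro rfl
    have := hψ.memPsi.lt_modulus
    have h1 : 1 < bigQ D := Real.one_lt_exp_iff.mpr (by positivity)
    norm_num at this; linarith
  -- The lengths fit the tail estimate: 4/3 + 1/6 = 3/2, and 2/3 + 1/6 ≤ 1 for the dual sum.
  have b2 := h₂ D (by linarith) q ψ a (4 / 3) (ρ + s) ⌊bigQ D ^ (3 / 2 : ℝ)⌋₊ hψ1 (by linarith) le_rfl
    (by linarith) (bigQ_rpow_le_floor_add_one (by norm_num))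
  have b3 := h₂ D (by linarith) q ψ (-a) (2 / 3) (1 - conj (ρ + s)) ⌊bigQ D⌋₊ hψ1
    (by rw [abs_neg]; linarith) (by norm_num) (by
      simp only [sub_re, one_re, conj_re]; linarith)
    (by simpa using bigQ_rpow_le_floor_add_one (D := D) (x := 2 / 3 + 1 / 6) (y := 1) (by norm_num))
  have b4 := norm_exp_neg_mul_le (by linarith : 1 ≤ logD D) (s := s) (by linarith)
  have e1 : (bigQ D : ℂ) ^ (-2 * s) = exp (-(2 * logD D ^ 2 : ℝ) * s) := by
    rw [bigQ_cpow]; congr 1; push_cast; ring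
  have e2 : ∑ n ∈ Finset.Icc 1 ⌊bigQ D⌋₊, smoothTerm D ψ⁻¹ (-a) (2 / 3) (1 - ρ - s) n =
      conj (∑ n ∈ Finset.Icc 1 ⌊bigQ D⌋₊, smoothTerm D ψ (-a) (2 / 3) (1 - conj (ρ + s)) n) := by
    rw [map_sum]
    refine Finset.sum_congr rfl fun n hn => ?_
    rw [conj_smoothTerm D ψ _ _ _ (by have := (Finset.mem_Icc.mp hn).1; lia)]
    congr 1
    simp; ring
  rw [← exp_mul_log_logD (by linarith), e1, e2]
  clear h₁ h₂ hset
  set l := Real.log (logD D) with hldef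
  set V₁ := vint (fun z => LFunction ψ (ρ + s + z + a) / LFunction ψ (ρ + s + z - a) *
    kernel D (4 / 3) z) 1 (8 * logD D)
  set V₂ := vint (fun z => LFunction ψ (1 - conj (ρ + s) + z + (-a : ℝ)) /
    LFunction ψ (1 - conj (ρ + s) + z - (-a : ℝ)) * kernel D (2 / 3) z) 1 (8 * logD D)
  set A₁ := ∑ n ∈ Finset.Icc 1 ⌊bigQ D ^ (3 / 2 : ℝ)⌋₊, smoothTerm D ψ a (4 / 3) (ρ + s) n
  set A₂ := ∑ n ∈ Finset.Icc 1 ⌊bigQ D⌋₊, smoothTerm D ψ (-a) (2 / 3) (1 - conj (ρ + s)) n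
  set e := exp (-(2 * logD D ^ 2 : ℝ) * s)
  set q' := quot (LFunction ψ) (LFunction (ψ.mul χ)) (F χ ψ) a (ρ + s)
  have hπ : (Real.pi : ℂ) ≠ 0 := ofReal_ne_zero.mpr Real.pi_ne_zero
  have hconj : conj ((1 : ℂ) / (2 * Real.pi) * V₂) = 1 / (2 * Real.pi) * conj V₂ := by
    simp [map_ofNat]
  have key : q' - (A₁ - e * conj A₂) = 1 / (2 * Real.pi) * (2 * Real.pi * q' - (V₁ - e * conj V₂)) -
      (A₁ - 1 / (2 * Real.pi) * V₁) + e * conj (A₂ - 1 / (2 * Real.pi) * V₂) := by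
    rw [map_sub, hconj]
    field_simp
    ring
  have hπ2 : ‖(1 : ℂ) / (2 * Real.pi)‖ ≤ 1 := by
    rw [norm_div, norm_one, norm_mul, norm_ofNat, norm_real, Real.norm_of_nonneg Real.pi_pos.le,
      div_le_one (by positivity)]
    linarith [Real.pi_gt_three]
  have hlL2 : l ≤ logD D ^ 2 := by nlinarith
  have c1 : C₂ * Real.exp (-(logD D ^ 2)) ≤ C₂ * Real.exp (-(3 / 5) * l) := by
    gcongr; linarith
  have c2 : ‖e * conj (A₂ - 1 / (2 * Real.pi) * V₂)‖ ≤ C₂ * Real.exp (-(3 / 5) * l) := by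
    rw [norm_mul, norm_conj]
    calc _ ≤ Real.exp (1 / 5 * l) * (C₂ * Real.exp (-(logD D ^ 2))) := by gcongr
      _ = C₂ * Real.exp (1 / 5 * l + -(logD D ^ 2)) := by rw [Real.exp_add]; ring
      _ ≤ _ := mul_le_mul_of_nonneg_left (Real.exp_le_exp.mpr (by linarith)) hC₂.le
  have c3 : ‖1 / (2 * Real.pi) * (2 * Real.pi * q' - (V₁ - e * conj V₂))‖ ≤
      C₁ * Real.exp (-(3 / 5) * l) := by
    rw [norm_mul]
    calc _ ≤ 1 * (C₁ * Real.exp (-(3 / 5) * l)) := by gcongr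
      _ = _ := one_mul _
  rw [key]
  refine (norm_add_le _ _).trans ((add_le_add ((norm_sub_le _ _).trans
    (add_le_add c3 (b2.trans c1))) c2).trans (le_of_eq ?_))
  ring

end LandauSiegel

theorem lemma4p4 :
    ∃ (C : ℝ) (D₀ : ℕ), ∀ (D : ℕ) [NeZero D], D₀ ≤ D →
      ∀ χ : DirichletCharacter ℂ D, χ.IsPrimitive → (∀ a : ZMod D, (χ a).im = 0) →
      ∀ (q : ℕ) [NeZero q] (ψ : DirichletCharacter ℂ q), MemPsiStar χ ψ →
      ∀ ρ ∈ zeroSet χ ψ, ∀ s : ℂ, ‖s‖ ≤ 3 * omega D →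
        ‖Kplus χ ψ (ρ + s) -
            ((∑ n ∈ Finset.Icc 1 ⌊bigQ D ^ (3 / 2 : ℝ)⌋₊,
                lambdaPlus D n * ψ n / (n : ℂ) ^ (ρ + s) *
                  vartheta D (bigQ D ^ (4 / 3 : ℝ) / n)) -
              (bigQ D : ℂ) ^ (-2 * s) *
                ∑ n ∈ Finset.Icc 1 ⌊bigQ D⌋₊,
                  lambdaMinus D n * ψ⁻¹ n / (n : ℂ) ^ (1 - ρ - s) *
                    vartheta D (bigQ D ^ (2 / 3 : ℝ) / n))‖
          ≤ C * logD D ^ (-(3 / 5) : ℝ) ∧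
        ‖Kminus χ ψ (ρ + s) -
            ((∑ n ∈ Finset.Icc 1 ⌊bigQ D ^ (3 / 2 : ℝ)⌋₊,
                lambdaMinus D n * ψ n / (n : ℂ) ^ (ρ + s) *
                  vartheta D (bigQ D ^ (4 / 3 : ℝ) / n)) -
              (bigQ D : ℂ) ^ (-2 * s) *
                ∑ n ∈ Finset.Icc 1 ⌊bigQ D⌋₊,
                  lambdaPlus D n * ψ⁻¹ n / (n : ℂ) ^ (1 - ρ - s) *
                    vartheta D (bigQ D ^ (2 / 3 : ℝ) / n))‖
          ≤ C * logD D ^ (-(3 / 5) : ℝ) := by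
  obtain ⟨C, -, h⟩ := eventually_quot_smooth_sum
  obtain ⟨D₀, h⟩ := Filter.eventually_atTop.mp h
  refine ⟨C, D₀, fun D _ hD χ _ hχ q _ ψ hψ ρ hρ s hs => ⟨?_, ?_⟩⟩
  · have := h D hD χ hχ q ψ hψ (alpha D) (Or.inl rfl) ρ hρ s hs
    simpa only [quot, smoothTerm, Kplus, lambdaPlus, lambdaMinus] using this
  · have := h D hD χ hχ q ψ hψ (-alpha D) (Or.inr rfl) ρ hρ s hs
    simpa only [quot, smoothTerm, Kminus, lambdaPlus, lambdaMinus, neg_neg, ofReal_neg,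
      sub_neg_eq_add, ← sub_eq_add_neg] using this
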